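/- Let $F$ be a field of characteristic zero with algebraic closure $\overline F$, and let $p\ge q\ge 1$ be integers with $p=q+1$ or $p=q$. Let $J_r$ be the $r\times r$ matrix with ones on the antidiagonal and zeros elsewhere, and put $J_{p,q}=\begin{pmatrix}J_p&0\\0&-J_q\end{pmatrix}$ and $I_{p,q}=\begin{pmatrix}1_p&0\\0&-1_q\end{pmatrix}$. Let $G=\mathrm O(J_{p,q})=\{g\in\mathrm{GL}_{p+q}: gJ_{p,q}g^t=J_{p,q}\}$, with Lie algebra $\mathfrak g=\{X\in\mathfrak{gl}_{p+q}: X^tJ_{p,q}+J_{p,q}X=0\}$, and let $\theta$ be conjugation by $I_{p,q}$ on $G$ and on $\mathfrak g$. Let $G(1)\subseteq G$ be the subgroup fixed by $\theta$, let $\mathfrak g(-1)$ be the $(-1)$-eigenspace of $\theta$ on $\mathfrak g$, and for $e\in\mathfrak g(-1)(F)$ put $\mathfrak g(-1)^e=\{X\in\mathfrak g(-1)(F):[e,X]=0\}$. A Cartan subspace is a subspace of $\mathfrak g(-1)(F)$ that is maximal among the commutative subspaces consisting of semisimple matrices, and $\mathrm{rank}\,\theta$ is its dimension; $\mathrm{rank}\,G$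 is the dimension of a maximal torus of $G_{\overline F}$. An element $X\in\mathfrak g(-1)(\overline F)$ is relatively regular if the orbit of $X$ under conjugation by $G(1)(\overline F)$ has maximal dimension among all $G(1)(\overline F)$-orbits in $\mathfrak g(-1)(\overline F)$. Define a block matrix $e$ as follows. * If $p=q+1$, let $e=\begin{pmatrix}0&A\\B&0\end{pmatrix}$, where $A=\begin{pmatrix}1_q\\0_{1,q}\end{pmatrix}$ and $B=\begin{pmatrix}0_{q,1}&1_q\end{pmatrix}$. * If $p=q$, let $e=\begin{pmatrix}0&e^*\\J_q(e^*)^tJ_q&0\end{pmatrix}$, where $e^*$ is the $q\times q$ matrix obtained from $1_q$ by shifting the entries $1$ of the first $\lceil q/2\rceil$ rows to the right by one column (for $q=1$ the entry is shifted out and $e^*=0$). Then in both cases $e\in\mathfrak g(-1)(F)$, the matrix $e$ is nilpotent, all Cartan subspaces of $\mathfrak g(-1)(F)$ have the same dimension, all maximal tori of $G_{\overline F}$ have the same dimension, $$\dim_F\mathfrak g(-1)^e=q=\mathrm{rank}\,\theta=\mathrm{rank}\,G,$$ and $e$ is relatively regular. -/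

import Mathlib

open Matrix

noncomputable section

namespace OrthSymm

attribute [local instance 100] LieRing.ofAssociativeRing

/-- The antidiagonal matrix `J_r`, with ones on the antidiagonal and zeros elsewhere. -/
def antiDiag (F : Type*) [Field F] (r : ℕ) : Matrix (Fin r) (Fin r) F :=
  Matrix.of fun i j => if j = Fin.rev i then 1 else 0

/-- The symmetric matrix `J_{p,q} = diag(J_p, -J_q)`. -/
def Jpq (F : Type*) [Field F] (p q : ℕ) : Matrix (Fin p ⊕ Fin q) (Fin p ⊕ Fin q) F :=
  fromBlocks (antiDiag F p) 0 0 (-antiDiag F q)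

/-- The matrix `I_{p,q} = diag(1_p, -1_q)`, as an invertible matrix. -/
def Ipq (F : Type*) [Field F] (p q : ℕ) : GL (Fin p ⊕ Fin q) F where
  val := fromBlocks 1 0 0 (-1)
  inv := fromBlocks 1 0 0 (-1)
  val_inv := by simp [fromBlocks_multiply]
  inv_val := by simp [fromBlocks_multiply]

/-- The points over a field `R` of the orthogonal group `O(J)`. For `J` invertible the condition
`g J gᵗ = J` is the same as `J g⁻ᵗ J⁻¹ = g`. -/
def orthGroup {n R : Type*} [Fintype n] [DecidableEq n] [Field R] (J : Matrix n n R) :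
    Subgroup (GL n R) where
  carrier := {g | (g : Matrix n n R) * J * (g : Matrix n n R)ᵀ = J}
  one_mem' := by simp
  mul_mem' := by
    intro a b ha hb
    simp only [Set.mem_ofPred_eq] at ha hb ⊢
    calc _ = (a : Matrix n n R) * ((b : Matrix n n R) * J * (b : Matrix n n R)ᵀ)
          * (a : Matrix n n R)ᵀ := by
          simp [Matrix.transpose_mul, Matrix.mul_assoc]
      _ = J := by rw [hb, ha]
  inv_mem' := by
    intro a ha
    simp only [Set.mem_ofPred_eq] at ha ⊢
    have h1 : ((a⁻¹ : GL n R) : Matrix n n R) * (a : Matrix n n R) = 1 := by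
      rw [← Units.val_mul]; simp
    have h2 : (a : Matrix n n R)ᵀ * ((a⁻¹ : GL n R) : Matrix n n R)ᵀ = 1 := by
      rw [← Matrix.transpose_mul, h1, Matrix.transpose_one]
    calc _ = ((a⁻¹ : GL n R) : Matrix n n R) * ((a : Matrix n n R) * J * (a : Matrix n n R)ᵀ)
          * ((a⁻¹ : GL n R) : Matrix n n R)ᵀ := by rw [ha]
      _ = (((a⁻¹ : GL n R) : Matrix n n R) * (a : Matrix n n R)) * J
          * ((a : Matrix n n R)ᵀ * ((a⁻¹ : GL n R) : Matrix n n R)ᵀ) := by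
          simp only [Matrix.mul_assoc]
      _ = J := by rw [h1, h2, Matrix.one_mul, Matrix.mul_one]

/-- The involution `θ(g) = I_{p,q} g I_{p,q}⁻¹`. -/
def theta (F : Type*) [Field F] (p q : ℕ) : GL (Fin p ⊕ Fin q) F ≃* GL (Fin p ⊕ Fin q) F :=
  MulAut.conj (Ipq F p q)

/-- The group `G(1)` of `θ`-invariant elements of `G = O(J_{p,q})`. -/
def groupOne (F : Type*) [Field F] (p q : ℕ) : Subgroup (GL (Fin p ⊕ Fin q) F) :=
  orthGroup (Jpq F p q) ⊓ (theta F p q).toMonoidHom.eqLocus (MonoidHom.id _)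

/-- The Lie algebra `𝔤 = 𝔬(J_{p,q})`, consisting of the matrices `X` with `Xᵗ J = J (-X)`. -/
def orthLie (F : Type*) [Field F] (p q : ℕ) :
    LieSubalgebra F (Matrix (Fin p ⊕ Fin q) (Fin p ⊕ Fin q) F) :=
  skewAdjointMatricesLieSubalgebra (Jpq F p q)

/-- The `(-1)`-eigenspace `𝔤(-1)` of the involution `X ↦ I_{p,q} X I_{p,q}⁻¹` of `𝔤`. -/
def gMinus (F : Type*) [Field F] (p q : ℕ) :
    Submodule F (Matrix (Fin p ⊕ Fin q) (Fin p ⊕ Fin q) F) where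
  carrier := {X | X ∈ orthLie F p q ∧
    (Ipq F p q).val * X * ((Ipq F p q)⁻¹).val = -X}
  zero_mem' := by simp
  add_mem' := by
    rintro X Y ⟨hX, hX'⟩ ⟨hY, hY'⟩
    refine ⟨add_mem hX hY, ?_⟩
    rw [Matrix.mul_add, Matrix.add_mul, hX', hY', neg_add]
  smul_mem' := by
    rintro c X ⟨hX, hX'⟩
    refine ⟨(orthLie F p q).smul_mem c hX, ?_⟩
    rw [Matrix.mul_smul, Matrix.smul_mul, hX', smul_neg]

/-- The centralizer `𝔤(-1)^e` of `e` in `𝔤(-1)`. -/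
def gMinusCentralizer {F : Type*} [Field F] (p q : ℕ)
    (e : Matrix (Fin p ⊕ Fin q) (Fin p ⊕ Fin q) F) :
    Submodule F (Matrix (Fin p ⊕ Fin q) (Fin p ⊕ Fin q) F) where
  carrier := {X | X ∈ gMinus F p q ∧ ⁅e, X⁆ = 0}
  zero_mem' := by simp
  add_mem' := by
    rintro X Y ⟨hX, hX'⟩ ⟨hY, hY'⟩
    exact ⟨add_mem hX hY, by rw [lie_add, hX', hY', add_zero]⟩
  smul_mem' := by
    rintro c X ⟨hX, hX'⟩
    exact ⟨(gMinus F p q).smul_mem c hX, by rw [lie_smul, hX', smul_zero]⟩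

/-- A commutative subspace of `𝔤(-1)` which consists of semisimple elements. -/
def IsToralSubspace {F : Type*} [Field F] (p q : ℕ)
    (t : Submodule F (Matrix (Fin p ⊕ Fin q) (Fin p ⊕ Fin q) F)) : Prop :=
  t ≤ gMinus F p q ∧ (∀ X ∈ t, ∀ Y ∈ t, ⁅X, Y⁆ = 0) ∧
    ∀ X ∈ t, Module.End.IsSemisimple (Matrix.toLin' X)

/-- A Cartan subspace of `𝔤(-1)`. -/
def IsCartanSubspace {F : Type*} [Field F] (p q : ℕ)
    (t : Submodule F (Matrix (Fin p ⊕ Fin q) (Fin p ⊕ Fin q) F)) : Prop :=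
  Maximal (IsToralSubspace p q) t

/-- `rank θ = r`: Cartan subspaces of `𝔤(-1)` exist and all of them have dimension `r`. -/
def RankThetaEq (F : Type*) [Field F] (p q r : ℕ) : Prop :=
  (∃ t : Submodule F (Matrix (Fin p ⊕ Fin q) (Fin p ⊕ Fin q) F), IsCartanSubspace p q t) ∧
    ∀ t : Submodule F (Matrix (Fin p ⊕ Fin q) (Fin p ⊕ Fin q) F),
      IsCartanSubspace p q t → Module.finrank F t = r

/-- The set of points of the affine space `K ^ (n × n)` given by the matrices in `S`. -/
def points {n K : Type*} (S : Set (Matrix n n K)) : Set (n × n → K) :=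
  (fun (M : Matrix n n K) (ij : n × n) => M ij.1 ij.2) '' S

/-- The dimension of a set `S` of matrices over an algebraically closed field, that is, the Krull
dimension of the coordinate ring of its Zariski closure. -/
def zariskiDim {n K : Type*} [Field K] (S : Set (Matrix n n K)) : WithBot ℕ∞ :=
  ringKrullDim (MvPolynomial (n × n) K ⧸ MvPolynomial.vanishingIdeal K (points S))

/-- The orbit of `X` under the action of a subgroup of `GL_n` by conjugation. -/
def conjOrbit {n K : Type*} [Fintype n] [DecidableEq n] [Field K] (H : Subgroup (GL n K))
    (X : Matrix n n K) : Set (Matrix n n K) :=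
  {Y | ∃ g ∈ H, Y = (g : Matrix n n K) * X * ((g⁻¹ : GL n K) : Matrix n n K)}

/-- For `K` algebraically closed: `X ∈ 𝔤(-1)(K)` is relatively regular if its `G(1)(K)`-orbit is of
maximal dimension among all `G(1)(K)`-orbits in `𝔤(-1)(K)`. -/
def IsRelativelyRegular {K : Type*} [Field K] (p q : ℕ)
    (X : Matrix (Fin p ⊕ Fin q) (Fin p ⊕ Fin q) K) : Prop :=
  X ∈ gMinus K p q ∧ ∀ Y ∈ gMinus K p q,
    zariskiDim (conjOrbit (groupOne K p q) Y) ≤ zariskiDim (conjOrbit (groupOne K p q) X)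

/-- The matrices belonging to a subgroup of `GL_n`. -/
def matrixSet {n K : Type*} [Fintype n] [DecidableEq n] [Field K] (T : Subgroup (GL n K)) :
    Set (Matrix n n K) :=
  (fun g : GL n K => (g : Matrix n n K)) '' (T : Set (GL n K))

/-- For `K` algebraically closed: a torus in `GL_n`, that is, a Zariski closed, connected,
diagonalizable subgroup. A closed subgroup is connected if and only if it is irreducible, that is,
its vanishing ideal is prime. -/
def IsTorus {n K : Type*} [Fintype n] [DecidableEq n] [Field K] (T : Subgroup (GL n K)) : Prop :=
  (∀ g : GL n K, (fun ij : n × n => (g : Matrix n n K) ij.1 ij.2) ∈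
      MvPolynomial.zeroLocus K (MvPolynomial.vanishingIdeal K (points (matrixSet T))) → g ∈ T) ∧
  (MvPolynomial.vanishingIdeal K (points (matrixSet T))).IsPrime ∧
  ∃ h : GL n K, ∀ g ∈ T, ((h * g * h⁻¹ : GL n K) : Matrix n n K).IsDiag

/-- For `K` algebraically closed: the algebraic group `G ≤ GL_n` has rank `r`, that is, maximal
tori of `G` exist and all of them have dimension `r`. -/
def GroupRankEq {n K : Type*} [Fintype n] [DecidableEq n] [Field K] (G : Subgroup (GL n K))
    (r : ℕ) : Prop :=
  (∃ T, Maximal (fun T : Subgroup (GL n K) => T ≤ G ∧ IsTorus T) T) ∧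
    ∀ T, Maximal (fun T : Subgroup (GL n K) => T ≤ G ∧ IsTorus T) T →
      zariskiDim (matrixSet T) = (r : WithBot ℕ∞)

/-- The element `e` for `p = q + 1`: the upper right block is `1_q` followed by a zero row, the
lower left block is a zero column followed by `1_q`. -/
def eOdd (F : Type*) [Field F] (q : ℕ) :
    Matrix (Fin (q + 1) ⊕ Fin q) (Fin (q + 1) ⊕ Fin q) F :=
  fromBlocks 0 (Matrix.of fun i j => if i = j.castSucc then 1 else 0)
    (Matrix.of fun i j => if j = i.succ then 1 else 0) 0

/-- The matrix `e*`: the identity matrix with the first `⌈q/2⌉` entries `1` shifted to the right by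
one column (for `q = 1` the single entry is shifted out, and `e* = 0`). Indices start at `0`. -/
def eStar (F : Type*) [Field F] (q : ℕ) : Matrix (Fin q) (Fin q) F :=
  Matrix.of fun i j =>
    if (j : ℕ) = (if (i : ℕ) < (q + 1) / 2 then (i : ℕ) + 1 else (i : ℕ)) then 1 else 0

/-- The element `e` for `p = q`. -/
def eEven (F : Type*) [Field F] (q : ℕ) : Matrix (Fin q ⊕ Fin q) (Fin q ⊕ Fin q) F :=
  fromBlocks 0 (eStar F q) (antiDiag F q * (eStar F q)ᵀ * antiDiag F q) 0

end OrthSymm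

end

open OrthSymm

open OrthSymm

universe u

/-! An element of 𝔤(-1) is `offDiag A` for a p × q block A, its other block being the adjoint A♯ =
`sharp A`. Most questions about it reduce to the self-adjoint q × q matrix T = A♯A
(`aeval_fromBlocks_odd`). For both choices of e, T is strictly upper triangular with nonzero
superdiagonal, so e is nilpotent and T has a cyclic vector. A skew matrix commuting with a cyclic
self-adjoint matrix is zero, hence the centralizer of e in 𝔤(1) vanishes
(`eq_zero_of_skew_of_intertwine`). By duality under the trace form, ad e maps 𝔤(-1) onto 𝔤(1)
(`adSkew_surjective`), and the kernel has dimension pq - p(p-1)/2 - q(q-1)/2, which is q because p -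
q is 0 or 1.

Relative regularity: no orbit has larger dimension than G(1), and the orbit of e attains it
(`zariskiDim_le_conjOrbit`). Dimension is measured by algebraically independent functions, via
Noether normalization. At a generic point g of G(1), a derivation killing the entries of g e g⁻¹
kills those of g, since g⁻¹ D(g) centralizes e; so the entries of g are algebraic over those of g e
g⁻¹.

rank θ: over the algebraic closure, the joint eigenvectors of a toral subspace give a simultaneous
singular value decomposition (`exists_singular_pairs`), so the subspace commutes with a regular
semisimple `offDiag A`. Being regular is the nonvanishing of a polynomial, and this brings A down to
F (`exists_isRegPair_of_map`). The centralizer of a regular element consists of the odd polynomials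
in it and is toral of dimension q, so every Cartan subspace is such a centralizer.

rank G: a torus is connected, so it fixes every non-isotropic joint eigenvector. This yields a
hyperbolic basis of joint eigenvectors (`exists_hyperbolic_basis`), so the torus lies in a split
torus with entries t, t⁻¹ and possibly 1. Split tori are maximal of dimension q. -/

/-! ### Krull dimension and algebraically independent elements. -/

/-- Incomparability: in an integral extension, contraction of primes is strictly monotone. -/
theorem ringKrullDim_le_of_isIntegral (R S : Type*) [CommRing R] [CommRing S] [Algebra R S]
    [Algebra.IsIntegral R S] : ringKrullDim S ≤ ringKrullDim R := by
  refine Order.krullDim_le_of_strictMono (PrimeSpectrum.comap (algebraMap R S)) ?_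
  intro P Q h
  exact Ideal.IsIntegral.comap_lt_comap (R := R) (I := P.asIdeal) (J := Q.asIdeal) h

/-- Going up, prime by prime from the bottom; keeping track of the contraction of the last prime
makes the induction run. Injectivity only starts the chain, by providing a prime over the first one.
-/
theorem exists_ltSeries_comap_of_isIntegral {R S : Type*} [CommRing R] [CommRing S] [Algebra R S]
    [Algebra.IsIntegral R S] (hinj : Function.Injective (algebraMap R S))
    (p : LTSeries (PrimeSpectrum R)) :
    ∃ q : LTSeries (PrimeSpectrum S), q.length = p.length ∧
      PrimeSpectrum.comap (algebraMap R S) q.last = p.last := by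
  induction p using RelSeries.inductionOn' with
  | singleton x =>
    obtain ⟨Q, -, hQ, h⟩ := Ideal.exists_ideal_over_prime_of_isIntegral (S := S) x.asIdeal ⊥
      (by rw [← RingHom.ker_eq_comap_bot, (RingHom.injective_iff_ker_eq_bot _).1 hinj]; simp)
    exact ⟨RelSeries.singleton _ ⟨Q, hQ⟩, rfl, PrimeSpectrum.ext h⟩
  | snoc p x hx ih =>
    obtain ⟨q, hl, hq⟩ := ih
    have hlt : p.last < x := hx
    obtain ⟨Q, hle, hQ, h⟩ := Ideal.exists_ideal_over_prime_of_isIntegral (S := S) x.asIdeal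
      q.last.asIdeal (by
        have := congrArg PrimeSpectrum.asIdeal hq
        rw [PrimeSpectrum.comap_asIdeal] at this
        rw [this]
        exact hlt.le)
    have hlt' : q.last < (⟨Q, hQ⟩ : PrimeSpectrum S) := by
      refine lt_of_le_of_ne hle fun e => hlt.ne ?_
      rw [← hq, e]
      exact PrimeSpectrum.ext h
    refine ⟨q.snoc ⟨Q, hQ⟩ hlt', by simp [hl], ?_⟩
    rw [RelSeries.last_snoc, RelSeries.last_snoc]
    exact PrimeSpectrum.ext h

theorem ringKrullDim_eq_of_isIntegral {R S : Type*} [CommRing R] [CommRing S] [Algebra R S]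
    [Algebra.IsIntegral R S] (hinj : Function.Injective (algebraMap R S)) :
    ringKrullDim S = ringKrullDim R := by
  refine le_antisymm (ringKrullDim_le_of_isIntegral R S) (iSup_le fun p => ?_)
  obtain ⟨q, hl, -⟩ := exists_ltSeries_comap_of_isIntegral hinj p
  rw [← hl]
  exact le_iSup (fun l : LTSeries (PrimeSpectrum S) => ((l.length : ℕ∞) : WithBot ℕ∞)) q

/-- Noether normalization in terms of algebraically independent elements. -/
theorem exists_algebraicIndependent_ringKrullDim_eq (k A : Type*) [Field k] [CommRing A]
    [Nontrivial A] [Algebra k A] [Algebra.FiniteType k A] :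
    ∃ (d : ℕ) (x : Fin d → A), ringKrullDim A = d ∧ AlgebraicIndependent k x ∧
      Algebra.IsIntegral (Algebra.adjoin k (Set.range x)) A := by
  obtain ⟨s, g, hg, hint⟩ := exists_integral_inj_algHom_of_fg k A
  refine ⟨s, fun i => g (MvPolynomial.X i), ?_, ?_, ?_⟩
  · let _ := g.toRingHom.toAlgebra
    have : Algebra.IsIntegral (MvPolynomial (Fin s) k) A := ⟨hint⟩
    rw [ringKrullDim_eq_of_isIntegral (R := MvPolynomial (Fin s) k) (S := A) hg,
      MvPolynomial.ringKrullDim_of_isNoetherianRing, ringKrullDim_eq_zero_of_field]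
    simp
  · exact (MvPolynomial.algebraicIndependent_X (Fin s) k).map' hg
  · constructor
    intro a
    obtain ⟨p, hp, h0⟩ := hint a
    have hmem : ∀ f, g f ∈ Algebra.adjoin k (Set.range fun i => g (MvPolynomial.X i)) := by
      intro f
      induction f using MvPolynomial.induction_on with
      | C c =>
        rw [← MvPolynomial.algebraMap_eq, g.commutes]
        exact Subalgebra.algebraMap_mem _ c
      | add f h hf hh => rw [map_add]; exact add_mem hf hh
      | mul_X f i hf =>
        rw [map_mul]
        exact mul_mem hf (Algebra.subset_adjoin ⟨i, rfl⟩)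
    let φ : MvPolynomial (Fin s) k →ₐ[k]
        Algebra.adjoin k (Set.range fun i => g (MvPolynomial.X i)) := g.codRestrict _ hmem
    refine ⟨p.map φ.toRingHom, hp.map _, ?_⟩
    rw [Polynomial.eval₂_map]
    exact h0

/-- In a domain the variables of a Noether normalization form a transcendence basis, and no
independent family is longer than that. -/
theorem natCast_le_ringKrullDim_of_isDomain {k A : Type*} [Field k] [CommRing A] [IsDomain A]
    [Algebra k A] [Algebra.FiniteType k A] {d : ℕ} {x : Fin d → A}
    (hx : AlgebraicIndependent k x) : (d : WithBot ℕ∞) ≤ ringKrullDim A := by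
  obtain ⟨s, y, hs, hy, hint⟩ := exists_algebraicIndependent_ringKrullDim_eq k A
  have halg : Algebra.IsAlgebraic (Algebra.adjoin k (Set.range y)) A :=
    Algebra.IsIntegral.isAlgebraic
  have hb : IsTranscendenceBasis k y :=
    isTranscendenceBasis_iff_algebraicIndependent_isAlgebraic.2 ⟨hy, halg⟩
  have h1 := hx.lift_cardinalMk_le_trdeg
  have h2 := hb.lift_cardinalMk_eq_trdeg
  simp only [Cardinal.mk_fin, Cardinal.lift_natCast, Cardinal.lift_uzero] at h1 h2
  rw [← h2] at h1
  have hds : d ≤ s := by exact_mod_cast h1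
  rw [hs]
  exact_mod_cast hds

/-- Algebraically independent elements stay independent modulo a suitable prime ideal. -/
theorem exists_isPrime_forall_ne_zero {k A : Type*} [Field k] [CommRing A] [Algebra k A]
    {ι : Type*} {x : ι → A} (hx : AlgebraicIndependent k x) :
    ∃ P : Ideal A, P.IsPrime ∧
      ∀ f : MvPolynomial ι k, MvPolynomial.aeval x f ∈ P → f = 0 := by
  let φ : MvPolynomial ι k →ₐ[k] A := MvPolynomial.aeval x
  have hφ : Function.Injective φ := hx
  have hmin : (⊥ : Ideal (MvPolynomial ι k)) ∈
      ((⊥ : Ideal A).comap φ.toRingHom).minimalPrimes := by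
    have h0 : (⊥ : Ideal A).comap φ.toRingHom = ⊥ := by
      rw [← RingHom.ker_eq_comap_bot]
      exact (RingHom.injective_iff_ker_eq_bot _).1 hφ
    rw [h0]
    exact ⟨⟨Ideal.isPrime_bot, le_rfl⟩, fun _ _ _ => bot_le⟩
  -- The zero ideal is a minimal prime over the contraction of the zero ideal, and minimal primes
  -- over a contraction are themselves contractions of primes.
  obtain ⟨P, hP, -, hPc⟩ := Ideal.exists_comap_eq_of_mem_minimalPrimes φ.toRingHom _ hmin
  refine ⟨P, hP, fun f hf => ?_⟩
  have : f ∈ P.comap φ.toRingHom := hf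
  rwa [hPc] at this

theorem algebraicIndependent_comp_of_ker {k A D : Type*} [Field k] [CommRing A] [CommRing D]
    [Algebra k A] [Algebra k D] {ι : Type*} {x : ι → A} (g : A →ₐ[k] D)
    (h : ∀ f : MvPolynomial ι k, g (MvPolynomial.aeval x f) = 0 → f = 0) :
    AlgebraicIndependent k (g ∘ x) := by
  rw [algebraicIndependent_iff]
  intro f hf
  refine h f ?_
  rw [← hf, ← AlgHom.comp_apply, MvPolynomial.comp_aeval]
  rfl

/-- Reduce to a domain modulo a prime that keeps the family independent; a quotient does not have
larger dimension. -/
theorem natCast_le_ringKrullDim_of_algebraicIndependent {k A : Type*} [Field k] [CommRing A]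
    [Algebra k A] [Algebra.FiniteType k A] {d : ℕ} {x : Fin d → A}
    (hx : AlgebraicIndependent k x) : (d : WithBot ℕ∞) ≤ ringKrullDim A := by
  obtain ⟨P, hP, h⟩ := exists_isPrime_forall_ne_zero hx
  have hind := algebraicIndependent_comp_of_ker (Ideal.Quotient.mkₐ k P)
    fun f hf => h f (Ideal.Quotient.eq_zero_iff_mem.1 hf)
  exact (natCast_le_ringKrullDim_of_isDomain hind).trans
    (ringKrullDim_le_of_surjective (Ideal.Quotient.mk P) Ideal.Quotient.mk_surjective)

theorem ringKrullDim_le_of_algebraicIndependent_transfer {k A B : Type*} [Field k] [CommRing A]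
    [CommRing B] [Algebra k A] [Algebra k B] [Algebra.FiniteType k A] [Algebra.FiniteType k B]
    (h : ∀ (d : ℕ) (x : Fin d → A), AlgebraicIndependent k x →
      ∃ y : Fin d → B, AlgebraicIndependent k y) : ringKrullDim A ≤ ringKrullDim B := by
  rcases subsingleton_or_nontrivial A with hA | hA
  · rw [ringKrullDim_eq_bot_of_subsingleton]
    exact bot_le
  · obtain ⟨d, x, hd, hx, -⟩ := exists_algebraicIndependent_ringKrullDim_eq k A
    obtain ⟨y, hy⟩ := h d x hx
    rw [hd]
    exact natCast_le_ringKrullDim_of_algebraicIndependent hy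

/-- Independence in the quotient is phrased on representatives: no nonzero polynomial in them lies
in the ideal. Comparing dimensions becomes transporting such families. -/
theorem ringKrullDim_quotient_le_of_indep {σ K : Type*} [Finite σ] [Field K]
    {I I' : Ideal (MvPolynomial σ K)}
    (h : ∀ (d : ℕ) (f : Fin d → MvPolynomial σ K), (∀ F : MvPolynomial (Fin d) K, MvPolynomial.aeval f F ∈ I → F = 0) →
      ∃ f' : Fin d → MvPolynomial σ K,
        ∀ F : MvPolynomial (Fin d) K, MvPolynomial.aeval f' F ∈ I' → F = 0) :
    ringKrullDim (MvPolynomial σ K ⧸ I) ≤ ringKrullDim (MvPolynomial σ K ⧸ I') := by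
  refine ringKrullDim_le_of_algebraicIndependent_transfer (k := K) fun d x hx => ?_
  choose f hf using fun i => Ideal.Quotient.mkₐ_surjective K I (x i)
  obtain ⟨f', hf'⟩ := h d f fun F hF => by
    rw [algebraicIndependent_iff] at hx
    refine hx F ?_
    have : x = Ideal.Quotient.mkₐ K I ∘ f := funext fun i => (hf i).symm
    rw [this]
    refine (MvPolynomial.comp_aeval_apply (f := f) (Ideal.Quotient.mkₐ K I) F).symm.trans ?_
    exact Ideal.Quotient.eq_zero_iff_mem.2 hF
  exact ⟨_, algebraicIndependent_comp_of_ker (Ideal.Quotient.mkₐ K I') fun F hF =>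
    hf' F (Ideal.Quotient.eq_zero_iff_mem.1 hF)⟩

/-! ### Dimensions of orbits of subgroups of an orthogonal group. -/

section Orbit

variable {n : Type} [Fintype n] {K : Type*} [Field K]

/-- The matrix `g Y g⁻¹`, where `g` is the generic matrix and `g⁻¹` is written as `J gᵗ J⁻¹`. -/
noncomputable def genericConj (J J' Y : Matrix n n K) : Matrix n n (MvPolynomial (n × n) K) :=
  mvPolynomialX n n K * Y.map MvPolynomial.C *
    (J.map MvPolynomial.C * (mvPolynomialX n n K)ᵀ * J'.map MvPolynomial.C)

/-- The comorphism of the orbit map `g ↦ g Y g⁻¹` of an orthogonal group. -/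
noncomputable def orbitComorphism (J J' Y : Matrix n n K) :
    MvPolynomial (n × n) K →ₐ[K] MvPolynomial (n × n) K :=
  MvPolynomial.aeval fun ij => genericConj J J' Y ij.1 ij.2

theorem map_genericConj {L : Type*} [CommRing L] [Algebra K L]
    (φ : MvPolynomial (n × n) K →ₐ[K] L) (J J' Y : Matrix n n K) :
    (genericConj J J' Y).map φ =
      (mvPolynomialX n n K).map φ * Y.map (algebraMap K L) *
        (J.map (algebraMap K L) * ((mvPolynomialX n n K).map φ)ᵀ * J'.map (algebraMap K L)) := by
  have hC : ∀ M : Matrix n n K, (M.map MvPolynomial.C).map φ = M.map (algebraMap K L) := by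
    intro M
    ext i j
    simp only [map_apply]
    rw [← MvPolynomial.algebraMap_eq, φ.commutes]
  simp only [genericConj, Matrix.map_mul, hC, transpose_map]

theorem aeval_orbitComorphism {L : Type*} [CommRing L] [Algebra K L] (J J' Y : Matrix n n K)
    (φ : MvPolynomial (n × n) K →ₐ[K] L) (f : MvPolynomial (n × n) K) :
    φ (orbitComorphism J J' Y f) =
      MvPolynomial.aeval (fun ij : n × n => ((genericConj J J' Y).map φ) ij.1 ij.2) f := by
  rw [orbitComorphism, MvPolynomial.comp_aeval_apply]
  rfl

theorem map_derivation_mul {k L : Type*} [CommRing k] [CommRing L] [Algebra k L]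
    (D : Derivation k L L) (M N : Matrix n n L) :
    (M * N).map D = M.map D * N + M * N.map D := by
  ext i j
  simp only [map_apply, Matrix.mul_apply, map_sum, Derivation.leibniz, Matrix.add_apply,
    Finset.sum_add_distrib, smul_eq_mul]
  rw [add_comm]
  congr 1
  exact Finset.sum_congr rfl fun _ _ => mul_comm _ _

variable [DecidableEq n]

theorem val_inv_of_orthogonal {J J' : Matrix n n K} (hJ : J * J' = 1) {g : GL n K}
    (hg : (g : Matrix n n K) * J * (g : Matrix n n K)ᵀ = J) :
    ((g⁻¹ : GL n K) : Matrix n n K) = J * (g : Matrix n n K)ᵀ * J' := by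
  have h1 : (g : Matrix n n K) * (J * (g : Matrix n n K)ᵀ * J') = 1 := by
    rw [← Matrix.mul_assoc, ← Matrix.mul_assoc, hg, hJ]
  have h2 : ((g⁻¹ : GL n K) : Matrix n n K) * (g : Matrix n n K) = 1 := by
    rw [← Units.val_mul]; simp
  calc ((g⁻¹ : GL n K) : Matrix n n K)
      = ((g⁻¹ : GL n K) : Matrix n n K) * ((g : Matrix n n K) * (J * (g : Matrix n n K)ᵀ * J')) := by
        rw [h1, Matrix.mul_one]
    _ = _ := by rw [← Matrix.mul_assoc, h2, Matrix.one_mul]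

/-- On O(J) inversion is g ↦ J gᵗ J⁻¹, so the orbit map is polynomial in g, and the ideal of the
orbit is the preimage of the ideal of `H` under the comorphism. -/
theorem mem_vanishingIdeal_conjOrbit_iff {J J' : Matrix n n K} (hJ : J * J' = 1)
    {H : Subgroup (GL n K)} (hH : H ≤ orthGroup J) (Y : Matrix n n K)
    (f : MvPolynomial (n × n) K) :
    f ∈ MvPolynomial.vanishingIdeal K (points (conjOrbit H Y)) ↔
      orbitComorphism J J' Y f ∈ MvPolynomial.vanishingIdeal K (points (matrixSet H)) := by
  have key : ∀ g ∈ H, MvPolynomial.aeval (fun ij : n × n => (g : Matrix n n K) ij.1 ij.2)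
      (orbitComorphism J J' Y f) = MvPolynomial.aeval (fun ij : n × n =>
        ((g : Matrix n n K) * Y * ((g⁻¹ : GL n K) : Matrix n n K)) ij.1 ij.2) f := by
    intro g hg
    rw [aeval_orbitComorphism, map_genericConj, val_inv_of_orthogonal hJ (hH hg)]
    have : (mvPolynomialX n n K).map
        (MvPolynomial.aeval (fun ij : n × n => (g : Matrix n n K) ij.1 ij.2)) = g := by
      ext i j
      simp [mvPolynomialX_apply]
    rw [this]
    rfl
  simp only [MvPolynomial.mem_vanishingIdeal_iff, points, matrixSet, conjOrbit]
  constructor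
  · rintro h _ ⟨_, ⟨g, hg, rfl⟩, rfl⟩
    rw [key g hg]
    exact h _ ⟨_, ⟨g, hg, rfl⟩, rfl⟩
  · rintro h _ ⟨_, ⟨g, hg, rfl⟩, rfl⟩
    have := h _ ⟨_, ⟨g, hg, rfl⟩, rfl⟩
    rwa [key g hg] at this

/-- Independent functions on the orbit pull back to independent functions on `H`. -/
theorem zariskiDim_conjOrbit_le {J J' : Matrix n n K} (hJ : J * J' = 1)
    {H : Subgroup (GL n K)} (hH : H ≤ orthGroup J) (Y : Matrix n n K) :
    zariskiDim (conjOrbit H Y) ≤ zariskiDim (matrixSet H) := by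
  refine ringKrullDim_quotient_le_of_indep fun d f hf =>
    ⟨fun i => orbitComorphism J J' Y (f i), fun F hF => hf F ?_⟩
  rw [mem_vanishingIdeal_conjOrbit_iff hJ hH, MvPolynomial.comp_aeval_apply]
  exact hF

/-- Differentiating the equations satisfied by `g` shows that the logarithmic derivative Z = g⁻¹
D(g) is skew for J and commutes with S and `e`; `hinj` then gives Z = 0. -/
theorem map_derivation_eq_zero {k L : Type*} [Field k] [Field L] [Algebra k L]
    (D : Derivation k L L) {g J J' S e y : Matrix n n L}
    (hJ : J * J' = 1) (hgJ : g * J * gᵀ = J) (hgS : S * g = g * S) (hy : y * g = g * e)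
    (hDJ : J.map D = 0) (hDS : S.map D = 0) (hDe : e.map D = 0) (hDy : y.map D = 0)
    (hinj : ∀ Z : Matrix n n L, Z * J + J * Zᵀ = 0 → S * Z = Z * S → Z * e = e * Z → Z = 0) :
    g.map D = 0 := by
  obtain ⟨gi, hgi⟩ : ∃ gi, gi = J * gᵀ * J' := ⟨_, rfl⟩
  have h1 : g * gi = 1 := by rw [hgi, ← Matrix.mul_assoc, ← Matrix.mul_assoc, hgJ, hJ]
  have h2 : gi * g = 1 := mul_eq_one_comm.1 h1
  generalize hdg : g.map D = dg
  obtain ⟨Z, hZ⟩ : ∃ Z, Z = gi * dg := ⟨_, rfl⟩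
  have hgZ : dg = g * Z := by rw [hZ, ← Matrix.mul_assoc, h1, Matrix.one_mul]
  have e1 : dg * J * gᵀ + g * J * dgᵀ = 0 := by
    have := congrArg (fun M : Matrix n n L => M.map D) hgJ
    simp only [map_derivation_mul, hDJ, Matrix.mul_zero, add_zero, transpose_map, hdg] at this
    exact this
  have e2 : S * dg = dg * S := by
    have := congrArg (fun M : Matrix n n L => M.map D) hgS
    simpa only [map_derivation_mul, hDS, Matrix.mul_zero, Matrix.zero_mul, add_zero, zero_add,
      hdg] using this
  have e3 : y * dg = dg * e := by
    have := congrArg (fun M : Matrix n n L => M.map D) hy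
    simpa only [map_derivation_mul, hDy, hDe, Matrix.mul_zero, Matrix.zero_mul, add_zero, zero_add,
      hdg] using this
  have hgiS : S * gi = gi * S := by
    calc S * gi = gi * g * (S * gi) := by rw [h2, Matrix.one_mul]
      _ = gi * (g * S) * gi := by simp only [Matrix.mul_assoc]
      _ = gi * S * (g * gi) := by rw [← hgS]; simp only [Matrix.mul_assoc]
      _ = gi * S := by rw [h1, Matrix.mul_one]
  have h2t : gᵀ * giᵀ = 1 := by rw [← transpose_mul, h2, transpose_one]
  have hZ0 : Z = 0 := by
    refine hinj Z ?_ ?_ ?_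
    · have : gi * (dg * J * gᵀ + g * J * dgᵀ) * giᵀ = Z * J + J * Zᵀ := by
        rw [Matrix.mul_add, Matrix.add_mul]
        congr 1
        · rw [hZ]
          simp only [Matrix.mul_assoc]
          rw [h2t, Matrix.mul_one]
        · rw [hZ, transpose_mul]
          simp only [← Matrix.mul_assoc]
          rw [h2, Matrix.one_mul]
      rw [← this, e1, Matrix.mul_zero, Matrix.zero_mul]
    · rw [hZ, ← Matrix.mul_assoc, hgiS, Matrix.mul_assoc, e2, Matrix.mul_assoc]
    · have : g * (Z * e) = g * (e * Z) := by
        rw [← Matrix.mul_assoc, ← hgZ, ← e3, hgZ, ← Matrix.mul_assoc, hy, Matrix.mul_assoc]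
      calc Z * e = gi * (g * (Z * e)) := by rw [← Matrix.mul_assoc, h2, Matrix.one_mul]
        _ = e * Z := by rw [this, ← Matrix.mul_assoc, h2, Matrix.one_mul]
  rw [hgZ, hZ0, Matrix.mul_zero]

/-- Without derivations the Kähler differentials vanish, so the extension is formally unramified;
being essentially of finite type, it is then separable algebraic. -/
theorem isAlgebraic_of_forall_derivation_eq_zero {k L : Type*} [Field k] [Field L] [Algebra k L]
    [Algebra.EssFiniteType k L] (h : ∀ (D : Derivation k L L) (x : L), D x = 0) :
    Algebra.IsAlgebraic k L := by
  have hD : ∀ x : L, KaehlerDifferential.D k L x = 0 := by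
    intro x
    rw [← Module.forall_dual_apply_eq_zero_iff L]
    intro ℓ
    exact h (ℓ.compDer (KaehlerDifferential.D k L)) x
  have hsub : Subsingleton (Ω[L⁄k]) := by
    rw [← Submodule.subsingleton_iff L, ← subsingleton_iff_bot_eq_top,
      ← KaehlerDifferential.span_range_derivation, eq_comm, Submodule.span_eq_bot]
    rintro _ ⟨x, rfl⟩
    exact hD x
  have : Algebra.FormallyUnramified k L := ⟨hsub⟩
  have := (Algebra.FormallyUnramified.iff_isSeparable k L).1 this
  infer_instance

/-- `L` is the function field of an irreducible closed subset of the zero set of `I` on which `f`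
stays independent, and `φ` is its generic point. -/
theorem exists_field_hom_of_indep {K : Type u} [Field K] {σ : Type} [Finite σ] {I : Ideal (MvPolynomial σ K)} {d : ℕ}
    {f : Fin d → MvPolynomial σ K}
    (hf : ∀ F : MvPolynomial (Fin d) K, MvPolynomial.aeval f F ∈ I → F = 0) :
    ∃ (L : Type u) (_ : Field L) (_ : Algebra K L) (φ : MvPolynomial σ K →ₐ[K] L),
      Algebra.EssFiniteType K L ∧ (∀ a ∈ I, φ a = 0) ∧
      IntermediateField.adjoin K (Set.range fun i => φ (MvPolynomial.X i)) = ⊤ ∧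
      AlgebraicIndependent K (φ ∘ f) := by
  have hind : AlgebraicIndependent K (Ideal.Quotient.mkₐ K I ∘ f) :=
    algebraicIndependent_comp_of_ker _ fun F hF => hf F (Ideal.Quotient.eq_zero_iff_mem.1 hF)
  obtain ⟨P, hP, h⟩ := exists_isPrime_forall_ne_zero hind
  let φ : MvPolynomial σ K →ₐ[K] FractionRing ((MvPolynomial σ K ⧸ I) ⧸ P) :=
    (IsScalarTower.toAlgHom K ((MvPolynomial σ K ⧸ I) ⧸ P) _).comp
      ((Ideal.Quotient.mkₐ K P).comp (Ideal.Quotient.mkₐ K I))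
  refine ⟨FractionRing ((MvPolynomial σ K ⧸ I) ⧸ P), inferInstance, inferInstance, φ,
    ?_, ?_, ?_, ?_⟩
  · have : Algebra.EssFiniteType ((MvPolynomial σ K ⧸ I) ⧸ P)
        (FractionRing ((MvPolynomial σ K ⧸ I) ⧸ P)) :=
      Algebra.EssFiniteType.of_isLocalization _ (nonZeroDivisors _)
    exact Algebra.EssFiniteType.comp K ((MvPolynomial σ K ⧸ I) ⧸ P) _
  · intro a ha
    have : Ideal.Quotient.mk I a = 0 := Ideal.Quotient.eq_zero_iff_mem.2 ha
    simp [φ, this]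
  · rw [eq_top_iff]
    rintro x -
    have hmem : ∀ a, φ a ∈ IntermediateField.adjoin K
        (Set.range fun i => φ (MvPolynomial.X i)) := by
      intro a
      induction a using MvPolynomial.induction_on with
      | C c =>
        rw [← MvPolynomial.algebraMap_eq, φ.commutes]
        exact IntermediateField.algebraMap_mem _ c
      | add f h hf hh => rw [map_add]; exact add_mem hf hh
      | mul_X f i hf =>
        rw [map_mul]
        exact mul_mem hf (IntermediateField.subset_adjoin _ _ ⟨i, rfl⟩)
    obtain ⟨a, b, hb, rfl⟩ := IsFractionRing.div_surjective
      (A := (MvPolynomial σ K ⧸ I) ⧸ P) x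
    obtain ⟨a, rfl⟩ := Ideal.Quotient.mk_surjective a
    obtain ⟨a, rfl⟩ := Ideal.Quotient.mk_surjective a
    obtain ⟨b, rfl⟩ := Ideal.Quotient.mk_surjective b
    obtain ⟨b, rfl⟩ := Ideal.Quotient.mk_surjective b
    exact div_mem (hmem a) (hmem b)
  · have := (algebraicIndependent_comp_of_ker (Ideal.Quotient.mkₐ K P)
      fun F hF => h F (Ideal.Quotient.eq_zero_iff_mem.1 hF)).map'
      (f := IsScalarTower.toAlgHom K ((MvPolynomial σ K ⧸ I) ⧸ P)
        (FractionRing ((MvPolynomial σ K ⧸ I) ⧸ P)))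
      (IsFractionRing.injective _ _)
    exact this

/-- If the centralizer of `e` in the Lie algebra of `H` vanishes, then the orbit map of `e` has
finite fibres, so the orbit of `e` has the dimension of `H`. -/
theorem zariskiDim_le_conjOrbit {K : Type u} [Field K] [CharZero K] {J J' S e : Matrix n n K} (hJ : J * J' = 1)
    {H : Subgroup (GL n K)} (hH : H ≤ orthGroup J)
    (hHS : ∀ g ∈ H, S * (g : Matrix n n K) = (g : Matrix n n K) * S)
    (hinj : ∀ (L : Type u) [Field L] [CharZero L] [Algebra K L], ∀ Z : Matrix n n L,
      Z * J.map (algebraMap K L) + J.map (algebraMap K L) * Zᵀ = 0 →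
      S.map (algebraMap K L) * Z = Z * S.map (algebraMap K L) →
      Z * e.map (algebraMap K L) = e.map (algebraMap K L) * Z → Z = 0) :
    zariskiDim (matrixSet H) ≤ zariskiDim (conjOrbit H e) := by
  refine ringKrullDim_quotient_le_of_indep fun d f hf => ?_
  obtain ⟨L, _, _, φ, hfin, hφ, htop, hind⟩ := exists_field_hom_of_indep hf
  have : CharZero L := charZero_of_injective_algebraMap (algebraMap K L).injective
  set g : Matrix n n L := (mvPolynomialX n n K).map φ with hg
  set y : Matrix n n L := (genericConj J J' e).map φ with hydef
  have hy : y = g * e.map (algebraMap K L) *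
      (J.map (algebraMap K L) * gᵀ * J'.map (algebraMap K L)) := map_genericConj φ J J' e
  -- Polynomial identities valid at every point of `H` hold at the generic point `g`, since `φ`
  -- kills the vanishing ideal.
  have hpoint : ∀ M : Matrix n n (MvPolynomial (n × n) K),
      (∀ h ∈ H, M.map (MvPolynomial.aeval fun ij : n × n => (h : Matrix n n K) ij.1 ij.2) = 0) →
      M.map φ = 0 := by
    intro M hM
    ext i j
    refine hφ _ ?_
    rintro _ ⟨_, ⟨h, hh, rfl⟩, rfl⟩
    exact congrFun (congrFun (hM h hh) i) j
  have hX : ∀ {A : Type u} [CommRing A] [Algebra K A] (ψ : MvPolynomial (n × n) K →ₐ[K] A)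
      (M : Matrix n n K), (M.map MvPolynomial.C).map ψ = M.map (algebraMap K A) := by
    intro A _ _ ψ M
    ext i j
    simp only [map_apply]
    rw [← MvPolynomial.algebraMap_eq, ψ.commutes]
  have hXh : ∀ h : GL n K, (mvPolynomialX n n K).map
      (MvPolynomial.aeval (fun ij : n × n => (h : Matrix n n K) ij.1 ij.2)) =
        (h : Matrix n n K) := by
    intro h
    ext i j
    simp [mvPolynomialX_apply]
  have hid : ∀ M : Matrix n n K, M.map (algebraMap K K) = M := fun M => by ext; rfl
  have hJL : J.map (algebraMap K L) * J'.map (algebraMap K L) = 1 := by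
    rw [← Matrix.map_mul, hJ, Matrix.map_one _ (map_zero _) (map_one _)]
  have hgJ : g * J.map (algebraMap K L) * gᵀ = J.map (algebraMap K L) := by
    have := hpoint (mvPolynomialX n n K * J.map MvPolynomial.C * (mvPolynomialX n n K)ᵀ -
      J.map MvPolynomial.C) (fun h hh => by
        rw [Matrix.map_sub _ (map_sub _), Matrix.map_mul, Matrix.map_mul, hX, transpose_map,
          hXh, hid, sub_eq_zero]
        exact hH hh)
    rw [Matrix.map_sub _ (map_sub _), Matrix.map_mul, Matrix.map_mul, hX, transpose_map,
      sub_eq_zero] at this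
    exact this
  have hgS : S.map (algebraMap K L) * g = g * S.map (algebraMap K L) := by
    have := hpoint (S.map MvPolynomial.C * mvPolynomialX n n K -
      mvPolynomialX n n K * S.map MvPolynomial.C) (fun h hh => by
        rw [Matrix.map_sub _ (map_sub _), Matrix.map_mul, Matrix.map_mul, hX, hXh, hid, sub_eq_zero]
        exact hHS h hh)
    rw [Matrix.map_sub _ (map_sub _), Matrix.map_mul, Matrix.map_mul, hX, sub_eq_zero] at this
    exact this
  have hyg : y * g = g * e.map (algebraMap K L) := by
    have h1 : g * (J.map (algebraMap K L) * gᵀ * J'.map (algebraMap K L)) = 1 := by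
      rw [← Matrix.mul_assoc, ← Matrix.mul_assoc, hgJ, hJL]
    rw [hy, Matrix.mul_assoc, mul_eq_one_comm.1 h1, Matrix.mul_one]
  let s : Set L := Set.range fun ij : n × n => y ij.1 ij.2
  let L' := IntermediateField.adjoin K s
  have hfin' : Algebra.EssFiniteType L' L := Algebra.EssFiniteType.of_comp K L' L
  -- A derivation over `L'` kills the entries of `y`, hence those of `g`, and the latter generate
  -- `L` over `K`.
  have halg : Algebra.IsAlgebraic L' L := by
    refine isAlgebraic_of_forall_derivation_eq_zero fun D => ?_
    have hconst : ∀ M : Matrix n n K, (M.map (algebraMap K L)).map D = 0 := by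
      intro M
      ext i j
      simp only [map_apply, Matrix.zero_apply]
      rw [IsScalarTower.algebraMap_apply K L' L]
      exact D.map_algebraMap _
    have hDy : y.map D = 0 := by
      ext i j
      exact D.map_algebraMap
        (⟨y i j, IntermediateField.subset_adjoin K s ⟨(i, j), rfl⟩⟩ : L')
    have hDg := map_derivation_eq_zero D hJL hgJ hgS hyg (hconst J) (hconst S) (hconst e) hDy
      (hinj L)
    intro x
    have hx : x ∈ IntermediateField.adjoin K (Set.range fun i => φ (MvPolynomial.X i)) := by
      rw [htop]
      trivial
    induction hx using IntermediateField.adjoin_induction with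
    | mem x hx =>
      obtain ⟨ij, rfl⟩ := hx
      exact congrFun (congrFun hDg ij.1) ij.2
    | algebraMap x =>
      rw [IsScalarTower.algebraMap_apply K L' L]
      exact D.map_algebraMap _
    | add x y _ _ hx hy => rw [map_add, hx, hy, add_zero]
    | inv x _ hx => rw [Derivation.leibniz_inv, hx, smul_zero]
    | mul x y _ _ hx hy => rw [Derivation.leibniz, hx, hy, smul_zero, smul_zero, add_zero]
  have halg' : Algebra.IsAlgebraic (Algebra.adjoin K s) L :=
    IntermediateField.isAlgebraic_adjoin_iff_top.1 halg
  -- A transcendence basis of `L` can be chosen among the entries of `y`. It has at least `d`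
  -- elements, and `d` of these coordinates are the wanted functions on the orbit.
  obtain ⟨t, hts, ht⟩ := exists_isTranscendenceBasis_subset (R := K) s
  have hcard : Cardinal.lift.{u} (Cardinal.mk (Fin d)) ≤ Cardinal.lift.{0} (Cardinal.mk t) := by
    have h1 := hind.lift_cardinalMk_le_trdeg
    rw [← ht.cardinalMk_eq_trdeg] at h1
    simpa using h1
  obtain ⟨ι⟩ : Nonempty (Fin d ↪ t) := by
    rwa [← Cardinal.lift_mk_le']
  choose c hc using fun k => hts (ι k).2
  refine ⟨fun k => MvPolynomial.X (c k), fun F hF => ?_⟩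
  rw [mem_vanishingIdeal_conjOrbit_iff hJ hH] at hF
  have h0 := hφ _ hF
  rw [aeval_orbitComorphism, MvPolynomial.comp_aeval_apply] at h0
  have hι := ht.1.comp ι ι.injective
  rw [algebraicIndependent_iff] at hι
  refine hι F ?_
  rw [← h0]
  congr 2
  funext k
  rw [MvPolynomial.aeval_X]
  exact (hc k).symm

end Orbit

/-! ### The adjoint of a block and the description of 𝔤(-1). -/

section Basic

variable {F : Type*} [Field F]

theorem antiDiag_transpose (r : ℕ) : (antiDiag F r)ᵀ = antiDiag F r := by
  ext i j
  simp only [transpose_apply, antiDiag, of_apply]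
  congr 1
  rw [eq_iff_iff]
  exact ⟨fun h => by rw [h, Fin.rev_rev], fun h => by rw [h, Fin.rev_rev]⟩

theorem antiDiag_mul_apply {n : Type*} (r : ℕ) (M : Matrix (Fin r) n F) (i : Fin r) (j : n) :
    (antiDiag F r * M) i j = M i.rev j := by
  simp [antiDiag, Matrix.mul_apply]

theorem mul_antiDiag_apply {n : Type*} (r : ℕ) (M : Matrix n (Fin r) F) (i : n) (j : Fin r) :
    (M * antiDiag F r) i j = M i j.rev := by
  have : M * antiDiag F r = (antiDiag F r * Mᵀ)ᵀ := by
    rw [transpose_mul, transpose_transpose, antiDiag_transpose]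
  rw [this, transpose_apply, antiDiag_mul_apply, transpose_apply]

theorem antiDiag_mul_self (r : ℕ) : antiDiag F r * antiDiag F r = 1 := by
  ext i j
  rw [antiDiag_mul_apply]
  simp [antiDiag, Matrix.one_apply, eq_comm]

theorem antiDiag_mul_cancel_left {n : Type*} (r : ℕ) (M : Matrix (Fin r) n F) :
    antiDiag F r * (antiDiag F r * M) = M := by
  rw [← Matrix.mul_assoc, antiDiag_mul_self, Matrix.one_mul]

theorem antiDiag_mul_cancel_right {n : Type*} (r : ℕ) (M : Matrix n (Fin r) F) :
    M * antiDiag F r * antiDiag F r = M := by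
  rw [Matrix.mul_assoc, antiDiag_mul_self, Matrix.mul_one]

theorem antiDiag_map {K : Type*} [Field K] (f : F →+* K) (r : ℕ) :
    (antiDiag F r).map f = antiDiag K r := by
  ext i j
  simp only [antiDiag, map_apply, of_apply]
  split <;> simp

/-- The adjoint `J_q Aᵗ J_p` of `A` with respect to the forms `J_p` and `J_q`. -/
noncomputable def sharp {p q : ℕ} (A : Matrix (Fin p) (Fin q) F) : Matrix (Fin q) (Fin p) F :=
  antiDiag F q * Aᵀ * antiDiag F p

variable {p q r : ℕ}

theorem sharp_apply (A : Matrix (Fin p) (Fin q) F) (i : Fin q) (j : Fin p) :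
    sharp A i j = A j.rev i.rev := by
  rw [sharp, mul_antiDiag_apply, antiDiag_mul_apply, transpose_apply]

theorem sharp_sharp (A : Matrix (Fin p) (Fin q) F) : sharp (sharp A) = A := by
  ext i j
  simp [sharp_apply]

theorem sharp_mul (A : Matrix (Fin p) (Fin q) F) (B : Matrix (Fin q) (Fin r) F) :
    sharp (A * B) = sharp B * sharp A := by
  simp only [sharp, transpose_mul, Matrix.mul_assoc, antiDiag_mul_cancel_left]

theorem sharp_add (A B : Matrix (Fin p) (Fin q) F) : sharp (A + B) = sharp A + sharp B := by
  ext i j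
  simp [sharp_apply]

theorem sharp_smul (c : F) (A : Matrix (Fin p) (Fin q) F) : sharp (c • A) = c • sharp A := by
  ext i j
  simp [sharp_apply]

theorem sharp_zero : sharp (0 : Matrix (Fin p) (Fin q) F) = 0 := by
  ext i j
  simp [sharp_apply]

theorem sharp_one : sharp (1 : Matrix (Fin p) (Fin p) F) = 1 := by
  rw [sharp, transpose_one, Matrix.mul_one, antiDiag_mul_self]

theorem sharp_map {K : Type*} [Field K] (f : F →+* K) (A : Matrix (Fin p) (Fin q) F) :
    sharp (A.map f) = (sharp A).map f := by
  ext i j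
  simp [sharp_apply]

/-- The element of `𝔤(-1)` with upper right block `A`. -/
noncomputable def offDiag (A : Matrix (Fin p) (Fin q) F) :
    Matrix (Fin p ⊕ Fin q) (Fin p ⊕ Fin q) F :=
  fromBlocks 0 A (sharp A) 0

theorem offDiag_injective : Function.Injective (offDiag : Matrix (Fin p) (Fin q) F → _) := by
  intro A B h
  exact (fromBlocks_inj.1 h).2.1

theorem offDiag_map {K : Type*} [Field K] (f : F →+* K) (A : Matrix (Fin p) (Fin q) F) :
    (offDiag A).map f = offDiag (A.map f) := by
  rw [offDiag, offDiag, fromBlocks_map, sharp_map, Matrix.map_zero _ (map_zero f),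
    Matrix.map_zero _ (map_zero f)]

theorem Ipq_conj (X : Matrix (Fin p ⊕ Fin q) (Fin p ⊕ Fin q) F) :
    (Ipq F p q).val * X * ((Ipq F p q)⁻¹).val =
      fromBlocks X.toBlocks₁₁ (-X.toBlocks₁₂) (-X.toBlocks₂₁) X.toBlocks₂₂ := by
  change fromBlocks 1 0 0 (-1) * X * fromBlocks 1 0 0 (-1) = _
  conv_lhs => rw [← fromBlocks_toBlocks X]
  simp [fromBlocks_multiply]

theorem mem_orthLie_iff (X : Matrix (Fin p ⊕ Fin q) (Fin p ⊕ Fin q) F) :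
    X ∈ orthLie F p q ↔ Xᵀ * Jpq F p q = Jpq F p q * (-X) := by
  rw [orthLie, mem_skewAdjointMatricesLieSubalgebra, mem_skewAdjointMatricesSubmodule]
  rfl

/-- Conjugation by I_{p,q} keeps the diagonal blocks, so these equal their negatives and vanish in
characteristic zero. Skewness for J_{p,q} then determines the lower left block; the sign of -J_q is
what makes it +A♯. -/
theorem mem_gMinus_iff [CharZero F] (X : Matrix (Fin p ⊕ Fin q) (Fin p ⊕ Fin q) F) :
    X ∈ gMinus F p q ↔ ∃ A, X = offDiag A := by
  have hdef : X ∈ gMinus F p q ↔ X ∈ orthLie F p q ∧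
    (Ipq F p q).val * X * ((Ipq F p q)⁻¹).val = -X := Iff.rfl
  rw [hdef, Ipq_conj, mem_orthLie_iff]
  constructor
  · rintro ⟨h1, h2⟩
    obtain ⟨P, A, B, Q, rfl⟩ : ∃ P A B Q, X = fromBlocks P A B Q :=
      ⟨_, _, _, _, (fromBlocks_toBlocks X).symm⟩
    simp only [toBlocks_fromBlocks₁₁, toBlocks_fromBlocks₁₂, toBlocks_fromBlocks₂₁,
      toBlocks_fromBlocks₂₂, fromBlocks_neg, fromBlocks_inj] at h2
    have h0 : ∀ {r : ℕ} {M : Matrix (Fin r) (Fin r) F}, M = -M → M = 0 := fun h => by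
      ext i j
      exact self_eq_neg.1 (congrFun (congrFun h i) j)
    have hP : P = 0 := h0 h2.1
    have hQ : Q = 0 := h0 h2.2.2.2
    subst hP hQ
    refine ⟨A, ?_⟩
    rw [Jpq, fromBlocks_transpose, fromBlocks_neg, fromBlocks_multiply, fromBlocks_multiply,
      fromBlocks_inj] at h1
    have h3 := h1.2.2.1
    simp only [Matrix.mul_zero, add_zero, zero_add, Matrix.neg_mul, Matrix.mul_neg, neg_neg,
      neg_zero] at h3
    rw [offDiag, sharp, Matrix.mul_assoc, h3, antiDiag_mul_cancel_left]
  · rintro ⟨A, rfl⟩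
    constructor
    · rw [Jpq, offDiag, fromBlocks_transpose, fromBlocks_neg, fromBlocks_multiply,
        fromBlocks_multiply, fromBlocks_inj]
      simp [sharp, ← Matrix.mul_assoc, antiDiag_mul_self,
        antiDiag_transpose, antiDiag_mul_cancel_right]
    · simp [offDiag, fromBlocks_neg]

theorem offDiag_mem_gMinus [CharZero F] (A : Matrix (Fin p) (Fin q) F) :
    offDiag A ∈ gMinus F p q := (mem_gMinus_iff _).2 ⟨A, rfl⟩

theorem mem_gMinusCentralizer_iff (e X : Matrix (Fin p ⊕ Fin q) (Fin p ⊕ Fin q) F) :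
    X ∈ gMinusCentralizer p q e ↔ X ∈ gMinus F p q ∧ e * X = X * e := by
  rw [← sub_eq_zero (a := e * X)]
  rfl

theorem isToralSubspace_iff
    (t : Submodule F (Matrix (Fin p ⊕ Fin q) (Fin p ⊕ Fin q) F)) :
    IsToralSubspace p q t ↔ t ≤ gMinus F p q ∧ (∀ X ∈ t, ∀ Y ∈ t, X * Y = Y * X) ∧
      ∀ X ∈ t, Module.End.IsSemisimple (Matrix.toLin' X) := by
  have : ∀ X Y : Matrix (Fin p ⊕ Fin q) (Fin p ⊕ Fin q) F, X * Y = Y * X ↔ X * Y - Y * X = 0 :=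
    fun X Y => sub_eq_zero.symm
  simp only [this]
  rfl

theorem offDiag_mul_offDiag (A C : Matrix (Fin p) (Fin q) F) :
    offDiag A * offDiag C = fromBlocks (A * sharp C) 0 0 (sharp A * C) := by
  simp [offDiag, fromBlocks_multiply]

theorem offDiag_commute_iff (A C : Matrix (Fin p) (Fin q) F) :
    offDiag A * offDiag C = offDiag C * offDiag A ↔
      A * sharp C = C * sharp A ∧ sharp A * C = sharp C * A := by
  rw [offDiag_mul_offDiag, offDiag_mul_offDiag, fromBlocks_inj]
  simp

theorem fromBlocks_pow_odd (A : Matrix (Fin p) (Fin q) F) (B : Matrix (Fin q) (Fin p) F) (n : ℕ) :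
    fromBlocks 0 A B 0 ^ (2 * n + 1) = fromBlocks 0 (A * (B * A) ^ n) ((B * A) ^ n * B) 0 := by
  induction n with
  | zero => simp
  | succ n ih =>
    rw [show 2 * (n + 1) + 1 = 1 + (2 * n + 1) + 1 by ring, pow_succ, pow_add, ih, pow_one,
      fromBlocks_multiply, fromBlocks_multiply]
    simp only [Matrix.zero_mul, Matrix.mul_zero, add_zero, zero_add]
    congr 1
    · rw [pow_succ]
      simp only [Matrix.mul_assoc]
    · rw [pow_succ']
      simp only [Matrix.mul_assoc]

open Polynomial in
-- Odd powers of an off-diagonal matrix stay off-diagonal and involve only powers of `B * A`. So if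
-- χ annihilates `B * A`, then X χ(X²) annihilates the block matrix.
theorem aeval_fromBlocks_odd (A : Matrix (Fin p) (Fin q) F) (B : Matrix (Fin q) (Fin p) F)
    (h : F[X]) :
    aeval (fromBlocks 0 A B 0) (X * expand F 2 h) =
      fromBlocks 0 (A * aeval (B * A) h) (aeval (B * A) h * B) 0 := by
  induction h using Polynomial.induction_on' with
  | add f g hf hg =>
    rw [map_add, mul_add, map_add, hf, hg, fromBlocks_add, map_add, Matrix.mul_add, Matrix.add_mul,
      add_zero, add_zero]
  | monomial n a =>
    rw [expand_monomial, X_mul_monomial, aeval_monomial, aeval_monomial, ← Algebra.smul_def,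
      ← Algebra.smul_def, mul_comm n 2, fromBlocks_pow_odd, fromBlocks_smul]
    simp

end Basic

/-! ### Cyclic vectors and the vanishing of the centralizer in 𝔤(1). -/

section Krylov

variable {F : Type*} [Field F] {p q n : ℕ}

/-- The matrix with columns `w, T w, T² w, …`. -/
def krylov {R : Type*} [CommRing R] {n : ℕ} (T : Matrix (Fin n) (Fin n) R) (w : Fin n → R) :
    Matrix (Fin n) (Fin n) R :=
  of fun i k => ((T ^ (k : ℕ)) *ᵥ w) i

theorem mul_krylov_apply (N T : Matrix (Fin n) (Fin n) F) (w : Fin n → F) (i k : Fin n) :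
    (N * krylov T w) i k = ((N * T ^ (k : ℕ)) *ᵥ w) i := by
  rw [← mulVec_mulVec]
  rfl

theorem krylov_transpose_mul_apply (N T : Matrix (Fin n) (Fin n) F) (w : Fin n → F)
    (a b : Fin n) : ((krylov T w)ᵀ * (N * krylov T w)) a b =
      w ⬝ᵥ (((T ^ (a : ℕ))ᵀ * (N * T ^ (b : ℕ))) *ᵥ w) := by
  rw [← mulVec_mulVec, dotProduct_mulVec, vecMul_transpose, Matrix.mul_apply]
  exact Finset.sum_congr rfl fun i _ => by rw [mul_krylov_apply]; rfl

theorem dotProduct_mulVec_self_eq_zero [CharZero F] {m : Type*} [Fintype m] {M : Matrix m m F}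
    (hM : Mᵀ = -M) (w : m → F) : w ⬝ᵥ (M *ᵥ w) = 0 := by
  have h : w ⬝ᵥ (M *ᵥ w) = -(w ⬝ᵥ (M *ᵥ w)) := by
    conv_lhs => rw [dotProduct_mulVec, dotProduct_comm, ← mulVec_transpose, hM, neg_mulVec,
      dotProduct_neg]
  exact self_eq_neg.1 h

/-- Writing J for `antiDiag F n`, every J D Tᵏ is skew-symmetric, so the pairing of Tᵃ w with J D Tᵇ
w is that of w with J D Tᵃ⁺ᵇ w, which is zero. The vectors Tᵏ w span, so J D = 0. -/
theorem eq_zero_of_skew_of_commute_of_krylov [CharZero F] {T D : Matrix (Fin n) (Fin n) F}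
    {w : Fin n → F} (hK : (krylov T w).det ≠ 0) (hT : sharp T = T) (hD : sharp D = -D)
    (hDT : D * T = T * D) : D = 0 := by
  have hTn : ∀ k : ℕ, sharp (T ^ k) = T ^ k := by
    intro k
    induction k with
    | zero => rw [pow_zero, sharp_one]
    | succ k ih => rw [pow_succ, sharp_mul, ih, hT, ← pow_succ', ← pow_succ]
  have hDTn : ∀ k : ℕ, D * T ^ k = T ^ k * D := fun k => (Commute.pow_right hDT k)
  have hflip : ∀ M : Matrix (Fin n) (Fin n) F, Mᵀ * antiDiag F n = antiDiag F n * sharp M := by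
    intro M
    rw [sharp, Matrix.mul_assoc (antiDiag F n), antiDiag_mul_cancel_left]
  have hskew : ∀ k : ℕ, (antiDiag F n * (D * T ^ k))ᵀ = -(antiDiag F n * (D * T ^ k)) := by
    intro k
    rw [transpose_mul, antiDiag_transpose, hflip, sharp_mul, hTn, hD, Matrix.mul_neg,
      Matrix.mul_neg, hDTn]
  have h0 : (krylov T w)ᵀ * (antiDiag F n * D * krylov T w) = 0 := by
    ext a b
    rw [krylov_transpose_mul_apply]
    have : (T ^ (a : ℕ))ᵀ * (antiDiag F n * D * T ^ (b : ℕ)) =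
        antiDiag F n * (D * T ^ ((a : ℕ) + b)) := by
      rw [Matrix.mul_assoc (antiDiag F n), ← Matrix.mul_assoc, hflip, hTn, pow_add,
        ← Matrix.mul_assoc D, hDTn]
      simp only [Matrix.mul_assoc, hDTn]
    rw [this]
    exact dotProduct_mulVec_self_eq_zero (hskew _) w
  have hu : IsUnit (krylov T w) := (isUnit_iff_isUnit_det _).2 (isUnit_iff_ne_zero.2 hK)
  have hu' : IsUnit (krylov T w)ᵀ :=
    (isUnit_iff_isUnit_det _).2 (by rw [det_transpose]; exact isUnit_iff_ne_zero.2 hK)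
  have h1 : antiDiag F n * D * krylov T w = 0 :=
    hu'.mul_left_cancel (h0.trans (Matrix.mul_zero _).symm)
  have h2 : antiDiag F n * D = 0 := hu.mul_right_cancel (h1.trans (Matrix.zero_mul _).symm)
  rw [← antiDiag_mul_cancel_left n D, h2, Matrix.mul_zero]

/-- The centralizer of `offDiag A` in the `θ`-fixed subalgebra `𝔬(J_p) × 𝔬(J_q)` vanishes. -/
theorem eq_zero_of_skew_of_intertwine [CharZero F] {A : Matrix (Fin p) (Fin q) F} {w : Fin q → F}
    (hK : (krylov (sharp A * A) w).det ≠ 0)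
    (hA : ∀ M : Matrix (Fin p) (Fin p) F, Mᵀ = -M → M * A = 0 → M = 0)
    {C : Matrix (Fin p) (Fin p) F} {D : Matrix (Fin q) (Fin q) F}
    (hC : sharp C = -C) (hD : sharp D = -D) (h : C * A = A * D) : C = 0 ∧ D = 0 := by
  have h' : D * sharp A = sharp A * C := by
    have := congrArg sharp h
    rw [sharp_mul, sharp_mul, hC, hD, Matrix.mul_neg, Matrix.neg_mul, neg_inj] at this
    exact this.symm
  -- The intertwining relation and its adjoint together say that `D` commutes with A♯A.
  have hD0 : D = 0 := by
    refine eq_zero_of_skew_of_commute_of_krylov hK (by rw [sharp_mul, sharp_sharp]) hD ?_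
    rw [← Matrix.mul_assoc, h', Matrix.mul_assoc, h, Matrix.mul_assoc]
  refine ⟨?_, hD0⟩
  have : antiDiag F p * C = 0 := by
    refine hA _ ?_ ?_
    · rw [transpose_mul, antiDiag_transpose, ← Matrix.mul_neg, ← hC, sharp,
        Matrix.mul_assoc (antiDiag F p), antiDiag_mul_cancel_left]
    · rw [Matrix.mul_assoc, h, hD0, Matrix.mul_zero, Matrix.mul_zero]
  rw [← antiDiag_mul_cancel_left p C, this, Matrix.mul_zero]

end Krylov

/-! ### Surjectivity of ad e by duality, and the dimension count. -/

section Dimension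

variable (F : Type*) [Field F] {p q : ℕ}

/-- The space of skew-symmetric matrices. -/
def skewSubmodule (n : ℕ) : Submodule F (Matrix (Fin n) (Fin n) F) where
  carrier := {M | Mᵀ = -M}
  zero_mem' := by simp
  add_mem' := by
    intro M N hM hN
    simp only [Set.mem_ofPred_eq] at *
    rw [transpose_add, hM, hN, neg_add]
  smul_mem' := by
    intro c M hM
    simp only [Set.mem_ofPred_eq] at *
    rw [transpose_smul, hM, smul_neg]

variable {F}

theorem mem_skewSubmodule {n : ℕ} {M : Matrix (Fin n) (Fin n) F} :
    M ∈ skewSubmodule F n ↔ Mᵀ = -M := Iff.rfl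

variable (F) in
theorem finrank_skewSubmodule [CharZero F] (n : ℕ) :
    Module.finrank F (skewSubmodule F n) = n * (n - 1) / 2 := by
  let φ : skewSubmodule F n →ₗ[F] ((Σ j : Fin n, Fin j) → F) :=
    { toFun := fun M x => M.1 ⟨x.2, x.2.2.trans x.1.2⟩ x.1
      map_add' := fun _ _ => rfl
      map_smul' := fun _ _ => rfl }
  have hφ : Function.Bijective φ := by
    constructor
    · rw [injective_iff_map_eq_zero]
      rintro ⟨M, hM⟩ h
      rw [mem_skewSubmodule] at hM
      have hs : ∀ i j, M j i = -M i j := fun i j => congrFun (congrFun hM i) j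
      have hlt : ∀ i j : Fin n, i < j → M i j = 0 := fun i j hij => congrFun h ⟨j, ⟨i, hij⟩⟩
      ext i j
      rcases lt_trichotomy i j with hij | rfl | hij
      · exact hlt i j hij
      · exact self_eq_neg.1 (hs i i)
      · simp [hs j i, hlt j i hij]
    · intro f
      refine ⟨⟨of fun i j => if h : i < j then f ⟨j, ⟨i, h⟩⟩ else
        if h : j < i then -f ⟨i, ⟨j, h⟩⟩ else 0, ?_⟩, ?_⟩
      · rw [mem_skewSubmodule]
        ext i j
        rcases lt_trichotomy i j with hij | rfl | hij
        · simp [hij, hij.not_gt]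
        · simp
        · simp [hij, hij.not_gt]
      · funext ⟨j, i⟩
        have : (⟨i, i.2.trans j.2⟩ : Fin n) < j := i.2
        refine (dif_pos this).trans ?_
        rfl
  rw [(LinearEquiv.ofBijective φ hφ).finrank_eq, Module.finrank_fintype_fun_eq_card,
    Fintype.card_sigma]
  simp only [Fintype.card_fin]
  rw [Fin.sum_univ_eq_sum_range (fun i => i), Finset.sum_range_id]

/-- Any functional is a trace pairing with some matrix, and against skew matrices only its skew part
(N - Nᵗ)/2 counts. -/
theorem exists_trace_eq [CharZero F] {n : ℕ} (f : skewSubmodule F n →ₗ[F] F) :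
    ∃ N ∈ skewSubmodule F n, ∀ M : skewSubmodule F n, f M = trace (M.1 * N) := by
  obtain ⟨g, hg⟩ := f.exists_extend
  let N : Matrix (Fin n) (Fin n) F := of fun i j => g (Matrix.single j i 1)
  have hgN : ∀ M, g M = trace (M * N) := by
    intro M
    conv_lhs => rw [matrix_eq_sum_single M]
    simp only [map_sum, trace, diag_apply, Matrix.mul_apply]
    refine Finset.sum_congr rfl fun i _ => Finset.sum_congr rfl fun j _ => ?_
    have : Matrix.single i j (M i j) = M i j • Matrix.single i j (1 : F) := by simp
    rw [this, map_smul]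
    rfl
  refine ⟨(2 : F)⁻¹ • (N - Nᵀ), ?_, ?_⟩
  · rw [mem_skewSubmodule, transpose_smul, transpose_sub, transpose_transpose, ← smul_neg, neg_sub]
  · rintro ⟨M, hM⟩
    have hM' : Mᵀ = -M := hM
    have h1 : f ⟨M, hM⟩ = trace (M * N) := by
      rw [← hgN, ← hg]
      rfl
    have h2 : trace (M * Nᵀ) = -trace (M * N) := by
      rw [← trace_transpose, transpose_mul, transpose_transpose, hM', Matrix.mul_neg, trace_neg,
        trace_mul_comm]
    rw [h1, Matrix.mul_smul, trace_smul, Matrix.mul_sub, trace_sub, h2, smul_eq_mul]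
    field_simp
    ring

/-- The map `ad (offDiag A)` from `𝔤(-1)` to `𝔤(1)`, in terms of skew-symmetric matrices. -/
noncomputable def adSkew (A : Matrix (Fin p) (Fin q) F) :
    Matrix (Fin p) (Fin q) F →ₗ[F] skewSubmodule F p × skewSubmodule F q :=
  LinearMap.prod
    (LinearMap.codRestrict _
      { toFun := fun C => A * antiDiag F q * Cᵀ - C * antiDiag F q * Aᵀ
        map_add' := fun C D => by
          rw [transpose_add, Matrix.mul_add, Matrix.add_mul, Matrix.add_mul]; abel
        map_smul' := fun c C => by
          simp only [transpose_smul, Matrix.mul_smul, Matrix.smul_mul, RingHom.id_apply, smul_sub] }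
      fun C => by
        change (A * antiDiag F q * Cᵀ - C * antiDiag F q * Aᵀ)ᵀ = -(A * antiDiag F q * Cᵀ - C * antiDiag F q * Aᵀ)
        simp only [transpose_sub, transpose_mul, transpose_transpose, antiDiag_transpose, neg_sub,
          Matrix.mul_assoc])
    (LinearMap.codRestrict _
      { toFun := fun C => Aᵀ * antiDiag F p * C - Cᵀ * antiDiag F p * A
        map_add' := fun C D => by
          rw [transpose_add, Matrix.mul_add, Matrix.add_mul, Matrix.add_mul]; abel
        map_smul' := fun c C => by
          simp only [transpose_smul, Matrix.mul_smul, Matrix.smul_mul, RingHom.id_apply, smul_sub] }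
      fun C => by
        change (Aᵀ * antiDiag F p * C - Cᵀ * antiDiag F p * A)ᵀ = -(Aᵀ * antiDiag F p * C - Cᵀ * antiDiag F p * A)
        simp only [transpose_sub, transpose_mul, transpose_transpose, antiDiag_transpose, neg_sub,
          Matrix.mul_assoc])

theorem adSkew_eq_zero_iff (A C : Matrix (Fin p) (Fin q) F) :
    adSkew A C = 0 ↔ A * sharp C = C * sharp A ∧ sharp A * C = sharp C * A := by
  have hdef : adSkew A C = 0 ↔ A * antiDiag F q * Cᵀ - C * antiDiag F q * Aᵀ = 0 ∧
      Aᵀ * antiDiag F p * C - Cᵀ * antiDiag F p * A = 0 := by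
    rw [Prod.ext_iff, Subtype.ext_iff, Subtype.ext_iff]
    rfl
  rw [hdef, sub_eq_zero, sub_eq_zero]
  constructor
  · rintro ⟨h1, h2⟩
    constructor
    · simp only [sharp, ← Matrix.mul_assoc, h1]
    · have : ∀ X Y : Matrix (Fin p) (Fin q) F,
          sharp X * Y = antiDiag F q * (Xᵀ * antiDiag F p * Y) := fun X Y => by
        simp only [sharp, Matrix.mul_assoc]
      rw [this, this, h2]
  · rintro ⟨h1, h2⟩
    constructor
    · have : ∀ X Y : Matrix (Fin p) (Fin q) F,
          X * antiDiag F q * Yᵀ = X * sharp Y * antiDiag F p := fun X Y => by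
        rw [sharp, ← Matrix.mul_assoc, antiDiag_mul_cancel_right, Matrix.mul_assoc X]
      rw [this, this, h1]
    · have : ∀ X Y : Matrix (Fin p) (Fin q) F,
          Xᵀ * antiDiag F p * Y = antiDiag F q * (sharp X * Y) := fun X Y => by
        simp only [sharp, Matrix.mul_assoc, antiDiag_mul_cancel_left]
      rw [this, this, h2]

/-- Up to sign, ad e : 𝔤(-1) → 𝔤(1) is adjoint under the trace form to ad e : 𝔤(1) → 𝔤(-1), which is
injective by `hA`. A functional vanishing on the range is pairing with a pair (P, Q), and `key'`
says that (J P, Q J) centralizes `offDiag A`. -/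
theorem adSkew_surjective [CharZero F] {A : Matrix (Fin p) (Fin q) F}
    (hA : ∀ (C : Matrix (Fin p) (Fin p) F) (D : Matrix (Fin q) (Fin q) F), sharp C = -C →
      sharp D = -D → C * A = A * D → C = 0 ∧ D = 0) : Function.Surjective (adSkew A) := by
  rw [← LinearMap.range_eq_top]
  by_contra hne
  obtain ⟨f, hf, hle⟩ := Submodule.exists_le_ker_of_lt_top _ (lt_top_iff_ne_top.2 hne)
  obtain ⟨P, hP, hfP⟩ := exists_trace_eq (f.comp (LinearMap.inl F _ _))
  obtain ⟨Q, hQ, hfQ⟩ := exists_trace_eq (f.comp (LinearMap.inr F _ _))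
  rw [mem_skewSubmodule] at hP hQ
  have hfPQ : ∀ x, f x = trace (x.1.1 * P) + trace (x.2.1 * Q) := by
    rintro ⟨x, y⟩
    rw [← hfP, ← hfQ, LinearMap.comp_apply, LinearMap.comp_apply, ← map_add]
    simp
  have key : Q * Aᵀ * antiDiag F p = antiDiag F q * Aᵀ * P := by
    rw [Matrix.ext_iff_trace_mul_left]
    intro C
    have h0 : f (adSkew A C) = 0 := hle ⟨C, rfl⟩
    rw [hfPQ] at h0
    change trace ((A * antiDiag F q * Cᵀ - C * antiDiag F q * Aᵀ) * P) +
      trace ((Aᵀ * antiDiag F p * C - Cᵀ * antiDiag F p * A) * Q) = 0 at h0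
    have e1 : trace (A * antiDiag F q * Cᵀ * P) = -trace (C * antiDiag F q * Aᵀ * P) := by
      rw [← trace_transpose]
      simp only [transpose_mul, transpose_transpose, hP, antiDiag_transpose, Matrix.neg_mul,
        trace_neg]
      rw [trace_mul_comm]
      simp only [Matrix.mul_assoc]
    have e2 : trace (Cᵀ * antiDiag F p * A * Q) = -trace (Aᵀ * antiDiag F p * C * Q) := by
      rw [← trace_transpose]
      simp only [transpose_mul, transpose_transpose, hQ, antiDiag_transpose, Matrix.neg_mul,
        trace_neg]
      rw [trace_mul_comm]
      simp only [Matrix.mul_assoc]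
    have e3 : trace (Aᵀ * antiDiag F p * C * Q) = trace (C * (Q * Aᵀ * antiDiag F p)) := by
      rw [Matrix.mul_assoc _ C Q, trace_mul_comm]
      simp only [Matrix.mul_assoc]
    rw [Matrix.sub_mul, Matrix.sub_mul, trace_sub, trace_sub, e1, e2, e3] at h0
    have e4 : C * antiDiag F q * Aᵀ * P = C * (antiDiag F q * Aᵀ * P) := by
      simp only [Matrix.mul_assoc]
    rw [e4] at h0
    have : (2 : F) * (trace (C * (Q * Aᵀ * antiDiag F p)) -
        trace (C * (antiDiag F q * Aᵀ * P))) = 0 := by linear_combination h0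
    exact sub_eq_zero.1 ((mul_eq_zero.1 this).resolve_left two_ne_zero)
  have key' : antiDiag F p * P * A = A * (Q * antiDiag F q) := by
    have h1 := congrArg transpose key
    simp only [transpose_mul, transpose_transpose, antiDiag_transpose, hP, hQ, Matrix.neg_mul,
      Matrix.mul_neg, neg_inj] at h1
    calc antiDiag F p * P * A = antiDiag F p * (P * (A * antiDiag F q)) * antiDiag F q := by
          simp only [← Matrix.mul_assoc, antiDiag_mul_cancel_right]
      _ = A * (Q * antiDiag F q) := by
          rw [← h1]
          simp only [Matrix.mul_assoc, antiDiag_mul_cancel_left]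
  obtain ⟨hC, hD⟩ := hA (antiDiag F p * P) (Q * antiDiag F q)
    (by simp only [sharp, transpose_mul, antiDiag_transpose, hP, Matrix.mul_neg, Matrix.neg_mul,
          ← Matrix.mul_assoc, antiDiag_mul_cancel_right])
    (by simp only [sharp, transpose_mul, antiDiag_transpose, hQ, Matrix.mul_neg, Matrix.neg_mul,
          antiDiag_mul_cancel_left])
    key'
  have hP0 : P = 0 := by rw [← antiDiag_mul_cancel_left p P, hC, Matrix.mul_zero]
  have hQ0 : Q = 0 := by rw [← antiDiag_mul_cancel_right q Q, hD, Matrix.zero_mul]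
  refine hf (LinearMap.ext fun x => ?_)
  rw [hfPQ, hP0, hQ0]
  simp

/-- Rank-nullity for `adSkew A`, whose kernel is the centralizer. -/
theorem finrank_gMinusCentralizer_add [CharZero F] {A : Matrix (Fin p) (Fin q) F}
    (hA : ∀ (C : Matrix (Fin p) (Fin p) F) (D : Matrix (Fin q) (Fin q) F), sharp C = -C →
      sharp D = -D → C * A = A * D → C = 0 ∧ D = 0) :
    p * (p - 1) / 2 + q * (q - 1) / 2 + Module.finrank F (gMinusCentralizer p q (offDiag A)) =
      p * q := by
  let ι : Matrix (Fin p) (Fin q) F →ₗ[F] Matrix (Fin p ⊕ Fin q) (Fin p ⊕ Fin q) F :=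
    { toFun := offDiag
      map_add' := fun C D => by simp [offDiag, sharp_add, fromBlocks_add]
      map_smul' := fun c C => by simp [offDiag, sharp_smul, fromBlocks_smul] }
  have hmap : (LinearMap.ker (adSkew A)).map ι = gMinusCentralizer p q (offDiag A) := by
    ext X
    rw [mem_gMinusCentralizer_iff, mem_gMinus_iff]
    constructor
    · rintro ⟨C, hC, rfl⟩
      exact ⟨⟨C, rfl⟩, (offDiag_commute_iff A C).2 ((adSkew_eq_zero_iff A C).1 hC)⟩
    · rintro ⟨⟨C, rfl⟩, hC⟩
      exact ⟨C, (adSkew_eq_zero_iff A C).2 ((offDiag_commute_iff A C).1 hC), rfl⟩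
  have h := LinearMap.finrank_range_add_finrank_ker (adSkew A)
  rw [LinearMap.range_eq_top.2 (adSkew_surjective hA), finrank_top, Module.finrank_prod,
    finrank_skewSubmodule, finrank_skewSubmodule, Module.finrank_matrix, Fintype.card_fin,
    Fintype.card_fin, Module.finrank_self, mul_one,
    (Submodule.equivMapOfInjective ι offDiag_injective _).finrank_eq, hmap] at h
  exact h

end Dimension

/-! ### The two nilpotent elements and their relative regularity. -/

section Distinguished

variable {F : Type*} [Field F] {n : ℕ}

/-- `T` moves basis vectors upwards, so column k of the Krylov matrix of the last basis vector ends
with a nonzero entry in row n - k. Reversing the columns gives a triangular matrix with nonzero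
diagonal. -/
theorem det_krylov_ne_zero {T : Matrix (Fin (n + 1)) (Fin (n + 1)) F}
    (h0 : ∀ i j, j ≤ i → T i j = 0) (h1 : ∀ i : Fin n, T i.castSucc i.succ ≠ 0) :
    (krylov T (Pi.single (Fin.last n) 1)).det ≠ 0 := by
  have hpow : ∀ k : ℕ, (∀ i : Fin (n + 1), n < (i : ℕ) + k → (T ^ k) i (Fin.last n) = 0) ∧
      ∀ i : Fin (n + 1), (i : ℕ) + k = n → (T ^ k) i (Fin.last n) ≠ 0 := by
    intro k
    induction k with
    | zero =>
      refine ⟨fun i hi => absurd i.2 (by lia), fun i hi => ?_⟩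
      rw [show i = Fin.last n from Fin.ext hi]
      simp
    | succ k ih =>
      refine ⟨fun i hi => ?_, fun i hi => ?_⟩
      · rw [pow_succ', Matrix.mul_apply]
        refine Finset.sum_eq_zero fun m _ => ?_
        rcases le_or_gt m i with hm | hm
        · rw [h0 i m hm, zero_mul]
        · rw [ih.1 m (by have : (i : ℕ) < m := hm; lia), mul_zero]
      · have hin : (i : ℕ) < n := by lia
        rw [pow_succ', Matrix.mul_apply, Finset.sum_eq_single (Fin.succ ⟨i, hin⟩)]
        · refine mul_ne_zero ?_ (ih.2 _ (by simp; lia))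
          exact h1 ⟨i, hin⟩
        · intro m _ hm
          rcases le_or_gt m i with hmi | hmi
          · rw [h0 i m hmi, zero_mul]
          · rw [ih.1 m, mul_zero]
            have h2 : (i : ℕ) < m := hmi
            have h3 : (m : ℕ) ≠ i + 1 := fun h => hm (Fin.ext h)
            lia
        · simp
  have hK : ∀ i k, krylov T (Pi.single (Fin.last n) 1) i k = (T ^ (k : ℕ)) i (Fin.last n) := by
    intro i k
    simp [krylov]
  have htri : ((krylov T (Pi.single (Fin.last n) 1)).submatrix id Fin.revPerm).IsUpperTriangular := by
    intro i j hij
    rw [submatrix_apply, id, hK]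
    refine (hpow _).1 i ?_
    have : (j : ℕ) < i := hij
    simp only [Fin.revPerm_apply, Fin.val_rev]
    lia
  have hdet := Matrix.det_of_isUpperTriangular htri
  rw [Matrix.det_permute'] at hdet
  intro h
  rw [h, mul_zero] at hdet
  refine Finset.prod_ne_zero_iff.2 (fun i _ => ?_) hdet.symm
  rw [submatrix_apply, id, hK]
  refine (hpow _).2 i ?_
  simp only [Fin.revPerm_apply, Fin.val_rev]
  lia

open Polynomial in
-- The characteristic polynomial of A♯A is X^q, so X · (X²)^q annihilates `offDiag A`.
theorem isNilpotent_offDiag {p q : ℕ} {A : Matrix (Fin p) (Fin q) F}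
    (h0 : ∀ i j, j ≤ i → (sharp A * A) i j = 0) : IsNilpotent (offDiag A) := by
  have htri : (sharp A * A).IsUpperTriangular := fun i j hij => h0 i j (le_of_lt hij)
  have hchar : (sharp A * A).charpoly = X ^ q := by
    rw [Matrix.charpoly_of_isUpperTriangular _ htri]
    simp [h0 _ _ le_rfl]
  have h := aeval_fromBlocks_odd A (sharp A) ((sharp A * A).charpoly)
  rw [Matrix.aeval_self_charpoly, Matrix.mul_zero, Matrix.zero_mul, fromBlocks_zero, hchar, map_pow,
    expand_X, ← pow_mul, ← pow_succ', map_pow, aeval_X] at h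
  exact ⟨_, h⟩

/-- A combinatorial form of being regular nilpotent, for an element `offDiag A` of `𝔤(-1)`. -/
structure IsStaircase {p q : ℕ} (A : Matrix (Fin p) (Fin q) F) : Prop where
  lower : ∀ i j, j ≤ i → (sharp A * A) i j = 0
  succ : ∀ i j : Fin q, (j : ℕ) = i + 1 → (sharp A * A) i j ≠ 0
  skew : ∀ M : Matrix (Fin p) (Fin p) F, Mᵀ = -M → M * A = 0 → M = 0

theorem IsStaircase.centralizer_eq_zero [CharZero F] {p q : ℕ} (hq : 0 < q)
    {A : Matrix (Fin p) (Fin q) F} (hA : IsStaircase A)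
    {C : Matrix (Fin p) (Fin p) F} {D : Matrix (Fin q) (Fin q) F}
    (hC : sharp C = -C) (hD : sharp D = -D) (h : C * A = A * D) : C = 0 ∧ D = 0 := by
  obtain ⟨n, rfl⟩ : ∃ n, q = n + 1 := ⟨q - 1, by lia⟩
  exact eq_zero_of_skew_of_intertwine
    (det_krylov_ne_zero hA.lower fun i => hA.succ _ _ (by simp)) hA.skew hC hD h

/-- The number pq - p(p-1)/2 - q(q-1)/2 equals q exactly when (p - q)² = p - q; this is where p = q
or p = q + 1 enters. -/
theorem IsStaircase.finrank_gMinusCentralizer [CharZero F] {p q : ℕ} (hq : 0 < q)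
    (hpq : p = q + 1 ∨ p = q) {A : Matrix (Fin p) (Fin q) F} (hA : IsStaircase A) :
    Module.finrank F (gMinusCentralizer p q (offDiag A)) = q := by
  have h := finrank_gMinusCentralizer_add fun C D hC hD h => hA.centralizer_eq_zero hq hC hD h
  have h2 := Nat.div_mul_cancel (even_iff_two_dvd.1 (Nat.even_mul_pred_self q))
  obtain ⟨n, rfl⟩ : ∃ n, q = n + 1 := ⟨q - 1, by lia⟩
  rcases hpq with rfl | rfl
  · have h3 := Nat.div_mul_cancel (even_iff_two_dvd.1 (Nat.even_mul_pred_self (n + 1 + 1)))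
    simp only [Nat.add_sub_cancel] at *
    nlinarith
  · simp only [Nat.add_sub_cancel] at *
    nlinarith

/-- The upper right block of `eOdd`. -/
def oddBlock (F : Type*) [Field F] (q : ℕ) : Matrix (Fin (q + 1)) (Fin q) F :=
  of fun i j => if i = j.castSucc then 1 else 0

theorem eOdd_eq (q : ℕ) : eOdd F q = offDiag (oddBlock F q) := by
  rw [eOdd, offDiag, oddBlock]
  congr 1
  ext i j
  rw [sharp_apply, of_apply, of_apply]
  congr 1
  rw [eq_iff_iff, Fin.ext_iff, Fin.ext_iff]
  simp only [Fin.val_succ, Fin.val_rev, Fin.val_castSucc]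
  lia

theorem eEven_eq (q : ℕ) : eEven F q = offDiag (eStar F q) := rfl

theorem oddBlock_map {K : Type*} [Field K] (f : F →+* K) (q : ℕ) :
    (oddBlock F q).map f = oddBlock K q := by
  ext i j
  simp only [oddBlock, map_apply, of_apply]
  split <;> simp

theorem eStar_map {K : Type*} [Field K] (f : F →+* K) (q : ℕ) :
    (eStar F q).map f = eStar K q := by
  ext i j
  simp only [eStar, map_apply, of_apply]
  split <;> simp

/-- All columns are multiples of column `a`, and that one vanishes: M i a = -M a i = -c i · M a a,
where M a a = 0 by skewness. -/
theorem eq_zero_of_skew_of_rows [CharZero F] {p : ℕ} {M : Matrix (Fin p) (Fin p) F}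
    (hM : Mᵀ = -M) {a : Fin p} (c : Fin p → F) (h : ∀ i k, M i k = c k * M i a) : M = 0 := by
  have hs : ∀ i j, M j i = -M i j := fun i j => congrFun (congrFun hM i) j
  have haa : M a a = 0 := self_eq_neg.1 (hs a a)
  have ha : ∀ i, M i a = 0 := fun i => by rw [hs a i, h, haa, mul_zero, neg_zero]
  ext i k
  rw [h, ha, mul_zero, Matrix.zero_apply]

theorem isStaircase_oddBlock [CharZero F] (q : ℕ) : IsStaircase (oddBlock F q) := by
  -- A♯A is a single nilpotent Jordan block: only the middle index i + 1 contributes.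
  have hT : ∀ i j : Fin q, (sharp (oddBlock F q) * oddBlock F q) i j =
      if (j : ℕ) = i + 1 then 1 else 0 := by
    intro i j
    rw [Matrix.mul_apply, Finset.sum_eq_single i.succ]
    · rw [sharp_apply, oddBlock, of_apply, of_apply, if_pos (by ext; simp), one_mul]
      congr 1
      rw [eq_iff_iff, Fin.ext_iff]
      simp [eq_comm]
    · intro k _ hk
      rw [sharp_apply, oddBlock, of_apply, if_neg, zero_mul]
      intro h
      refine hk (Fin.ext ?_)
      have := congrArg Fin.val h
      simp only [Fin.val_rev, Fin.val_castSucc] at this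
      simp only [Fin.val_succ]
      lia
    · simp
  refine ⟨fun i j hij => ?_, fun i j hij => ?_, fun M hM hMA => ?_⟩
  · rw [hT, if_neg]
    have : (j : ℕ) ≤ i := hij
    lia
  · rw [hT, if_pos hij]
    exact one_ne_zero
  -- Multiplying by `oddBlock` just drops the last column of `M`, so no other column can be nonzero.
  · refine eq_zero_of_skew_of_rows hM (a := Fin.last q)
      (fun k => if k = Fin.last q then 1 else 0) fun i k => ?_
    rcases Fin.eq_castSucc_or_eq_last k with ⟨j, rfl⟩ | rfl
    · have := congrFun (congrFun hMA i) j
      rw [Matrix.mul_apply, Finset.sum_eq_single j.castSucc] at this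
      · simpa [oddBlock, (Fin.castSucc_lt_last j).ne] using this
      · intro k _ hk
        rw [oddBlock, of_apply, if_neg hk, mul_zero]
      · simp
    · simp

theorem isStaircase_eStar [CharZero F] {q : ℕ} (hq : 0 < q) : IsStaircase (eStar F q) := by
  set m := (q + 1) / 2 with hm
  have hA : ∀ k j : Fin q, eStar F q k j =
      if (j : ℕ) = (if (k : ℕ) < m then (k : ℕ) + 1 else k) then 1 else 0 := fun _ _ => rfl
  have hB : ∀ i k : Fin q, sharp (eStar F q) i k =
      if (k : ℕ) = (if q < (k : ℕ) + 1 + m then (i : ℕ) + 1 else i) then 1 else 0 := by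
    intro i k
    rw [sharp_apply, hA]
    have hi := i.2
    have hk := k.2
    congr 1
    rw [eq_iff_iff]
    simp only [Fin.val_rev]
    split_ifs <;> lia
  -- Both factors have entries 0 and 1, so an entry of the product counts paths i → k → j; in
  -- characteristic zero it is nonzero as soon as a path exists.
  have hT : ∀ i j : Fin q, (sharp (eStar F q) * eStar F q) i j =
      ((Finset.univ.filter fun k : Fin q =>
        (k : ℕ) = (if q < (k : ℕ) + 1 + m then (i : ℕ) + 1 else i) ∧
        (j : ℕ) = (if (k : ℕ) < m then (k : ℕ) + 1 else k)).card : F) := by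
    intro i j
    rw [Matrix.mul_apply, Finset.card_filter, Nat.cast_sum]
    refine Finset.sum_congr rfl fun k _ => ?_
    rw [hB, hA, Nat.cast_ite, Nat.cast_one, Nat.cast_zero, ite_and, ite_mul, one_mul, zero_mul]
  refine ⟨fun i j hij => ?_, fun i j hij => ?_, fun M hM hMA => ?_⟩
  · rw [hT, Nat.cast_eq_zero, Finset.card_eq_zero, Finset.filter_eq_empty_iff]
    rintro k - ⟨h1, h2⟩
    have : (j : ℕ) ≤ i := hij
    split_ifs at h1 h2 <;> lia
  · rw [hT, Nat.cast_ne_zero, Finset.card_ne_zero]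
    have hj := j.2
    -- The path from i to i + 1 passes through k = i if the second factor makes the shift, and
    -- through k = i + 1 if the first one does.
    by_cases h : (i : ℕ) + 1 + m ≤ q
    · refine ⟨i, Finset.mem_filter.2 ⟨Finset.mem_univ _, ?_, ?_⟩⟩
      · rw [if_neg (by lia)]
      · rw [if_pos (by lia), hij]
    · refine ⟨j, Finset.mem_filter.2 ⟨Finset.mem_univ _, ?_, ?_⟩⟩
      · rw [if_pos (by lia), hij]
      · rw [if_neg (by lia)]
  · have hcol : ∀ (i j : Fin q), ∑ k, M i k *
        (if (j : ℕ) = (if (k : ℕ) < m then (k : ℕ) + 1 else k) then 1 else 0) = 0 := by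
      intro i j
      have := congrFun (congrFun hMA i) j
      rwa [Matrix.mul_apply] at this
    -- Column 0 of `eStar` is empty, column m (present when q ≥ 2) has ones in rows m - 1 and m, and
    -- every other column has a single one. So `M * A = 0` makes column m of `M` the negative of
    -- column m - 1 and kills all the others.
    refine eq_zero_of_skew_of_rows hM (a := ⟨m - 1, by lia⟩)
      (fun k => if (k : ℕ) = m - 1 then 1 else if (k : ℕ) = m then -1 else 0) fun i k => ?_
    have hk := k.2
    by_cases h1 : (k : ℕ) = m - 1
    · rw [if_pos h1, one_mul]
      congr 1
      exact Fin.ext h1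
    rw [if_neg h1]
    by_cases h2 : (k : ℕ) = m
    · rw [if_pos h2]
      have := hcol i k
      rw [Finset.sum_eq_add k (⟨m - 1, by lia⟩ : Fin q) (fun h => h1 (congrArg Fin.val h))] at this
      · rw [if_pos (by rw [if_neg (by lia)]), if_pos (by rw [if_pos (by simp; lia)]; simp; lia)] at this
        linear_combination this
      · rintro l - ⟨hl1, hl2⟩
        rw [if_neg, mul_zero]
        have h3 : (l : ℕ) ≠ k := fun h => hl1 (Fin.ext h)
        have h4 : (l : ℕ) ≠ m - 1 := fun h => hl2 (Fin.ext h)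
        split_ifs <;> lia
      · simp
      · simp
    · rw [if_neg h2, zero_mul]
      rcases lt_or_ge (k : ℕ) m with h3 | h3
      · have := hcol i ⟨k + 1, by lia⟩
        rw [Finset.sum_eq_single k] at this
        · rwa [if_pos (by rw [if_pos h3]), mul_one] at this
        · intro l _ hl
          rw [if_neg, mul_zero]
          have h4 : (l : ℕ) ≠ k := fun h => hl (Fin.ext h)
          split_ifs <;> simp <;> lia
        · simp
      · have := hcol i k
        rw [Finset.sum_eq_single k] at this
        · rwa [if_pos (by rw [if_neg (by lia)]), mul_one] at this
        · intro l _ hl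
          rw [if_neg, mul_zero]
          have h4 : (l : ℕ) ≠ k := fun h => hl (Fin.ext h)
          split_ifs <;> lia
        · simp

theorem Jpq_mul_self (p q : ℕ) : Jpq F p q * Jpq F p q = 1 := by
  rw [Jpq, fromBlocks_multiply]
  simp [antiDiag_mul_self]

theorem Jpq_map {K : Type*} [Field K] (f : F →+* K) (p q : ℕ) :
    (Jpq F p q).map f = Jpq K p q := by
  rw [Jpq, fromBlocks_map, antiDiag_map, Matrix.map_zero _ (map_zero f),
    Matrix.map_zero _ (map_zero f), Matrix.map_neg _ (map_neg f), antiDiag_map]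
  rfl

theorem Ipq_val_map {K : Type*} [Field K] (f : F →+* K) (p q : ℕ) :
    (Ipq F p q).val.map f = (Ipq K p q).val := by
  change (fromBlocks 1 0 0 (-1)).map f = fromBlocks 1 0 0 (-1)
  rw [fromBlocks_map, Matrix.map_zero _ (map_zero f), Matrix.map_zero _ (map_zero f),
    Matrix.map_neg _ (map_neg f), Matrix.map_one _ (map_zero f) (map_one f),
    Matrix.map_one _ (map_zero f) (map_one f)]

theorem sharp_eq_neg_of_mul_add {r : ℕ} {C : Matrix (Fin r) (Fin r) F}
    (h : C * antiDiag F r + antiDiag F r * Cᵀ = 0) : sharp C = -C := by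
  have := congrArg (fun M => M * antiDiag F r) h
  simp only [Matrix.add_mul, antiDiag_mul_cancel_right, Matrix.zero_mul] at this
  rw [sharp]
  exact (neg_eq_of_add_eq_zero_right this).symm

theorem groupOne_commute {p q : ℕ} {g : GL (Fin p ⊕ Fin q) F} (hg : g ∈ groupOne F p q) :
    (Ipq F p q).val * (g : Matrix _ _ F) = (g : Matrix _ _ F) * (Ipq F p q).val := by
  have h : Ipq F p q * g * (Ipq F p q)⁻¹ = g := hg.2
  have h' : Ipq F p q * g = g * Ipq F p q := by
    conv_rhs => rw [← h]
    group
  exact congrArg Units.val h'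

/-- The orbit attains the dimension of G(1), which bounds all orbits, because the centralizer in
𝔤(1) vanishes. This is needed over extensions `L` of `K`, since a generic point of G(1) has its
entries in a function field. -/
theorem isRelativelyRegular_offDiag {K : Type u} [Field K] [CharZero K] {p q : ℕ} (hq : 0 < q)
    {A : Matrix (Fin p) (Fin q) K}
    (hA : ∀ (L : Type u) [Field L] [CharZero L] [Algebra K L],
      IsStaircase (A.map (algebraMap K L))) : IsRelativelyRegular p q (offDiag A) := by
  refine ⟨offDiag_mem_gMinus A, fun Y _ => ?_⟩
  refine (zariskiDim_conjOrbit_le (Jpq_mul_self p q) inf_le_left Y).trans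
    (zariskiDim_le_conjOrbit (S := (Ipq K p q).val) (Jpq_mul_self p q) inf_le_left
      (fun g hg => groupOne_commute hg) ?_)
  intro L _ _ _ Z h1 h2 h3
  rw [Jpq_map] at h1
  rw [Ipq_val_map] at h2
  rw [offDiag_map] at h3
  obtain ⟨C, M, N, D, rfl⟩ : ∃ C M N D, Z = fromBlocks C M N D :=
    ⟨_, _, _, _, (fromBlocks_toBlocks Z).symm⟩
  change fromBlocks 1 0 0 (-1) * _ = _ * fromBlocks 1 0 0 (-1) at h2
  simp only [fromBlocks_multiply, Matrix.one_mul, Matrix.zero_mul, Matrix.mul_zero, add_zero,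
    zero_add, Matrix.mul_one, Matrix.neg_mul, Matrix.mul_neg, fromBlocks_inj] at h2
  have hM : M = 0 := by
    ext i j
    exact self_eq_neg.1 (congrFun (congrFun h2.2.1 i) j)
  have hN : N = 0 := by
    ext i j
    exact self_eq_neg.1 (congrFun (congrFun h2.2.2.1 i) j).symm
  subst hM hN
  rw [Jpq, fromBlocks_transpose, fromBlocks_multiply, fromBlocks_multiply, fromBlocks_add,
    ← fromBlocks_zero, fromBlocks_inj] at h1
  simp only [Matrix.zero_mul, Matrix.mul_zero, add_zero, zero_add, Matrix.neg_mul,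
    Matrix.mul_neg] at h1
  rw [offDiag, fromBlocks_multiply, fromBlocks_multiply, fromBlocks_inj] at h3
  simp only [Matrix.zero_mul, Matrix.mul_zero, add_zero, zero_add] at h3
  have hD : D * antiDiag L q + antiDiag L q * Dᵀ = 0 := by
    rw [← neg_eq_zero, neg_add]
    exact h1.2.2.2
  obtain ⟨rfl, rfl⟩ := (hA L).centralizer_eq_zero hq (sharp_eq_neg_of_mul_add h1.1)
    (sharp_eq_neg_of_mul_add hD) h3.2.1
  exact fromBlocks_zero

end Distinguished

/-! ### Regular semisimple elements of 𝔤(-1) and their centralizers. -/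

section Regular

variable {F : Type*} [Field F] {p q : ℕ}

open Polynomial in
/-- For `T = A♯ A`, the element `offDiag A` of `𝔤(-1)` has `2 q` distinct nonzero eigenvalues, and
`w` is a cyclic vector of `T`. -/
structure IsRegPair (A : Matrix (Fin p) (Fin q) F) (w : Fin q → F) : Prop where
  krylov_ne : (krylov (sharp A * A) w).det ≠ 0
  resultant_ne : resultant (sharp A * A).charpoly (derivative (sharp A * A).charpoly) q (q - 1) ≠ 0
  det_ne : (sharp A * A).det ≠ 0

open Polynomial in
-- The derivative of g(X²) is g'(X²) · 2X, and g(X²) is coprime to each factor: to g'(X²) by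
-- substitution in a Bézout relation, to X because g(0) ≠ 0.
theorem separable_X_mul_expand_two [CharZero F] {g : F[X]} (hg : g.Separable)
    (h0 : g.coeff 0 ≠ 0) : (X * expand F 2 g).Separable := by
  have hX : IsCoprime (X : F[X]) (expand F 2 g) := by
    rw [irreducible_X.coprime_iff_not_dvd, X_dvd_iff, coeff_zero_eq_eval_zero, expand_eval,
      zero_pow two_ne_zero, ← coeff_zero_eq_eval_zero]
    exact h0
  refine separable_X.mul ?_ hX
  rw [Polynomial.Separable, derivative_expand]
  refine IsCoprime.mul_right (IsCoprime.map hg (expand F 2).toRingHom) (IsCoprime.mul_right ?_ ?_)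
  · have : IsUnit ((2 : ℕ) : F[X]) := by
      rw [← C_eq_natCast]
      exact isUnit_C.2 (isUnit_iff_ne_zero.2 (Nat.cast_ne_zero.2 two_ne_zero))
    obtain ⟨u, hu⟩ := this
    exact ⟨0, u⁻¹.1, by rw [← hu, zero_mul, zero_add, Units.inv_mul]⟩
  · exact hX.symm.pow_right

theorem krylov_mulVec (T : Matrix (Fin q) (Fin q) F) (w c : Fin q → F) :
    krylov T w *ᵥ c = (∑ k : Fin q, c k • T ^ (k : ℕ)) *ᵥ w := by
  ext i
  simp only [mulVec, dotProduct, krylov, of_apply, Matrix.sum_apply, Matrix.smul_apply,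
    Finset.sum_mul, smul_eq_mul]
  rw [Finset.sum_comm]
  refine Finset.sum_congr rfl fun k _ => Finset.sum_congr rfl fun l _ => by ring

/-- Take the polynomial in `T` that agrees with `R` at the cyclic vector; both commute with `T`, so
they agree on every Tᵏ w. -/
theorem exists_eq_sum_pow_of_commute {T R : Matrix (Fin q) (Fin q) F} {w : Fin q → F}
    (hK : (krylov T w).det ≠ 0) (h : R * T = T * R) :
    ∃ c : Fin q → F, R = ∑ k : Fin q, c k • T ^ (k : ℕ) := by
  have hu : IsUnit (krylov T w) := (isUnit_iff_isUnit_det _).2 (isUnit_iff_ne_zero.2 hK)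
  obtain ⟨c, hc⟩ := (mulVec_surjective_iff_isUnit.2 hu) (R *ᵥ w)
  refine ⟨c, hu.mul_right_cancel ?_⟩
  rw [krylov_mulVec] at hc
  have hcomm : ∀ S : Matrix (Fin q) (Fin q) F, S * T = T * S → S * krylov T w =
      of fun (i k : Fin q) => ((T ^ (k : ℕ)) *ᵥ (S *ᵥ w)) i := by
    intro S hS
    ext i k
    rw [mul_krylov_apply, (Commute.pow_right hS _ : S * T ^ (k : ℕ) = T ^ (k : ℕ) * S),
      ← mulVec_mulVec]
    rfl
  rw [hcomm R h, hcomm _ ?_, hc]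
  rw [Finset.sum_mul, Finset.mul_sum]
  refine Finset.sum_congr rfl fun k _ => ?_
  rw [Matrix.smul_mul, Matrix.mul_smul, ← pow_succ, ← pow_succ']

theorem sharp_sum_pow {T : Matrix (Fin q) (Fin q) F} (hT : sharp T = T) (c : Fin q → F) :
    sharp (∑ k : Fin q, c k • T ^ (k : ℕ)) = ∑ k : Fin q, c k • T ^ (k : ℕ) := by
  have hTn : ∀ k : ℕ, sharp (T ^ k) = T ^ k := by
    intro k
    induction k with
    | zero => rw [pow_zero, sharp_one]
    | succ k ih => rw [pow_succ, sharp_mul, ih, hT, ← pow_succ', ← pow_succ]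
  have : ∀ s : Finset (Fin q), sharp (∑ k ∈ s, c k • T ^ (k : ℕ)) = ∑ k ∈ s, c k • T ^ (k : ℕ) := by
    intro s
    induction s using Finset.induction_on with
    | empty => simp [sharp_zero]
    | insert a s ha ih => rw [Finset.sum_insert ha, sharp_add, ih, sharp_smul, hTn]
  exact this _

/-- The odd polynomials in `offDiag A`. -/
noncomputable def oddPoly (A : Matrix (Fin p) (Fin q) F) :
    (Fin q → F) →ₗ[F] Matrix (Fin p ⊕ Fin q) (Fin p ⊕ Fin q) F where
  toFun c := offDiag (A * ∑ k : Fin q, c k • (sharp A * A) ^ (k : ℕ))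
  map_add' c d := by
    simp [add_smul, Finset.sum_add_distrib, Matrix.mul_add, offDiag, sharp_add, fromBlocks_add]
  map_smul' a c := by
    simp [mul_smul, ← Finset.smul_sum, offDiag, sharp_smul, fromBlocks_smul]

open Polynomial in
theorem oddPoly_mem_adjoin (A : Matrix (Fin p) (Fin q) F) (c : Fin q → F) :
    ∃ f : F[X], oddPoly A c = aeval (offDiag A) f := by
  refine ⟨X * expand F 2 (∑ k : Fin q, C (c k) * X ^ (k : ℕ)), ?_⟩
  rw [offDiag, aeval_fromBlocks_odd]
  have : aeval (sharp A * A) (∑ k : Fin q, C (c k) * X ^ (k : ℕ)) =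
      ∑ k : Fin q, c k • (sharp A * A) ^ (k : ℕ) := by
    rw [map_sum]
    refine Finset.sum_congr rfl fun k _ => ?_
    rw [map_mul, aeval_C, map_pow, aeval_X, ← Algebra.smul_def]
  rw [this]
  change offDiag _ = _
  rw [offDiag, sharp_mul, sharp_sum_pow (by rw [sharp_mul, sharp_sharp])]

/-- If `offDiag C` commutes with `offDiag A`, then R = A♯ C T⁻¹ commutes with T = A♯A, so R is a
polynomial in T, and C = A R. -/
theorem IsRegPair.range_oddPoly [CharZero F] {A : Matrix (Fin p) (Fin q) F} {w : Fin q → F}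
    (h : IsRegPair A w) : LinearMap.range (oddPoly A) = gMinusCentralizer p q (offDiag A) := by
  ext X
  rw [mem_gMinusCentralizer_iff, mem_gMinus_iff]
  constructor
  · rintro ⟨c, rfl⟩
    refine ⟨⟨_, rfl⟩, ?_⟩
    obtain ⟨f, hf⟩ := oddPoly_mem_adjoin A c
    rw [hf]
    have := congrArg (Polynomial.aeval (offDiag A)) (mul_comm Polynomial.X f)
    rwa [map_mul, map_mul, Polynomial.aeval_X] at this
  · rintro ⟨⟨C, rfl⟩, hC⟩
    obtain ⟨h1, h2⟩ := (offDiag_commute_iff A C).1 hC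
    have hu : IsUnit (sharp A * A) :=
      (isUnit_iff_isUnit_det _).2 (isUnit_iff_ne_zero.2 h.det_ne)
    obtain ⟨u, hu⟩ := hu
    have hST : (sharp A * C) * u.1 = u.1 * (sharp A * C) := by
      rw [hu]
      calc sharp A * C * (sharp A * A) = sharp A * (C * sharp A) * A := by
            simp only [Matrix.mul_assoc]
        _ = sharp A * A * (sharp C * A) := by rw [← h1]; simp only [Matrix.mul_assoc]
        _ = _ := by rw [h2]
    have hR : (sharp A * C * (u⁻¹).1) * (sharp A * A) = (sharp A * A) * (sharp A * C * (u⁻¹).1) := by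
      rw [← hu, Matrix.mul_assoc _ _ u.1, Units.inv_mul, Matrix.mul_one, ← Matrix.mul_assoc, ← hST,
        Matrix.mul_assoc _ u.1, Units.mul_inv, Matrix.mul_one]
    obtain ⟨c, hc⟩ := exists_eq_sum_pow_of_commute h.krylov_ne hR
    refine ⟨c, ?_⟩
    change offDiag _ = _
    congr 1
    rw [← hc]
    calc A * (sharp A * C * (u⁻¹).1) = C * (sharp A * A) * (u⁻¹).1 := by
          rw [h2, ← Matrix.mul_assoc, ← Matrix.mul_assoc, h1, Matrix.mul_assoc C]
      _ = C := by rw [← hu, Matrix.mul_assoc, Units.mul_inv, Matrix.mul_one]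

/-- The coefficients of an odd polynomial are recovered from its value: `A` is injective because A♯A
is invertible, and the powers of A♯A are independent on the cyclic vector. -/
theorem IsRegPair.finrank_centralizer [CharZero F] {A : Matrix (Fin p) (Fin q) F} {w : Fin q → F}
    (h : IsRegPair A w) : Module.finrank F (gMinusCentralizer p q (offDiag A)) = q := by
  rw [← h.range_oddPoly, LinearMap.finrank_range_of_inj, Module.finrank_fintype_fun_eq_card,
    Fintype.card_fin]
  rw [injective_iff_map_eq_zero]
  intro c hc
  have h1 : A * ∑ k : Fin q, c k • (sharp A * A) ^ (k : ℕ) = 0 := by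
    refine offDiag_injective (hc.trans ?_)
    rw [offDiag, sharp_zero, fromBlocks_zero]
  have hu : IsUnit (sharp A * A) :=
    (isUnit_iff_isUnit_det _).2 (isUnit_iff_ne_zero.2 h.det_ne)
  have h2 : ∑ k : Fin q, c k • (sharp A * A) ^ (k : ℕ) = 0 := by
    refine hu.mul_left_cancel ?_
    rw [Matrix.mul_zero, Matrix.mul_assoc, h1, Matrix.mul_zero]
  refine (mulVec_injective_iff_isUnit.2
    ((isUnit_iff_isUnit_det _).2 (isUnit_iff_ne_zero.2 h.krylov_ne))) ?_
  rw [krylov_mulVec, h2, zero_mulVec, mulVec_zero]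

open Polynomial in
-- With χ the characteristic polynomial of A♯A, X χ(X²) annihilates `offDiag A`. It is squarefree
-- since the resultant condition makes χ separable and the determinant gives χ(0) ≠ 0.
theorem IsRegPair.isSemisimple [CharZero F] (hq : 0 < q) {A : Matrix (Fin p) (Fin q) F}
    {w : Fin q → F} (h : IsRegPair A w) : Module.End.IsSemisimple (toLin' (offDiag A)) := by
  have hnat : (sharp A * A).charpoly.natDegree = q := by
    rw [charpoly_natDegree_eq_dim, Fintype.card_fin]
  obtain ⟨a, b, -, -, hab⟩ := exists_mul_add_mul_eq_C_resultant (sharp A * A).charpoly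
    (derivative (sharp A * A).charpoly) (m := q) (n := q - 1) hnat.le
    ((natDegree_derivative_le _).trans (by rw [hnat])) (Or.inl hq.ne')
  have hsep : (sharp A * A).charpoly.Separable := by
    set r := resultant (sharp A * A).charpoly (derivative (sharp A * A).charpoly) q (q - 1) with hr
    refine ⟨C r⁻¹ * a, C r⁻¹ * b, ?_⟩
    have : C r⁻¹ * C r = (1 : F[X]) := by
      rw [← C_mul, inv_mul_cancel₀ h.resultant_ne, C_1]
    rw [← this, ← hab]
    ring
  have hc0 : (sharp A * A).charpoly.coeff 0 ≠ 0 := by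
    intro h0
    refine h.det_ne ?_
    rw [det_eq_sign_charpoly_coeff, h0, mul_zero]
  refine Module.End.isSemisimple_of_squarefree_aeval_eq_zero
    (separable_X_mul_expand_two hsep hc0).squarefree ?_
  have h0 := aeval_fromBlocks_odd A (sharp A) (sharp A * A).charpoly
  rw [aeval_self_charpoly, Matrix.mul_zero, Matrix.zero_mul, fromBlocks_zero] at h0
  change aeval (toLinAlgEquiv' (offDiag A)) _ = 0
  rw [aeval_algHom_apply, offDiag, h0, map_zero]

theorem IsRegPair.isToralSubspace [CharZero F] (hq : 0 < q) {A : Matrix (Fin p) (Fin q) F}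
    {w : Fin q → F} (h : IsRegPair A w) :
    IsToralSubspace p q (gMinusCentralizer p q (offDiag A)) := by
  rw [isToralSubspace_iff]
  refine ⟨fun X hX => ((mem_gMinusCentralizer_iff _ _).1 hX).1, fun X hX Y hY => ?_,
    fun X hX => ?_⟩
  · rw [← h.range_oddPoly] at hX hY
    obtain ⟨c, rfl⟩ := hX
    obtain ⟨d, rfl⟩ := hY
    obtain ⟨f, hf⟩ := oddPoly_mem_adjoin A c
    obtain ⟨g, hg⟩ := oddPoly_mem_adjoin A d
    rw [hf, hg, ← map_mul, ← map_mul, mul_comm]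
  · rw [← h.range_oddPoly] at hX
    obtain ⟨c, rfl⟩ := hX
    obtain ⟨f, hf⟩ := oddPoly_mem_adjoin A c
    have h1 : toLin' (Polynomial.aeval (offDiag A) f) =
        Polynomial.aeval (toLin' (offDiag A) : Module.End F (Fin p ⊕ Fin q → F)) f :=
      (Polynomial.aeval_algHom_apply
        (toLinAlgEquiv' : Matrix (Fin p ⊕ Fin q) (Fin p ⊕ Fin q) F ≃ₐ[F] _) (offDiag A) f).symm
    rw [hf, h1]
    exact (h.isSemisimple hq).aeval f

/-- A toral subspace containing the centralizer contains `offDiag A` itself, so all its members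
commute with `offDiag A`. -/
theorem IsRegPair.isCartanSubspace [CharZero F] (hq : 0 < q) {A : Matrix (Fin p) (Fin q) F}
    {w : Fin q → F} (h : IsRegPair A w) :
    IsCartanSubspace p q (gMinusCentralizer p q (offDiag A)) := by
  refine ⟨h.isToralSubspace hq, fun t ht hle X hX => ?_⟩
  rw [isToralSubspace_iff] at ht
  rw [mem_gMinusCentralizer_iff]
  refine ⟨ht.1 hX, ht.2.1 _ (hle ?_) _ hX⟩
  exact (mem_gMinusCentralizer_iff _ _).2 ⟨offDiag_mem_gMinus A, rfl⟩

end Regular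

/-! ### Joint eigenvectors of commuting semisimple operators. -/

section JointEigen

variable {K : Type*} [Field K] [IsAlgClosed K]

/-- The joint generalized eigenspaces span, and semisimplicity turns them into joint eigenspaces. -/
theorem span_joint_eigenvectors {V ι : Type*} [AddCommGroup V] [Module K V] [FiniteDimensional K V]
    (f : ι → Module.End K V) (hf : ∀ i j, f i * f j = f j * f i) (hs : ∀ i, (f i).IsSemisimple) :
    Submodule.span K {v | ∀ i, ∃ c : K, f i v = c • v} = ⊤ := by
  have h := Module.End.iSup_iInf_maxGenEigenspace_eq_top_of_iSup_maxGenEigenspace_eq_top_of_commute f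
    (fun i j _ => hf i j) (fun i => Module.End.iSup_maxGenEigenspace_eq_top (f i))
  rw [eq_top_iff, ← h]
  refine iSup_le fun χ v hv => Submodule.subset_span fun i => ⟨χ i, ?_⟩
  rw [Submodule.mem_iInf] at hv
  have h1 := hv i
  rw [(hs i).isFinitelySemisimple.maxGenEigenspace_eq_eigenspace] at h1
  exact Module.End.mem_eigenspace_iff.1 h1

end JointEigen

/-! ### Orthonormal families for a symmetric bilinear form. -/

section Bilin

variable {K V : Type*} [Field K] [AddCommGroup V] [Module K V]

/-- Projection to the orthogonal complement of an orthonormal family. -/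
def orthoProj (B : LinearMap.BilinForm K V) {k : ℕ} (W : Fin k → V) : V →ₗ[K] V :=
  LinearMap.id - ∑ i, (B (W i)).smulRight (W i)

theorem orthoProj_apply (B : LinearMap.BilinForm K V) {k : ℕ} (W : Fin k → V) (z : V) :
    orthoProj B W z = z - ∑ i, B (W i) z • W i := by
  simp [orthoProj, LinearMap.sum_apply]

theorem bilin_orthoProj {B : LinearMap.BilinForm K V} {k : ℕ} {W : Fin k → V}
    (hW : ∀ i j, B (W i) (W j) = if i = j then 1 else 0) (j : Fin k) (z : V) :
    B (W j) (orthoProj B W z) = 0 := by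
  rw [orthoProj_apply, map_sub, map_sum]
  simp [hW]

theorem bilin_orthoProj_right {B : LinearMap.BilinForm K V} (hB : ∀ x y, B x y = B y x) {k : ℕ}
    {W : Fin k → V} {y : V} (hy : ∀ i, B (W i) y = 0) (z : V) :
    B y (orthoProj B W z) = B y z := by
  rw [orthoProj_apply, map_sub, map_sum, sub_eq_self]
  exact Finset.sum_eq_zero fun i _ => by rw [map_smul, hB y, hy, smul_zero]

variable [IsAlgClosed K]

theorem exists_bilin_eq_one {B : LinearMap.BilinForm K V} {y : V} (hy : B y y ≠ 0) :
    ∃ s : K, s ≠ 0 ∧ s * s * B y y = 1 := by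
  obtain ⟨t, ht⟩ := IsAlgClosed.exists_pow_nat_eq (B y y)⁻¹ (n := 2) (by norm_num)
  refine ⟨t, ?_, ?_⟩
  · rintro rfl
    rw [zero_pow two_ne_zero] at ht
    exact hy (inv_eq_zero.1 ht.symm)
  · rw [← pow_two, ht, inv_mul_cancel₀ hy]

variable [CharZero K]

/-- If all vectors orthogonal to `W` were isotropic, polarization would kill the form on that
complement. By nondegeneracy the complement would be zero and `W` would span, against `hk`. -/
theorem exists_orthonormal_extend [FiniteDimensional K V] {B : LinearMap.BilinForm K V}
    (hB : ∀ x y, B x y = B y x) (hnd : ∀ x, (∀ y, B x y = 0) → x = 0) {k : ℕ} {W : Fin k → V}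
    (hW : ∀ i j, B (W i) (W j) = if i = j then 1 else 0) (hk : k < Module.finrank K V) :
    ∃ y, (∀ i, B (W i) y = 0) ∧ B y y = 1 := by
  by_contra hcon
  have h0 : ∀ y, (∀ i, B (W i) y = 0) → B y y = 0 := by
    intro y hy
    by_contra hne
    obtain ⟨s, -, hs⟩ := exists_bilin_eq_one hne
    refine hcon ⟨s • y, fun i => by rw [map_smul, hy, smul_zero], ?_⟩
    rw [map_smul, map_smul, LinearMap.smul_apply, smul_eq_mul, smul_eq_mul, ← mul_assoc, hs]
  have h1 : ∀ z, orthoProj B W z = 0 := by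
    intro z
    have hz := bilin_orthoProj hW (z := z)
    refine hnd _ fun z' => ?_
    have hz' := bilin_orthoProj hW (z := z')
    rw [← bilin_orthoProj_right hB hz]
    have h2 := h0 (orthoProj B W z + orthoProj B W z') fun i => by rw [map_add, hz, hz', add_zero]
    rw [map_add, map_add, LinearMap.add_apply, LinearMap.add_apply, h0 _ hz, h0 _ hz',
      hB (orthoProj B W z')] at h2
    have h3 : (2 : K) * B (orthoProj B W z) (orthoProj B W z') = 0 := by linear_combination h2
    exact (mul_eq_zero.1 h3).resolve_left two_ne_zero
  have hspan : Submodule.span K (Set.range W) = ⊤ := by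
    rw [eq_top_iff]
    rintro z -
    have := h1 z
    rw [orthoProj_apply, sub_eq_zero] at this
    rw [this]
    exact Submodule.sum_mem _ fun i _ => Submodule.smul_mem _ _ (Submodule.subset_span ⟨i, rfl⟩)
  have hle := finrank_range_le_card (R := K) W
  rw [Set.finrank, hspan, finrank_top, Fintype.card_fin] at hle
  lia

end Bilin

/-! ### Simultaneous singular value decomposition. -/

section SVD

variable {K : Type*} [Field K] {p q : ℕ}

/-- The bilinear form with matrix `J_r`. -/
noncomputable def antiForm (K : Type*) [Field K] (r : ℕ) : LinearMap.BilinForm K (Fin r → K) :=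
  Matrix.toBilin' (antiDiag K r)

theorem antiForm_apply {r : ℕ} (x y : Fin r → K) :
    antiForm K r x y = x ⬝ᵥ (antiDiag K r *ᵥ y) := Matrix.toBilin'_apply' _ _ _

theorem antiForm_comm {r : ℕ} (x y : Fin r → K) : antiForm K r x y = antiForm K r y x := by
  rw [antiForm_apply, antiForm_apply, dotProduct_mulVec, dotProduct_comm, ← mulVec_transpose,
    antiDiag_transpose]

theorem antiForm_nondegenerate {r : ℕ} (x : Fin r → K) (h : ∀ y, antiForm K r x y = 0) : x = 0 := by
  ext i
  have := h (antiDiag K r *ᵥ Pi.single i 1)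
  rw [antiForm_apply, mulVec_mulVec, antiDiag_mul_self, one_mulVec, dotProduct_single_one] at this
  exact this

/-- A♯ is the adjoint of A for the two forms, so `offDiag A` is self-adjoint for their orthogonal
sum. -/
theorem antiForm_mulVec (A : Matrix (Fin p) (Fin q) K) (y : Fin q → K) (x : Fin p → K) :
    antiForm K p (A *ᵥ y) x = antiForm K q y (sharp A *ᵥ x) := by
  rw [antiForm_apply, antiForm_apply, mulVec_mulVec, sharp, ← Matrix.mul_assoc,
    antiDiag_mul_cancel_left, ← mulVec_mulVec, ← vecMul_transpose, ← dotProduct_mulVec,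
    dotProduct_mulVec, dotProduct_mulVec]

theorem offDiag_mulVec (A : Matrix (Fin p) (Fin q) K) (v : Fin p ⊕ Fin q → K) :
    offDiag A *ᵥ v = Sum.elim (A *ᵥ (v ∘ Sum.inr)) (sharp A *ᵥ (v ∘ Sum.inl)) := by
  rw [offDiag, fromBlocks_mulVec]
  simp

variable [IsAlgClosed K] [CharZero K]

/-- Projecting to the complement of the pairs found so far preserves joint eigenvectors. If some
operator acts nontrivially there, a joint eigenvector with a nonzero eigenvalue splits into the
required u and w, once it is chosen non-isotropic. -/
theorem exists_singular_pair_extend {𝒜 : Set (Matrix (Fin p) (Fin q) K)}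
    (hspan : Submodule.span K {v : Fin p ⊕ Fin q → K |
      ∀ A ∈ 𝒜, ∃ c : K, offDiag A *ᵥ v = c • v} = ⊤)
    {k : ℕ} (hkp : k < p) (hkq : k < q) {U : Fin k → Fin p → K} {W : Fin k → Fin q → K}
    (hU : ∀ i j, antiForm K p (U i) (U j) = if i = j then 1 else 0)
    (hW : ∀ i j, antiForm K q (W i) (W j) = if i = j then 1 else 0)
    (hUW : ∀ A ∈ 𝒜, ∀ i, ∃ a : K, A *ᵥ W i = a • U i ∧ sharp A *ᵥ U i = a • W i) :
    ∃ (u : Fin p → K) (w : Fin q → K), (∀ i, antiForm K p (U i) u = 0) ∧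
      (∀ i, antiForm K q (W i) w = 0) ∧ antiForm K p u u = 1 ∧ antiForm K q w w = 1 ∧
      ∀ A ∈ 𝒜, ∃ a : K, A *ᵥ w = a • u ∧ sharp A *ᵥ u = a • w := by
  set P := antiForm K p with hP
  set Q := antiForm K q with hQ
  let πp := orthoProj P U
  let πq := orthoProj Q W
  -- projections of joint eigenvectors
  have hproj : ∀ (x : Fin p → K) (y : Fin q → K) (A) (_ : A ∈ 𝒜) (c : K), A *ᵥ y = c • x →
      sharp A *ᵥ x = c • y → A *ᵥ πq y = c • πp x ∧ sharp A *ᵥ πp x = c • πq y := by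
    intro x y A hA c h1 h2
    have hcoef : ∀ i, ∀ a : K, A *ᵥ W i = a • U i → sharp A *ᵥ U i = a • W i →
        a * Q (W i) y = c * P (U i) x ∧ a * P (U i) x = c * Q (W i) y := by
      intro i a h3 h4
      constructor
      · have := antiForm_mulVec A y (U i)
        rw [h1, h4, map_smul, map_smul, LinearMap.smul_apply, antiForm_comm x, antiForm_comm y]
          at this
        exact this.symm
      · have := antiForm_mulVec A (W i) x
        rw [h3, h2, map_smul, map_smul, LinearMap.smul_apply] at this
        exact this
    constructor
    · simp only [πp, πq, orthoProj_apply, mulVec_sub, h1, smul_sub, Finset.smul_sum]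
      rw [mulVec_sum]
      congr 1
      refine Finset.sum_congr rfl fun i _ => ?_
      obtain ⟨a, h3, h4⟩ := hUW A hA i
      rw [mulVec_smul, h3, smul_smul, smul_smul, mul_comm, (hcoef i a h3 h4).1]
    · simp only [πp, πq, orthoProj_apply, mulVec_sub, h2, smul_sub, Finset.smul_sum]
      rw [mulVec_sum]
      congr 1
      refine Finset.sum_congr rfl fun i _ => ?_
      obtain ⟨a, h3, h4⟩ := hUW A hA i
      rw [mulVec_smul, h4, smul_smul, smul_smul, mul_comm, (hcoef i a h3 h4).2]
  have hsplit : ∀ (A : Matrix (Fin p) (Fin q) K) (v : Fin p ⊕ Fin q → K) (c : K),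
      offDiag A *ᵥ v = c • v →
      A *ᵥ (v ∘ Sum.inr) = c • (v ∘ Sum.inl) ∧ sharp A *ᵥ (v ∘ Sum.inl) = c • (v ∘ Sum.inr) := by
    intro A v c h
    rw [offDiag_mulVec] at h
    constructor
    · ext i
      exact congrFun h (Sum.inl i)
    · ext i
      exact congrFun h (Sum.inr i)
  by_cases hzero : ∀ v : Fin p ⊕ Fin q → K, (∀ A ∈ 𝒜, ∃ c : K, offDiag A *ᵥ v = c • v) →
      ∀ A ∈ 𝒜, A *ᵥ πq (v ∘ Sum.inr) = 0 ∧ sharp A *ᵥ πp (v ∘ Sum.inl) = 0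
  -- All operators vanish on the complement, so any two unit vectors there serve, with singular
  -- value 0.
  · obtain ⟨u, hu, huu⟩ := exists_orthonormal_extend antiForm_comm antiForm_nondegenerate hU
      (by rwa [Module.finrank_fin_fun])
    obtain ⟨w, hw, hww⟩ := exists_orthonormal_extend antiForm_comm antiForm_nondegenerate hW
      (by rwa [Module.finrank_fin_fun])
    refine ⟨u, w, hu, hw, huu, hww, fun A hA => ⟨0, ?_, ?_⟩⟩
    all_goals rw [zero_smul]
    · have h1 : (mulVecLin A ∘ₗ πq ∘ₗ LinearMap.funLeft K K Sum.inr :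
          (Fin p ⊕ Fin q → K) →ₗ[K] _) = 0 :=
        LinearMap.ext_on_range (v := Subtype.val) (by rw [Subtype.range_coe]; exact hspan)
          fun v => (hzero v.1 v.2 A hA).1
      have h2 := LinearMap.congr_fun h1 (Sum.elim 0 w)
      have h3 : πq w = w := by
        simp only [πq, orthoProj_apply, hw, zero_smul, Finset.sum_const_zero, sub_zero]
      rw [← h3]
      exact h2
    · have h1 : (mulVecLin (sharp A) ∘ₗ πp ∘ₗ LinearMap.funLeft K K Sum.inl :
          (Fin p ⊕ Fin q → K) →ₗ[K] _) = 0 :=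
        LinearMap.ext_on_range (v := Subtype.val) (by rw [Subtype.range_coe]; exact hspan)
          fun v => (hzero v.1 v.2 A hA).2
      have h2 := LinearMap.congr_fun h1 (Sum.elim u 0)
      have h3 : πp u = u := by
        simp only [πp, orthoProj_apply, hu, zero_smul, Finset.sum_const_zero, sub_zero]
      rw [← h3]
      exact h2
  · push Not at hzero
    obtain ⟨v, hv, A₀, hA₀, hne⟩ := hzero
    -- joint eigenvectors in the orthogonal complement
    let E : (Fin p → K) → (Fin q → K) → (Matrix (Fin p) (Fin q) K → K) → Prop := fun x y c =>
      (∀ i, P (U i) x = 0) ∧ (∀ i, Q (W i) y = 0) ∧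
        ∀ A ∈ 𝒜, A *ᵥ y = c A • x ∧ sharp A *ᵥ x = c A • y
    have hE : ∀ v : Fin p ⊕ Fin q → K, (∀ A ∈ 𝒜, ∃ c : K, offDiag A *ᵥ v = c • v) →
        ∃ c, E (πp (v ∘ Sum.inl)) (πq (v ∘ Sum.inr)) c := by
      intro v hv
      have : ∀ A, ∃ c : K, A ∈ 𝒜 → offDiag A *ᵥ v = c • v := fun A => by
        by_cases hA : A ∈ 𝒜
        · obtain ⟨c, hc⟩ := hv A hA
          exact ⟨c, fun _ => hc⟩
        · exact ⟨0, fun h => absurd h hA⟩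
      choose c hc using this
      refine ⟨c, fun i => bilin_orthoProj hU i _, fun i => bilin_orthoProj hW i _, fun A hA => ?_⟩
      obtain ⟨h1, h2⟩ := hsplit A v (c A) (hc A hA)
      exact hproj _ _ A hA _ h1 h2
    obtain ⟨c, hc⟩ := hE v hv
    set x := πp (v ∘ Sum.inl) with hx
    set y := πq (v ∘ Sum.inr) with hy
    have hc0 : c A₀ ≠ 0 := by
      intro h0
      obtain ⟨h1, h2⟩ := hc.2.2 A₀ hA₀
      rw [h0, zero_smul] at h1 h2
      exact hne h1 h2
    have hbal : ∀ x y x' y' c c', E x y c → E x' y' c' → ∀ A ∈ 𝒜,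
        c A * P x x' = c' A * Q y y' ∧ c A * Q y y' = c' A * P x x' := by
      intro x y x' y' c c' h h' A hA
      obtain ⟨h1, h2⟩ := h.2.2 A hA
      obtain ⟨h3, h4⟩ := h'.2.2 A hA
      constructor
      · have := antiForm_mulVec A y x'
        rw [h1, h4, map_smul, map_smul, LinearMap.smul_apply] at this
        exact this
      · have := antiForm_mulVec A y' x
        rw [h3, h2, map_smul, map_smul, LinearMap.smul_apply, antiForm_comm x', antiForm_comm y']
          at this
        exact this.symm
    -- Joint eigenvectors with different eigenvalues are orthogonal. If those with eigenvalues `c`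
    -- were all isotropic, polarization would make (x, y) orthogonal to everything, hence zero.
    obtain ⟨x₁, y₁, h₁, hne₁⟩ : ∃ x₁ y₁, E x₁ y₁ c ∧ P x₁ x₁ + Q y₁ y₁ ≠ 0 := by
      by_contra hcon
      push Not at hcon
      have hall : ∀ v' : Fin p ⊕ Fin q → K, P x (v' ∘ Sum.inl) + Q y (v' ∘ Sum.inr) = 0 := by
        have h1 : (P x ∘ₗ LinearMap.funLeft K K Sum.inl + Q y ∘ₗ LinearMap.funLeft K K Sum.inr :
            (Fin p ⊕ Fin q → K) →ₗ[K] K) = 0 := by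
          refine LinearMap.ext_on_range (v := Subtype.val) (by rw [Subtype.range_coe]; exact hspan)
            fun v' => ?_
          obtain ⟨c', hc'⟩ := hE v'.1 v'.2
          change P x (v'.1 ∘ Sum.inl) + Q y (v'.1 ∘ Sum.inr) = 0
          rw [← bilin_orthoProj_right antiForm_comm hc.1,
            ← bilin_orthoProj_right antiForm_comm hc.2.1]
          by_contra hne'
          set x' := orthoProj P U (v'.1 ∘ Sum.inl)
          set y' := orthoProj Q W (v'.1 ∘ Sum.inr)
          have hcc : ∀ A ∈ 𝒜, c' A = c A := by
            intro A hA
            obtain ⟨h1, h2⟩ := hbal _ _ _ _ _ _ hc hc' A hA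
            have : (c' A - c A) * (P x x' + Q y y') = 0 := by linear_combination -h1 - h2
            exact sub_eq_zero.1 ((mul_eq_zero.1 this).resolve_right hne')
          have hc'' : E x' y' c := ⟨hc'.1, hc'.2.1, fun A hA => by
            rw [← hcc A hA]
            exact hc'.2.2 A hA⟩
          have hsum : E (x + x') (y + y') c := by
            refine ⟨fun i => by rw [map_add, hc.1, hc'.1, add_zero],
              fun i => by rw [map_add, hc.2.1, hc'.2.1, add_zero], fun A hA => ?_⟩
            rw [mulVec_add, mulVec_add, (hc.2.2 A hA).1, (hc.2.2 A hA).2, (hc''.2.2 A hA).1,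
              (hc''.2.2 A hA).2, smul_add, smul_add]
            exact ⟨rfl, rfl⟩
          have e1 := hcon _ _ hc
          have e2 := hcon _ _ hc''
          have e3 := hcon _ _ hsum
          simp only [map_add, LinearMap.add_apply] at e3
          rw [hP, hQ, antiForm_comm x' x, antiForm_comm y' y, ← hP, ← hQ] at e3
          have : (2 : K) * (P x x' + Q y y') = 0 := by linear_combination e3 - e1 - e2
          exact hne' ((mul_eq_zero.1 this).resolve_left two_ne_zero)
        exact fun v' => LinearMap.congr_fun h1 v'
      have hx0 : x = 0 := antiForm_nondegenerate x fun z => by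
        have := hall (Sum.elim z 0)
        rw [Sum.elim_comp_inl, Sum.elim_comp_inr, map_zero, add_zero] at this
        exact this
      have hy0 : y = 0 := antiForm_nondegenerate y fun z => by
        have := hall (Sum.elim 0 z)
        rw [Sum.elim_comp_inl, Sum.elim_comp_inr, map_zero, zero_add] at this
        exact this
      refine hne ?_ ?_
      · rw [hy0, mulVec_zero]
      · rw [hx0, mulVec_zero]
    -- As c A₀ ≠ 0, both components have the same norm, and a single scalar normalizes them.
    have heq : P x₁ x₁ = Q y₁ y₁ :=
      mul_left_cancel₀ hc0 (hbal _ _ _ _ _ _ h₁ h₁ A₀ hA₀).1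
    have hQ0 : Q y₁ y₁ ≠ 0 := by
      intro h0
      rw [heq, h0, add_zero] at hne₁
      exact hne₁ rfl
    obtain ⟨s, -, hs⟩ := exists_bilin_eq_one hQ0
    refine ⟨s • x₁, s • y₁, fun i => by rw [map_smul, h₁.1, smul_zero],
      fun i => by rw [map_smul, h₁.2.1, smul_zero], ?_, ?_, fun A hA => ⟨c A, ?_, ?_⟩⟩
    · rw [map_smul, map_smul, LinearMap.smul_apply, smul_eq_mul, smul_eq_mul, ← mul_assoc, heq, hs]
    · rw [map_smul, map_smul, LinearMap.smul_apply, smul_eq_mul, smul_eq_mul, ← mul_assoc, hs]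
    · rw [mulVec_smul, (h₁.2.2 A hA).1, smul_comm]
    · rw [mulVec_smul, (h₁.2.2 A hA).2, smul_comm]

/-- Simultaneous singular value decomposition. -/
theorem exists_singular_pairs {𝒜 : Set (Matrix (Fin p) (Fin q) K)}
    (hspan : Submodule.span K {v : Fin p ⊕ Fin q → K |
      ∀ A ∈ 𝒜, ∃ c : K, offDiag A *ᵥ v = c • v} = ⊤) (k : ℕ) (hkp : k ≤ p) (hkq : k ≤ q) :
    ∃ (U : Fin k → Fin p → K) (W : Fin k → Fin q → K),
      (∀ i j, antiForm K p (U i) (U j) = if i = j then 1 else 0) ∧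
      (∀ i j, antiForm K q (W i) (W j) = if i = j then 1 else 0) ∧
      ∀ A ∈ 𝒜, ∀ i, ∃ a : K, A *ᵥ W i = a • U i ∧ sharp A *ᵥ U i = a • W i := by
  induction k with
  | zero => exact ⟨Fin.elim0, Fin.elim0, fun i => i.elim0, fun i => i.elim0, fun _ _ i => i.elim0⟩
  | succ k ih =>
    obtain ⟨U, W, hU, hW, hUW⟩ := ih (by lia) (by lia)
    obtain ⟨u, w, hu, hw, huu, hww, huw⟩ := exists_singular_pair_extend hspan hkp hkq hU hW hUW
    have hsnoc : ∀ {r : ℕ} {Z : Fin k → Fin r → K} {z : Fin r → K},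
        (∀ i j, antiForm K r (Z i) (Z j) = if i = j then 1 else 0) →
        (∀ i, antiForm K r (Z i) z = 0) → antiForm K r z z = 1 → ∀ i j : Fin (k + 1),
        antiForm K r ((Fin.snoc Z z : Fin (k + 1) → Fin r → K) i)
          ((Fin.snoc Z z : Fin (k + 1) → Fin r → K) j) = if i = j then 1 else 0 := by
      intro r Z z h1 h2 h3 i j
      refine Fin.lastCases ?_ (fun i => ?_) i <;> refine Fin.lastCases ?_ (fun j => ?_) j
      · simp [h3]
      · rw [Fin.snoc_last, Fin.snoc_castSucc, antiForm_comm, h2, if_neg (Fin.castSucc_lt_last j).ne']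
      · rw [Fin.snoc_last, Fin.snoc_castSucc, h2, if_neg (Fin.castSucc_lt_last i).ne]
      · simp [h1]
    refine ⟨Fin.snoc U u, Fin.snoc W w, hsnoc hU hu huu, hsnoc hW hw hww, fun A hA i => ?_⟩
    refine Fin.lastCases ?_ (fun i => ?_) i
    · simpa using huw A hA
    · simpa using hUW A hA i

end SVD

/-! ### Regularity as the nonvanishing of a polynomial. -/

section GenericRegular

/-- The product of the determinant of the Krylov matrix, the discriminant of the characteristic
polynomial and the determinant of `T`. -/
noncomputable def krylovDisc {R : Type*} [CommRing R] {q : ℕ} (T : Matrix (Fin q) (Fin q) R)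
    (w : Fin q → R) : R :=
  (krylov T w).det * Polynomial.resultant T.charpoly (Polynomial.derivative T.charpoly) q (q - 1) *
    T.det

/-- A polynomial in the entries of `A` and `w` which does not vanish iff `(A, w)` is regular. -/
noncomputable def regPoly {R : Type*} [CommRing R] {p q : ℕ} (A : Matrix (Fin p) (Fin q) R)
    (w : Fin q → R) : R :=
  krylovDisc (Aᵀ.submatrix Fin.rev Fin.rev * A) w

theorem krylov_map {R S : Type*} [CommRing R] [CommRing S] (f : R →+* S) {q : ℕ}
    (T : Matrix (Fin q) (Fin q) R) (w : Fin q → R) :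
    (krylov T w).map f = krylov (T.map f) (f ∘ w) := by
  ext i k
  have : (T.map f) ^ (k : ℕ) = (T ^ (k : ℕ)).map f := (map_pow f.mapMatrix T k).symm
  rw [map_apply, krylov, krylov, of_apply, of_apply, this, RingHom.map_mulVec]

/-- The resultant is taken with the fixed degrees q and q - 1, not the actual ones, so it commutes
with every ring homomorphism. -/
theorem krylovDisc_map {R S : Type*} [CommRing R] [CommRing S] (f : R →+* S) {q : ℕ}
    (T : Matrix (Fin q) (Fin q) R) (w : Fin q → R) :
    f (krylovDisc T w) = krylovDisc (T.map f) (f ∘ w) := by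
  have h1 : f (Polynomial.resultant T.charpoly (Polynomial.derivative T.charpoly) q (q - 1)) =
      Polynomial.resultant (T.map f).charpoly (Polynomial.derivative (T.map f).charpoly) q
        (q - 1) := by
    rw [Matrix.charpoly_map, Polynomial.derivative_map, Polynomial.resultant_map_map]
  rw [krylovDisc, krylovDisc, map_mul, map_mul, h1, RingHom.map_det, RingHom.map_det,
    RingHom.mapMatrix_apply, RingHom.mapMatrix_apply, krylov_map]

theorem regPoly_map {R S : Type*} [CommRing R] [CommRing S] (f : R →+* S) {p q : ℕ}
    (A : Matrix (Fin p) (Fin q) R) (w : Fin q → R) :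
    f (regPoly A w) = regPoly (A.map f) (f ∘ w) := by
  rw [regPoly, regPoly, krylovDisc_map, Matrix.map_mul]
  rfl

variable {F : Type*} [Field F] {p q : ℕ}

theorem krylovDisc_ne_zero_iff (T : Matrix (Fin q) (Fin q) F) (w : Fin q → F) :
    krylovDisc T w ≠ 0 ↔ (krylov T w).det ≠ 0 ∧
      Polynomial.resultant T.charpoly (Polynomial.derivative T.charpoly) q (q - 1) ≠ 0 ∧
      T.det ≠ 0 := by
  rw [krylovDisc, mul_ne_zero_iff, mul_ne_zero_iff, and_assoc]

theorem isRegPair_iff (A : Matrix (Fin p) (Fin q) F) (w : Fin q → F) :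
    IsRegPair A w ↔ regPoly A w ≠ 0 := by
  have : Aᵀ.submatrix Fin.rev Fin.rev = sharp A := by
    ext i j
    rw [sharp_apply]
    rfl
  rw [regPoly, this, krylovDisc_ne_zero_iff]
  constructor
  · intro h
    exact ⟨h.krylov_ne, h.resultant_ne, h.det_ne⟩
  · rintro ⟨h1, h2, h3⟩
    constructor
    · exact h1
    · exact h2
    · exact h3

/-- For a diagonalized `T` the sum of the eigenvectors in `W` is cyclic: its Krylov matrix is `W`
times the Vandermonde matrix of the eigenvalues. -/
theorem krylovDisc_ne_zero_of_diagonal [CharZero F] {T W V : Matrix (Fin q) (Fin q) F} {e : Fin q → F}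
    (hVW : V * W = 1) (hT : T = W * diagonal e * V) (he : Function.Injective e)
    (he0 : ∀ i, e i ≠ 0) : krylovDisc T (W *ᵥ 1) ≠ 0 := by
  have hWV : W * V = 1 := mul_eq_one_comm.1 hVW
  have hdet : W.det * V.det = 1 := by rw [← det_mul, hWV, det_one]
  have hdetW : W.det ≠ 0 := left_ne_zero_of_mul_eq_one hdet
  have hdetV : V.det ≠ 0 := right_ne_zero_of_mul_eq_one hdet
  rw [krylovDisc_ne_zero_iff]
  refine ⟨?_, ?_, ?_⟩
  · have hTW : T * W = W * diagonal e := by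
      rw [hT, Matrix.mul_assoc, hVW, Matrix.mul_one]
    have hpow : ∀ k : ℕ, T ^ k * W = W * diagonal (fun i => e i ^ k) := by
      intro k
      induction k with
      | zero => simp
      | succ k ih =>
        rw [pow_succ, Matrix.mul_assoc, hTW, ← Matrix.mul_assoc, ih, Matrix.mul_assoc,
          diagonal_mul_diagonal]
        simp only [pow_succ]
    have hk : krylov T (W *ᵥ 1) = W * vandermonde e := by
      ext i k
      rw [krylov, of_apply, mulVec_mulVec, hpow, ← mulVec_mulVec, Matrix.mul_apply]
      change ∑ l, W i l * (diagonal (fun i => e i ^ (k : ℕ)) *ᵥ 1) l = _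
      refine Finset.sum_congr rfl fun l _ => ?_
      rw [mulVec_diagonal, vandermonde_apply, Pi.one_apply, mul_one]
    rw [hk, det_mul]
    exact mul_ne_zero hdetW (det_vandermonde_ne_zero_iff.2 he)
  · have hchar : T.charpoly = ∏ i, (Polynomial.X - Polynomial.C (e i)) := by
      rw [hT, charpoly_mul_comm, ← Matrix.mul_assoc, hVW, Matrix.one_mul, charpoly_diagonal]
    have hsep : T.charpoly.Separable := by
      rw [hchar]
      exact Polynomial.separable_prod_X_sub_C_iff.2 he
    have hnat : T.charpoly.natDegree = q := by
      rw [charpoly_natDegree_eq_dim, Fintype.card_fin]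
    have hres := Polynomial.resultant_ne_zero _ _ hsep
    rwa [Polynomial.natDegree_derivative, hnat] at hres
  · rw [hT, det_mul, det_mul, det_diagonal]
    exact mul_ne_zero (mul_ne_zero hdetW (Finset.prod_ne_zero_iff.2 fun i _ => he0 i)) hdetV

end GenericRegular

/-! ### A regular element commuting with a family of singular pairs. -/

section RegularPoint

variable {K : Type*} [Field K] [CharZero K] {p q : ℕ}

/-- `A₀` has the same singular vectors as the members of `𝒜` but freely prescribed singular values;
matrices diagonal in the same pair of orthonormal families give commuting `offDiag`s. -/
theorem exists_isRegPair_of_singular_pairs {𝒜 : Set (Matrix (Fin p) (Fin q) K)}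
    {U : Fin q → Fin p → K} {W : Fin q → Fin q → K}
    (hU : ∀ i j, antiForm K p (U i) (U j) = if i = j then 1 else 0)
    (hW : ∀ i j, antiForm K q (W i) (W j) = if i = j then 1 else 0)
    (hUW : ∀ A ∈ 𝒜, ∀ i, ∃ a : K, A *ᵥ W i = a • U i ∧ sharp A *ᵥ U i = a • W i) :
    ∃ (A₀ : Matrix (Fin p) (Fin q) K) (w : Fin q → K), IsRegPair A₀ w ∧
      ∀ A ∈ 𝒜, offDiag A * offDiag A₀ = offDiag A₀ * offDiag A := by
  obtain ⟨Um, hUm0⟩ : ∃ Um : Matrix (Fin p) (Fin q) K, ∀ i j, Um i j = U j i :=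
    ⟨of fun i j => U j i, fun _ _ => rfl⟩
  obtain ⟨Wm, hWm0⟩ : ∃ Wm : Matrix (Fin q) (Fin q) K, ∀ i j, Wm i j = W j i :=
    ⟨of fun i j => W j i, fun _ _ => rfl⟩
  have hgram : ∀ {r : ℕ} {Z : Fin q → Fin r → K} {M : Matrix (Fin r) (Fin q) K},
      (∀ i j, M i j = Z j i) →
      (∀ i j, antiForm K r (Z i) (Z j) = if i = j then 1 else 0) → Mᵀ * (antiDiag K r * M) = 1 := by
    intro r Z M hM h
    ext i j
    rw [Matrix.one_apply, ← h, antiForm_apply, Matrix.mul_apply]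
    refine Finset.sum_congr rfl fun l _ => ?_
    rw [transpose_apply, hM, Matrix.mul_apply]
    congr 1
    exact Finset.sum_congr rfl fun m _ => by rw [hM]
  have hUm : Umᵀ * (antiDiag K p * Um) = 1 := hgram hUm0 hU
  have hWm : Wmᵀ * (antiDiag K q * Wm) = 1 := hgram hWm0 hW
  -- The squares of the numbers i + 1, which become the eigenvalues of A₀♯A₀, are distinct and
  -- nonzero in characteristic zero.
  obtain ⟨d, hd⟩ : ∃ d : Fin q → K, ∀ i, d i = ((i : ℕ) : K) + 1 := ⟨_, fun _ => rfl⟩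
  obtain ⟨A₀, hA₀'⟩ : ∃ A₀, A₀ = Um * diagonal d * (Wmᵀ * antiDiag K q) := ⟨_, rfl⟩
  have hA₀ : sharp A₀ = Wm * diagonal d * (Umᵀ * antiDiag K p) := by
    simp only [hA₀', sharp, transpose_mul, transpose_transpose, antiDiag_transpose,
      diagonal_transpose, Matrix.mul_assoc, antiDiag_mul_cancel_left]
  have hT : sharp A₀ * A₀ = Wm * diagonal (fun i => d i * d i) * (Wmᵀ * antiDiag K q) := by
    rw [hA₀, hA₀']
    calc Wm * diagonal d * (Umᵀ * antiDiag K p) * (Um * diagonal d * (Wmᵀ * antiDiag K q))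
        = Wm * diagonal d * (Umᵀ * (antiDiag K p * Um)) * diagonal d * (Wmᵀ * antiDiag K q) := by
          simp only [Matrix.mul_assoc]
      _ = _ := by rw [hUm, Matrix.mul_one, Matrix.mul_assoc Wm, diagonal_mul_diagonal]
  have hVW : (Wmᵀ * antiDiag K q) * Wm = 1 := by rw [Matrix.mul_assoc, hWm]
  have hWV : Wm * (Wmᵀ * antiDiag K q) = 1 := mul_eq_one_comm.1 hVW
  have hdinj : Function.Injective fun i => d i * d i := by
    intro i j hij
    have h1 : ((i : ℕ) + 1) * ((i : ℕ) + 1) = ((j : ℕ) + 1) * ((j : ℕ) + 1) := by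
      simp only [hd] at hij
      exact_mod_cast hij
    exact Fin.ext (by simpa using Nat.mul_self_inj.1 h1)
  have hd0 : ∀ i, d i * d i ≠ 0 := fun i => by
    rw [hd]
    exact mul_ne_zero (Nat.cast_add_one_ne_zero _) (Nat.cast_add_one_ne_zero _)
  have hcommA : ∀ A ∈ 𝒜, offDiag A * offDiag A₀ = offDiag A₀ * offDiag A := by
    intro A hA
    choose a ha using hUW A hA
    have h1 : A * Wm = Um * diagonal a := by
      ext i j
      have := congrFun (ha j).1 i
      rw [Pi.smul_apply, smul_eq_mul, mul_comm] at this
      rw [mul_diagonal, hUm0, ← this, Matrix.mul_apply]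
      exact Finset.sum_congr rfl fun l _ => by rw [hWm0]
    have h2 : sharp A * Um = Wm * diagonal a := by
      ext i j
      have := congrFun (ha j).2 i
      rw [Pi.smul_apply, smul_eq_mul, mul_comm] at this
      rw [mul_diagonal, hWm0, ← this, Matrix.mul_apply]
      exact Finset.sum_congr rfl fun l _ => by rw [hUm0]
    have h3 : Wmᵀ * antiDiag K q * sharp A = diagonal a * (Umᵀ * antiDiag K p) := by
      have := congrArg transpose h1
      rw [transpose_mul, transpose_mul, diagonal_transpose] at this
      rw [← Matrix.mul_assoc, ← this, sharp]
      simp only [Matrix.mul_assoc, antiDiag_mul_cancel_left]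
    have h4 : Umᵀ * antiDiag K p * A = diagonal a * (Wmᵀ * antiDiag K q) := by
      have := congrArg transpose h2
      rw [transpose_mul, transpose_mul, diagonal_transpose] at this
      rw [← Matrix.mul_assoc, ← this, sharp]
      simp only [transpose_mul, antiDiag_transpose, transpose_transpose, Matrix.mul_assoc,
        antiDiag_mul_self, Matrix.mul_one]
    have hcomm : diagonal a * diagonal d = diagonal d * diagonal a := by
      rw [diagonal_mul_diagonal, diagonal_mul_diagonal]
      simp only [mul_comm]
    rw [offDiag_commute_iff]
    constructor
    · calc A * sharp A₀ = A * Wm * diagonal d * (Umᵀ * antiDiag K p) := by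
            rw [hA₀]; simp only [Matrix.mul_assoc]
        _ = Um * (diagonal a * diagonal d) * (Umᵀ * antiDiag K p) := by
            rw [h1]; simp only [Matrix.mul_assoc]
        _ = Um * diagonal d * (diagonal a * (Umᵀ * antiDiag K p)) := by
            rw [hcomm]; simp only [Matrix.mul_assoc]
        _ = A₀ * sharp A := by rw [← h3]; simp only [hA₀', Matrix.mul_assoc]
    · calc sharp A * A₀ = sharp A * Um * diagonal d * (Wmᵀ * antiDiag K q) := by
            simp only [hA₀', Matrix.mul_assoc]
        _ = Wm * (diagonal a * diagonal d) * (Wmᵀ * antiDiag K q) := by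
            rw [h2]; simp only [Matrix.mul_assoc]
        _ = Wm * diagonal d * (diagonal a * (Wmᵀ * antiDiag K q)) := by
            rw [hcomm]; simp only [Matrix.mul_assoc]
        _ = sharp A₀ * A := by rw [← h4, hA₀]; simp only [Matrix.mul_assoc]
  refine ⟨A₀, Wm *ᵥ 1, (isRegPair_iff _ _).2 ?_, hcommA⟩
  have hrev : A₀ᵀ.submatrix Fin.rev Fin.rev = sharp A₀ := by
    ext i j
    rw [sharp_apply]
    rfl
  rw [regPoly, hrev]
  exact krylovDisc_ne_zero_of_diagonal hVW hT hdinj hd0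

end RegularPoint

/-! ### Descent from the algebraic closure, and rank θ. -/

section Descent

variable {F K : Type*} [Field F] [Field K] [Algebra F K] {p q : ℕ}

/-- Over the perfect field `F` the squarefree minimal polynomial is separable, so it stays
squarefree over `K` and still annihilates. -/
theorem isSemisimple_map [CharZero F] {n : Type*} [Fintype n] [DecidableEq n] {X : Matrix n n F}
    (h : Module.End.IsSemisimple (toLin' X)) :
    Module.End.IsSemisimple (toLin' (X.map (algebraMap F K))) := by
  have hsep : (minpoly F (toLin' X)).Separable :=
    PerfectField.separable_iff_squarefree.2 h.minpoly_squarefree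
  refine Module.End.isSemisimple_of_squarefree_aeval_eq_zero
    (p := (minpoly F (toLin' X)).map (algebraMap F K)) hsep.map.squarefree ?_
  have h1 : Polynomial.aeval X (minpoly F (toLin' X)) = 0 := by
    have h2 := minpoly.aeval F (toLin' X)
    have h3 := Polynomial.aeval_algHom_apply (toLinAlgEquiv' : Matrix n n F ≃ₐ[F] _) X
      (minpoly F (toLin' X))
    exact toLin'.injective ((h3.symm.trans h2).trans (map_zero toLin').symm)
  have h4 := Polynomial.aeval_algHom_apply
    ((Algebra.ofId F K).mapMatrix : Matrix n n F →ₐ[F] Matrix n n K) X (minpoly F (toLin' X))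
  rw [h1, map_zero] at h4
  have h5 := Polynomial.aeval_algHom_apply (toLinAlgEquiv' : Matrix n n K ≃ₐ[K] _)
    (X.map (algebraMap F K)) ((minpoly F (toLin' X)).map (algebraMap F K))
  refine h5.trans ?_
  rw [Polynomial.aeval_map_algebraMap]
  exact (congrArg _ h4).trans (map_zero _)

/-- Commuting with matrices over `F` is an `F`-linear condition, so each coordinate of `A₀` in an
`F`-basis of `K` satisfies it, and so do all their `F`-combinations. Regularity of a combination is
a polynomial condition on its coefficients. -/
theorem exists_isRegPair_of_map [CharZero F]
    {t : Set (Matrix (Fin p ⊕ Fin q) (Fin p ⊕ Fin q) F)} {A₀ : Matrix (Fin p) (Fin q) K}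
    {w₀ : Fin q → K} (h : IsRegPair A₀ w₀)
    (ht : ∀ X ∈ t, X.map (algebraMap F K) * offDiag A₀ = offDiag A₀ * X.map (algebraMap F K)) :
    ∃ (A : Matrix (Fin p) (Fin q) F) (w : Fin q → F), IsRegPair A w ∧
      ∀ X ∈ t, X * offDiag A = offDiag A * X := by
  classical
  let b := Module.Basis.ofVectorSpace F K
  let φ := fun j => b.coord j
  let s : Finset (Module.Basis.ofVectorSpaceIndex F K) :=
    (Finset.univ.biUnion fun i => Finset.univ.biUnion fun l => (b.repr (A₀ i l)).support) ∪
      Finset.univ.biUnion fun l => (b.repr (w₀ l)).support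
  have hsum : ∀ x : K, (b.repr x).support ⊆ s →
      ∑ j ∈ s, b j * algebraMap F K (φ j x) = x := by
    intro x hx
    conv_rhs => rw [← b.linearCombination_repr x, Finsupp.linearCombination_apply,
      Finsupp.sum_of_support_subset _ hx _ (by simp)]
    refine Finset.sum_congr rfl fun j _ => ?_
    rw [Algebra.smul_def, mul_comm]
    rfl
  let P := regPoly
    (of fun i l => ∑ j ∈ s, MvPolynomial.X j * MvPolynomial.C (φ j (A₀ i l)))
    (fun l => ∑ j ∈ s, MvPolynomial.X j * MvPolynomial.C (φ j (w₀ l)))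
  -- Specializing the variables to the basis vectors of `K` recovers (A₀, w₀), where `regPoly` does
  -- not vanish.
  have hP : P ≠ 0 := by
    intro h0
    have h1 := congrArg (MvPolynomial.eval₂Hom (algebraMap F K) b) h0
    rw [map_zero, regPoly_map] at h1
    refine (isRegPair_iff A₀ w₀).1 h ?_
    convert h1 using 2
    · ext i l
      simp only [map_apply, of_apply, map_sum, map_mul, MvPolynomial.eval₂Hom_X',
        MvPolynomial.eval₂Hom_C]
      refine (hsum _ ?_).symm
      refine Finset.Subset.trans ?_ Finset.subset_union_left
      exact Finset.Subset.trans (Finset.subset_biUnion_of_mem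
        (fun l => (b.repr (A₀ i l)).support) (Finset.mem_univ l))
        (Finset.subset_biUnion_of_mem
          (fun i => Finset.univ.biUnion fun l => (b.repr (A₀ i l)).support) (Finset.mem_univ i))
    · ext l
      simp only [Function.comp_apply, map_sum, map_mul, MvPolynomial.eval₂Hom_X',
        MvPolynomial.eval₂Hom_C]
      refine (hsum _ ?_).symm
      refine Finset.Subset.trans ?_ Finset.subset_union_right
      exact Finset.subset_biUnion_of_mem (fun l => (b.repr (w₀ l)).support) (Finset.mem_univ l)
  obtain ⟨c, hc⟩ : ∃ c, MvPolynomial.eval c P ≠ 0 := by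
    by_contra hcon
    push Not at hcon
    exact hP (MvPolynomial.funext fun c => by rw [hcon, map_zero])
  refine ⟨of fun i l => ∑ j ∈ s, c j * φ j (A₀ i l), fun l => ∑ j ∈ s, c j * φ j (w₀ l), ?_, ?_⟩
  · rw [isRegPair_iff]
    rw [regPoly_map] at hc
    convert hc using 2
    · ext i l
      simp
    · ext l
      simp
  · intro X hX
    have hj : ∀ j, X * (offDiag A₀).map (φ j) = (offDiag A₀).map (φ j) * X := by
      intro j
      have h1 : (X.map (algebraMap F K) * offDiag A₀).map (φ j) = X * (offDiag A₀).map (φ j) := by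
        ext i l
        simp only [map_apply, Matrix.mul_apply, map_sum]
        refine Finset.sum_congr rfl fun m _ => ?_
        rw [← Algebra.smul_def, map_smul, smul_eq_mul]
      have h2 : (offDiag A₀ * X.map (algebraMap F K)).map (φ j) = (offDiag A₀).map (φ j) * X := by
        ext i l
        simp only [map_apply, Matrix.mul_apply, map_sum]
        refine Finset.sum_congr rfl fun m _ => ?_
        rw [mul_comm, ← Algebra.smul_def, map_smul, smul_eq_mul, mul_comm]
      rw [← h1, ht X hX, h2]
    have hoff : offDiag (of fun i l => ∑ j ∈ s, c j * φ j (A₀ i l)) =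
        ∑ j ∈ s, c j • (offDiag A₀).map (φ j) := by
      ext i l
      rw [Matrix.sum_apply]
      rcases i with i | i <;> rcases l with l | l <;>
        simp [offDiag, sharp_apply]
    rw [hoff, Finset.mul_sum, Finset.sum_mul]
    refine Finset.sum_congr rfl fun j _ => ?_
    rw [Matrix.mul_smul, Matrix.smul_mul, hj]

theorem exists_isRegPair_commute [CharZero F] (K : Type*) [Field K] [Algebra F K] [IsAlgClosed K]
    (hpq : q ≤ p) {t : Submodule F (Matrix (Fin p ⊕ Fin q) (Fin p ⊕ Fin q) F)}
    (ht : IsToralSubspace p q t) :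
    ∃ (A : Matrix (Fin p) (Fin q) F) (w : Fin q → F), IsRegPair A w ∧
      ∀ X ∈ t, X * offDiag A = offDiag A * X := by
  have : CharZero K := charZero_of_injective_algebraMap (algebraMap F K).injective
  rw [isToralSubspace_iff] at ht
  obtain ⟨hmem, hcomm, hss⟩ := ht
  let 𝒜 : Set (Matrix (Fin p) (Fin q) K) :=
    {B | ∃ A : Matrix (Fin p) (Fin q) F, offDiag A ∈ t ∧ B = A.map (algebraMap F K)}
  have hspan : Submodule.span K {v : Fin p ⊕ Fin q → K |
      ∀ A ∈ 𝒜, ∃ c : K, offDiag A *ᵥ v = c • v} = ⊤ := by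
    have h := span_joint_eigenvectors (K := K)
      (fun X : t => (toLin' (X.1.map (algebraMap F K)) : Module.End K (Fin p ⊕ Fin q → K)))
      (fun X Y => by
        rw [Module.End.mul_eq_comp, Module.End.mul_eq_comp, ← toLin'_mul, ← toLin'_mul,
          ← Matrix.map_mul, ← Matrix.map_mul, hcomm X.1 X.2 Y.1 Y.2])
      (fun X => isSemisimple_map (hss X.1 X.2))
    rw [eq_top_iff, ← h]
    refine Submodule.span_mono fun v hv A hA => ?_
    obtain ⟨A, hA, rfl⟩ := hA
    obtain ⟨c, hc⟩ := hv ⟨_, hA⟩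
    refine ⟨c, ?_⟩
    rw [← offDiag_map, ← hc, toLin'_apply]
  obtain ⟨U, W, hU, hW, hUW⟩ := exists_singular_pairs hspan q hpq le_rfl
  obtain ⟨A₀, w₀, hreg, hA₀⟩ := exists_isRegPair_of_singular_pairs hU hW hUW
  refine exists_isRegPair_of_map (t := (t : Set (Matrix _ _ F))) hreg fun X hX => ?_
  obtain ⟨A, rfl⟩ := (mem_gMinus_iff X).1 (hmem hX)
  rw [offDiag_map]
  exact hA₀ _ ⟨A, hX, rfl⟩

/-- Existence comes from t = ⊥. A Cartan subspace lies in the centralizer of a regular element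
commuting with it; that centralizer is toral of dimension q, so maximality gives equality. -/
theorem rankThetaEq [CharZero F] (K : Type*) [Field K] [Algebra F K] [IsAlgClosed K]
    (hq : 0 < q) (hpq : q ≤ p) : RankThetaEq F p q q := by
  constructor
  · obtain ⟨A, w, h, -⟩ := exists_isRegPair_commute (F := F) (t := ⊥) K hpq (by
      rw [isToralSubspace_iff]
      refine ⟨bot_le, fun X hX Y hY => ?_, fun X hX => ?_⟩
      · rw [(Submodule.mem_bot F).1 hX, (Submodule.mem_bot F).1 hY]
      · rw [(Submodule.mem_bot F).1 hX, map_zero]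
        exact Module.End.isSemisimple_zero)
    exact ⟨_, h.isCartanSubspace hq⟩
  · intro t ht
    obtain ⟨A, w, h, hcomm⟩ := exists_isRegPair_commute (F := F) K hpq ht.1
    have hle : t ≤ gMinusCentralizer p q (offDiag A) := fun X hX =>
      (mem_gMinusCentralizer_iff _ _).2 ⟨ht.1.1 hX, (hcomm X hX).symm⟩
    rw [le_antisymm hle (ht.2 (h.isToralSubspace hq) hle), h.finrank_centralizer]

end Descent

/-! ### Hyperbolic bases of joint eigenvectors of commuting isometries. -/

section Hyperbolic

variable {K V : Type*} [Field K] [AddCommGroup V] [Module K V]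

/-- The last clause transfers to the longer family any property shared by the old vectors, `x` and
`y`, such as being a joint eigenvector. -/
theorem dual_snoc {B : LinearMap.BilinForm K V} (hB : ∀ x y, B x y = B y x) {k : ℕ} {e : Fin k ⊕ Fin k → V}
    (he : ∀ s s', B (e s) (e s') = if s' = s.swap then 1 else 0) {x y : V}
    (hx : ∀ s, B (e s) x = 0) (hy : ∀ s, B (e s) y = 0) (hxx : B x x = 0) (hyy : B y y = 0)
    (hxy : B x y = 1) :
    ∃ e' : Fin (k + 1) ⊕ Fin (k + 1) → V,
      (∀ s s', B (e' s) (e' s') = if s' = s.swap then 1 else 0) ∧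
      ∀ P : V → Prop, (∀ s, P (e s)) → P x → P y → ∀ s, P (e' s) := by
  refine ⟨Sum.elim (Fin.snoc (e ∘ Sum.inl) x : Fin (k + 1) → V)
    (Fin.snoc (e ∘ Sum.inr) y : Fin (k + 1) → V), ?_, ?_⟩
  · rintro (i | i) (j | j) <;> refine Fin.lastCases ?_ (fun i => ?_) i <;>
      refine Fin.lastCases ?_ (fun j => ?_) j <;>
      simp [he, hx, hy, hxx, hyy, hxy, hB x, hB y, (Fin.castSucc_lt_last _).ne,
        (Fin.castSucc_lt_last _).ne']
  · rintro P h1 h2 h3 (i | i) <;> refine Fin.lastCases ?_ (fun i => ?_) i <;> simp [h1, h2, h3]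

variable {σ : Type*} [Fintype σ]

/-- Projection to the orthogonal complement of a family which is dual to itself up to the
permutation `τ` of its indices. -/
def hypProj (B : LinearMap.BilinForm K V) (τ : σ → σ) (e : σ → V) : V →ₗ[K] V :=
  LinearMap.id - ∑ s, (B (e (τ s))).smulRight (e s)

variable {B : LinearMap.BilinForm K V} {τ : σ → σ} {e : σ → V}

theorem hypProj_apply (z : V) : hypProj B τ e z = z - ∑ s, B (e (τ s)) z • e s := by
  simp [hypProj, LinearMap.sum_apply]

theorem bilin_hypProj_right (hB : ∀ x y, B x y = B y x) {y : V} (hy : ∀ s, B (e s) y = 0) (z : V) :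
    B y (hypProj B τ e z) = B y z := by
  rw [hypProj_apply, map_sub, map_sum, sub_eq_self]
  exact Finset.sum_eq_zero fun s _ => by rw [map_smul, hB y, hy, smul_zero]

theorem hypProj_of_orthogonal {y : V} (hy : ∀ s, B (e s) y = 0) : hypProj B τ e y = y := by
  simp [hypProj_apply, hy]

variable [DecidableEq σ]

theorem bilin_hypProj (hτ : Function.Involutive τ)
    (he : ∀ s s', B (e s) (e s') = if s' = τ s then 1 else 0) (s : σ) (z : V) :
    B (e s) (hypProj B τ e z) = 0 := by
  rw [hypProj_apply, map_sub, map_sum]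
  simp [he, hτ s]

/-- An isometry scales `e s` and its partner `e (τ s)` by inverse scalars, so the coefficients of
the projection match. -/
theorem map_hypProj
    (he : ∀ s s', B (e s) (e s') = if s' = τ s then 1 else 0) {f : V →ₗ[K] V}
    (hf : ∀ x y, B (f x) (f y) = B x y) (hfe : ∀ s, ∃ c : K, f (e s) = c • e s) (z : V) :
    f (hypProj B τ e z) = hypProj B τ e (f z) := by
  choose c hc using hfe
  rw [hypProj_apply, hypProj_apply, map_sub, map_sum]
  congr 1
  refine Finset.sum_congr rfl fun s _ => ?_
  have h1 := hf (e s) (e (τ s))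
  have h2 := hf (e (τ s)) z
  rw [hc, hc, map_smul, map_smul, LinearMap.smul_apply, he, if_pos rfl, smul_eq_mul, smul_eq_mul,
    mul_one] at h1
  rw [hc, map_smul, LinearMap.smul_apply, smul_eq_mul] at h2
  rw [map_smul, hc, smul_smul, ← h2]
  congr 1
  linear_combination (B (e (τ s)) (f z)) * h1

theorem card_le_finrank_of_dual [FiniteDimensional K V] (hτ : Function.Involutive τ)
    (he : ∀ s s', B (e s) (e s') = if s' = τ s then 1 else 0) :
    Fintype.card σ ≤ Module.finrank K V := by
  refine LinearIndependent.fintype_card_le_finrank (R := K) (b := e) ?_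
  rw [Fintype.linearIndependent_iff]
  intro c hc s
  have := congrArg (B (e (τ s))) hc
  rw [map_sum, map_zero] at this
  simpa [he, hτ s] using this

theorem exists_ne_zero_orthogonal [FiniteDimensional K V] {κ : Type*} [Fintype κ]
    (B : LinearMap.BilinForm K V) (u : κ → V) (h : Fintype.card κ < Module.finrank K V) :
    ∃ w, w ≠ 0 ∧ ∀ s, B (u s) w = 0 := by
  have h1 : LinearMap.ker (LinearMap.pi fun s => B (u s)) ≠ ⊥ :=
    LinearMap.ker_ne_bot_of_finrank_lt (by rwa [Module.finrank_fintype_fun_eq_card])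
  obtain ⟨w, hw, hw0⟩ := Submodule.exists_mem_ne_zero_of_ne_bot h1
  exact ⟨w, hw0, fun s => congrFun hw s⟩

/-- Two orthogonal vectors w₁, w₂ exist in the complement; if w₁ is not isotropic, some a w₁ + w₂
is, by extracting a square root. -/
theorem exists_isotropic_orthogonal {K V σ : Type*} [Field K] [IsAlgClosed K] [AddCommGroup V]
    [Module K V] [FiniteDimensional K V] [Fintype σ] {B : LinearMap.BilinForm K V} (hB : ∀ x y, B x y = B y x) (u : σ → V)
    (h : Fintype.card σ + 2 ≤ Module.finrank K V) :
    ∃ w, w ≠ 0 ∧ (∀ s, B (u s) w = 0) ∧ B w w = 0 := by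
  obtain ⟨w₁, h1, ho1⟩ := exists_ne_zero_orthogonal B u (by lia)
  by_cases hw1 : B w₁ w₁ = 0
  · exact ⟨w₁, h1, ho1, hw1⟩
  obtain ⟨w₂, h2, ho2⟩ := exists_ne_zero_orthogonal B (fun s : Option σ => s.elim w₁ u) (by
    rw [Fintype.card_option]; lia)
  have ho : B w₁ w₂ = 0 := ho2 none
  obtain ⟨a, ha⟩ := IsAlgClosed.exists_pow_nat_eq (-(B w₂ w₂ / B w₁ w₁)) (n := 2) (by norm_num)
  refine ⟨a • w₁ + w₂, ?_, fun s => ?_, ?_⟩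
  · intro h0
    have := congrArg (B w₁) h0
    rw [map_add, map_smul, ho, add_zero, map_zero, smul_eq_mul] at this
    have ha0 : a = 0 := (mul_eq_zero.1 this).resolve_right hw1
    rw [ha0, zero_smul, zero_add] at h0
    exact h2 h0
  · rw [map_add, map_smul, ho1, smul_zero, zero_add]
    exact ho2 (some s)
  · simp only [map_add, map_smul, LinearMap.add_apply, LinearMap.smul_apply, smul_eq_mul, ho,
      hB w₂ w₁]
    have : a * a * B w₁ w₁ = - B w₂ w₂ := by
      rw [← pow_two, ha, neg_mul, div_mul_cancel₀ _ hw1]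
    linear_combination this

variable {ι : Type*} {f : ι → V →ₗ[K] V}

/-- By nondegeneracy some joint eigenvector pairs nontrivially with `v`; project and rescale it to
`w`, then subtract a multiple of `v` to make it isotropic. If `w` was not isotropic, `hfix` says
that it is fixed; then so is `v`, and the difference is still an eigenvector. -/
theorem exists_dual_eigenvector [CharZero K] (hB : ∀ x y, B x y = B y x)
    (hnd : ∀ x, (∀ y, B x y = 0) → x = 0) (hf : ∀ i x y, B (f i x) (f i y) = B x y)
    (hspan : Submodule.span K {v | ∀ i, ∃ c : K, f i v = c • v} = ⊤)
    (hfix : ∀ v, (∀ i, ∃ c : K, f i v = c • v) → B v v ≠ 0 → ∀ i, f i v = v)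
    (hτ : Function.Involutive τ) (he : ∀ s s', B (e s) (e s') = if s' = τ s then 1 else 0)
    (hfe : ∀ s i, ∃ c : K, f i (e s) = c • e s) {v : V} (hv0 : v ≠ 0)
    (hv : ∀ s, B (e s) v = 0) (hfv : ∀ i, ∃ c : K, f i v = c • v) (hvv : B v v = 0) :
    ∃ y, (∀ s, B (e s) y = 0) ∧ (∀ i, ∃ c : K, f i y = c • y) ∧ B y y = 0 ∧ B v y = 1 := by
  obtain ⟨b, hb, hvb⟩ : ∃ b, (∀ i, ∃ c : K, f i b = c • b) ∧ B v b ≠ 0 := by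
    by_contra hcon
    push Not at hcon
    refine hv0 (hnd v fun z => ?_)
    have h1 : B v = 0 := LinearMap.ext_on_range (v := Subtype.val)
      (by rw [Subtype.range_coe]; exact hspan) fun b => hcon b.1 b.2
    rw [h1, LinearMap.zero_apply]
  obtain ⟨w, hw⟩ : ∃ w, w = (B v b)⁻¹ • hypProj B τ e b := ⟨_, rfl⟩
  have hew : ∀ s, B (e s) w = 0 := fun s => by rw [hw, map_smul, bilin_hypProj hτ he, smul_zero]
  have hvw : B v w = 1 := by
    rw [hw, map_smul, bilin_hypProj_right hB hv, smul_eq_mul, inv_mul_cancel₀ hvb]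
  have hfw : ∀ i, ∃ c : K, f i w = c • w := fun i => by
    obtain ⟨c, hc⟩ := hb i
    refine ⟨c, ?_⟩
    rw [hw, map_smul, map_hypProj he (hf i) (fun s => hfe s i), hc, map_smul, smul_comm]
  refine ⟨w - (B w w / 2) • v, fun s => ?_, fun i => ?_, ?_, ?_⟩
  · rw [map_sub, map_smul, hew, hv, smul_zero, sub_zero]
  · by_cases hww : B w w = 0
    · rw [hww, zero_div, zero_smul, sub_zero]
      exact hfw i
    · have h1 := hfix w hfw hww i
      obtain ⟨c, hc⟩ := hfv i
      have h2 := hf i v w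
      rw [hc, h1, map_smul, LinearMap.smul_apply, hvw, smul_eq_mul, mul_one] at h2
      refine ⟨1, ?_⟩
      rw [map_sub, map_smul, h1, hc, h2, one_smul, one_smul]
  · simp only [map_sub, map_smul, LinearMap.sub_apply, LinearMap.smul_apply, smul_eq_mul, hvv,
      hvw, hB w v]
    ring
  · rw [map_sub, map_smul, hvv, hvw, smul_zero, sub_zero]

variable [IsAlgClosed K] [FiniteDimensional K V]

/-- If no joint eigenvector of the complement were isotropic, `hfix` would make every `f i` the
identity there, and any isotropic vector of the complement would be an eigenvector after all. -/
theorem exists_isotropic_eigenvector (hB : ∀ x y, B x y = B y x)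
    (hf : ∀ i x y, B (f i x) (f i y) = B x y)
    (hspan : Submodule.span K {v | ∀ i, ∃ c : K, f i v = c • v} = ⊤)
    (hfix : ∀ v, (∀ i, ∃ c : K, f i v = c • v) → B v v ≠ 0 → ∀ i, f i v = v)
    (hτ : Function.Involutive τ) (he : ∀ s s', B (e s) (e s') = if s' = τ s then 1 else 0)
    (hfe : ∀ s i, ∃ c : K, f i (e s) = c • e s)
    (hcard : Fintype.card σ + 2 ≤ Module.finrank K V) :
    ∃ v, v ≠ 0 ∧ (∀ s, B (e s) v = 0) ∧ (∀ i, ∃ c : K, f i v = c • v) ∧ B v v = 0 := by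
  by_contra hcon
  have hne : ∀ v, v ≠ 0 → (∀ s, B (e s) v = 0) → (∀ i, ∃ c : K, f i v = c • v) → B v v ≠ 0 :=
    fun v h1 h2 h3 h4 => hcon ⟨v, h1, h2, h3, h4⟩
  have hall : ∀ i w, (∀ s, B (e s) w = 0) → f i w = w := by
    intro i w hw
    have h1 : f i ∘ₗ hypProj B τ e = hypProj B τ e := by
      refine LinearMap.ext_on_range (v := Subtype.val) (by rw [Subtype.range_coe]; exact hspan)
        fun b => ?_
      change f i (hypProj B τ e b) = hypProj B τ e b
      by_cases h0 : hypProj B τ e b = 0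
      · rw [h0, map_zero]
      · have hE : ∀ i, ∃ c : K, f i (hypProj B τ e b) = c • hypProj B τ e b := fun i => by
          obtain ⟨c, hc⟩ := b.2 i
          exact ⟨c, by rw [map_hypProj he (hf i) (fun s => hfe s i), hc, map_smul]⟩
        exact hfix _ hE (hne _ h0 (fun s => bilin_hypProj hτ he s _) hE) i
    have h2 := LinearMap.congr_fun h1 w
    rw [LinearMap.comp_apply, hypProj_of_orthogonal hw] at h2
    exact h2
  obtain ⟨w, hw0, hw, hww⟩ := exists_isotropic_orthogonal hB e hcard
  exact hne w hw0 hw (fun i => ⟨1, by rw [hall i w hw, one_smul]⟩) hww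

variable [CharZero K]

theorem exists_hyperbolic_family (hB : ∀ x y, B x y = B y x)
    (hnd : ∀ x, (∀ y, B x y = 0) → x = 0) (hf : ∀ i x y, B (f i x) (f i y) = B x y)
    (hspan : Submodule.span K {v | ∀ i, ∃ c : K, f i v = c • v} = ⊤)
    (hfix : ∀ v, (∀ i, ∃ c : K, f i v = c • v) → B v v ≠ 0 → ∀ i, f i v = v) (k : ℕ)
    (hk : 2 * k ≤ Module.finrank K V) :
    ∃ e : Fin k ⊕ Fin k → V, (∀ s s', B (e s) (e s') = if s' = s.swap then 1 else 0) ∧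
      ∀ s i, ∃ c : K, f i (e s) = c • e s := by
  induction k with
  | zero => exact ⟨fun s => s.elim Fin.elim0 Fin.elim0, fun s => (s.elim Fin.elim0 Fin.elim0),
      fun s => (s.elim Fin.elim0 Fin.elim0)⟩
  | succ k ih =>
    obtain ⟨e, he, hfe⟩ := ih (by lia)
    obtain ⟨x, hx0, hx, hfx, hxx⟩ := exists_isotropic_eigenvector hB hf hspan hfix
      Sum.swap_swap he hfe (by rw [Fintype.card_sum, Fintype.card_fin]; lia)
    obtain ⟨y, hy, hfy, hyy, hxy⟩ := exists_dual_eigenvector hB hnd hf hspan hfix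
      Sum.swap_swap he hfe hx0 hx hfx hxx
    obtain ⟨e', he', hP⟩ := dual_snoc hB he hx hy hxx hyy hxy
    exact ⟨e', he', fun s => hP (fun v => ∀ i, ∃ c : K, f i v = c • v) hfe hfx hfy s⟩

/-- A hyperbolic basis of joint eigenvectors, with an additional fixed unit vector in odd
dimension. -/
theorem exists_hyperbolic_basis (hB : ∀ x y, B x y = B y x)
    (hnd : ∀ x, (∀ y, B x y = 0) → x = 0) (hf : ∀ i x y, B (f i x) (f i y) = B x y)
    (hspan : Submodule.span K {v | ∀ i, ∃ c : K, f i v = c • v} = ⊤)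
    (hfix : ∀ v, (∀ i, ∃ c : K, f i v = c • v) → B v v ≠ 0 → ∀ i, f i v = v) {k r : ℕ}
    (hr : r ≤ 1) (hk : Module.finrank K V = 2 * k + r) :
    ∃ e : (Fin k ⊕ Fin k) ⊕ Fin r → V,
      (∀ s s', B (e s) (e s') = if s' = Sum.map Sum.swap id s then 1 else 0) ∧
      (∀ s i, ∃ c : K, f i (e s) = c • e s) ∧ ∀ j i, f i (e (Sum.inr j)) = e (Sum.inr j) := by
  obtain ⟨e, he, hfe⟩ := exists_hyperbolic_family hB hnd hf hspan hfix k (by lia)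
  have hz : ∃ z : Fin r → V, ∀ j, (∀ s, B (e s) (z j) = 0) ∧ B (z j) (z j) = 1 ∧
      ∀ i, f i (z j) = z j := by
    rcases Nat.le_one_iff_eq_zero_or_eq_one.1 hr with rfl | rfl
    · exact ⟨Fin.elim0, fun j => j.elim0⟩
    · obtain ⟨w, hw0, hw⟩ := exists_ne_zero_orthogonal B e (by
        rw [Fintype.card_sum, Fintype.card_fin]; lia)
      obtain ⟨b, hb, hb0⟩ : ∃ b, (∀ i, ∃ c : K, f i b = c • b) ∧ hypProj B Sum.swap e b ≠ 0 := by
        by_contra hcon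
        push Not at hcon
        have h1 : hypProj B Sum.swap e = 0 := LinearMap.ext_on_range (v := Subtype.val)
          (by rw [Subtype.range_coe]; exact hspan) fun b => hcon b.1 b.2
        refine hw0 ?_
        rw [← hypProj_of_orthogonal (τ := Sum.swap) hw, h1, LinearMap.zero_apply]
      set v := hypProj B Sum.swap e b with hv
      have hev : ∀ s, B (e s) v = 0 := fun s => bilin_hypProj Sum.swap_swap he s b
      have hfv : ∀ i, ∃ c : K, f i v = c • v := fun i => by
        obtain ⟨c, hc⟩ := hb i
        exact ⟨c, by rw [hv, map_hypProj he (hf i) (fun s => hfe s i), hc, map_smul]⟩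
      -- Otherwise `v` and a dual vector would give k + 1 hyperbolic pairs in a space of dimension
      -- 2k + 1.
      have hvv : B v v ≠ 0 := by
        intro hvv
        obtain ⟨y, hy, hfy, hyy, hvy⟩ := exists_dual_eigenvector hB hnd hf hspan hfix
          Sum.swap_swap he hfe hb0 hev hfv hvv
        obtain ⟨e', he', -⟩ := dual_snoc hB he hev hy hvv hyy hvy
        have := card_le_finrank_of_dual Sum.swap_swap he'
        rw [Fintype.card_sum, Fintype.card_fin] at this
        lia
      obtain ⟨s, -, hs⟩ := exists_bilin_eq_one hvv
      refine ⟨fun _ => s • v, fun _ => ⟨fun t => by rw [map_smul, hev, smul_zero], ?_, fun i => ?_⟩⟩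
      · rw [map_smul, map_smul, LinearMap.smul_apply, smul_eq_mul, smul_eq_mul, ← mul_assoc, hs]
      · rw [map_smul, hfix v hfv hvv i]
  obtain ⟨z, hz⟩ := hz
  refine ⟨Sum.elim e z, ?_, ?_, fun j i => (hz j).2.2 i⟩
  · rintro (s | j) (s' | j')
    · simp [he]
    · simpa using (hz j').1 s
    · simpa [hB (z j)] using (hz j).1 s'
    · have : j = j' := Fin.ext (by lia)
      subst this
      simpa using (hz j).2.1
  · rintro (s | j) i
    · exact hfe s i
    · exact ⟨1, by rw [one_smul]; exact (hz j).2.2 i⟩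

end Hyperbolic

/-! ### Split tori: closedness, irreducibility, dimension. -/

section SplitTorus

/-- The diagonal entries `t, t⁻¹, 1` of the elements of a split torus. -/
def torusWeight {L : Type*} [Field L] {q r : ℕ} (t : Fin q → L) : (Fin q ⊕ Fin q) ⊕ Fin r → L :=
  Sum.elim (Sum.elim t fun i => (t i)⁻¹) 1

/-- The polynomial `∏ i, X i` times a weight. -/
noncomputable def clearedWeight (K : Type*) [Field K] {q r : ℕ} :
    (Fin q ⊕ Fin q) ⊕ Fin r → MvPolynomial (Fin q) K :=
  Sum.elim (Sum.elim (fun i => (∏ j, MvPolynomial.X j) * MvPolynomial.X i)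
    fun i => ∏ j ∈ Finset.univ.erase i, MvPolynomial.X j) fun _ => ∏ j, MvPolynomial.X j

theorem aeval_clearedWeight {K L : Type*} [Field K] [Field L] [Algebra K L] {q r : ℕ}
    {t : Fin q → L} (ht : ∀ i, t i ≠ 0) (s : (Fin q ⊕ Fin q) ⊕ Fin r) :
    MvPolynomial.aeval t (clearedWeight K s) = (∏ i, t i) * torusWeight t s := by
  rcases s with (i | i) | i
  · simp [clearedWeight, torusWeight]
  · simp only [clearedWeight, torusWeight, Sum.elim_inl, Sum.elim_inr, map_prod,
      MvPolynomial.aeval_X]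
    rw [← Finset.mul_prod_erase _ _ (Finset.mem_univ i), mul_right_comm, mul_inv_cancel₀ (ht i),
      one_mul]
  · simp [clearedWeight, torusWeight]

theorem torusWeight_one {L : Type*} [Field L] {q r : ℕ} (s : (Fin q ⊕ Fin q) ⊕ Fin r) :
    torusWeight (1 : Fin q → L) s = 1 := by
  rcases s with (i | i) | i <;> simp [torusWeight]

theorem torusWeight_mul {L : Type*} [Field L] {q r : ℕ} (t t' : Fin q → L)
    (s : (Fin q ⊕ Fin q) ⊕ Fin r) :
    torusWeight (t * t') s = torusWeight t s * torusWeight t' s := by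
  rcases s with (i | i) | i <;> simp [torusWeight, mul_comm]

theorem torusWeight_mul_swap {L : Type*} [Field L] {q r : ℕ} {t : Fin q → L} (ht : ∀ i, t i ≠ 0)
    (s : (Fin q ⊕ Fin q) ⊕ Fin r) :
    torusWeight t s * torusWeight t (Sum.map Sum.swap id s) = 1 := by
  rcases s with (i | i) | i <;> simp [torusWeight, ht]

/-- The weights are powers of 2 with exponents i + 1, -(i + 1) and 0; the exponent 0 occurs at most
once since r ≤ 1. They are compared in ℚ, inside `K`. -/
theorem torusWeight_injective {K : Type*} [Field K] [CharZero K] {q r : ℕ} (hr : r ≤ 1) :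
    Function.Injective
      (torusWeight (fun i => 2 ^ ((i : ℕ) + 1)) : (Fin q ⊕ Fin q) ⊕ Fin r → K) := by
  let k : (Fin q ⊕ Fin q) ⊕ Fin r → ℤ :=
    Sum.elim (Sum.elim (fun i => (i : ℕ) + 1) fun i => -((i : ℕ) + 1)) 0
  have hk : ∀ s : (Fin q ⊕ Fin q) ⊕ Fin r,
      torusWeight (fun i : Fin q => (2 : K) ^ ((i : ℕ) + 1)) s = (((2 : ℚ) ^ k s : ℚ) : K) := by
    rintro ((i | i) | i)
    · have : k (Sum.inl (Sum.inl i)) = ((i + 1 : ℕ) : ℤ) := by simp [k]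
      rw [this, zpow_natCast]
      simp [torusWeight]
    · have : k (Sum.inl (Sum.inr i)) = -((i + 1 : ℕ) : ℤ) := by simp [k]
      rw [this, _root_.zpow_neg, zpow_natCast]
      simp [torusWeight]
    · simp [torusWeight, k]
  intro s s' h
  rw [hk, hk] at h
  have h1 : k s = k s' := zpow_right_injective₀ (by norm_num) (by norm_num) (Rat.cast_injective h)
  rcases s with (i | i) | i <;> rcases s' with (j | j) | j <;> simp [k] at h1
  · rw [Fin.ext h1]
  · lia
  · lia
  · lia
  · rw [Fin.ext h1]
  · lia
  · lia
  · lia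
  · rw [show i = j from Fin.ext (by lia)]

variable {K : Type u} [Field K] {n : Type} [Fintype n] [DecidableEq n] {q r : ℕ}

/-- The torus of the matrices which are diagonal with entries `t, t⁻¹, 1` in the basis `P`. -/
def splitTorus (ε : n ≃ (Fin q ⊕ Fin q) ⊕ Fin r) (P : GL n K) : Subgroup (GL n K) where
  carrier := {g | ∃ t : Fin q → K, (∀ i, t i ≠ 0) ∧
    (P⁻¹ * g * P : GL n K).1 = diagonal fun i => torusWeight t (ε i)}
  one_mem' := ⟨1, fun _ => one_ne_zero, by simp [torusWeight_one]⟩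
  mul_mem' := by
    rintro a b ⟨t, ht, hat⟩ ⟨t', ht', hbt⟩
    refine ⟨t * t', fun i => mul_ne_zero (ht i) (ht' i), ?_⟩
    rw [show P⁻¹ * (a * b) * P = (P⁻¹ * a * P) * (P⁻¹ * b * P) by group, Units.val_mul, hat, hbt,
      diagonal_mul_diagonal]
    simp only [torusWeight_mul]
  inv_mem' := by
    rintro a ⟨t, ht, hat⟩
    refine ⟨t⁻¹, fun i => inv_ne_zero (ht i), ?_⟩
    rw [show P⁻¹ * a⁻¹ * P = (P⁻¹ * a * P)⁻¹ by group]
    refine Units.inv_eq_of_mul_eq_one_right ?_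
    rw [hat, diagonal_mul_diagonal, ← diagonal_one]
    congr 1
    ext i
    rw [← torusWeight_mul]
    have : t * t⁻¹ = 1 := by
      ext j
      exact mul_inv_cancel₀ (ht j)
    rw [this, torusWeight_one]

/-- The coordinates of a generic matrix in the basis `P`. -/
noncomputable def conjCoord (P : GL n K) : Matrix n n (MvPolynomial (n × n) K) :=
  (P⁻¹).1.map MvPolynomial.C * mvPolynomialX n n K * P.1.map MvPolynomial.C

theorem aeval_conjCoord {L : Type*} [CommRing L] [Algebra K L] (P : GL n K) (M : Matrix n n L)
    (i j : n) : MvPolynomial.aeval (fun ij : n × n => M ij.1 ij.2) (conjCoord P i j) =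
      ((P⁻¹).1.map (algebraMap K L) * M * P.1.map (algebraMap K L)) i j := by
  simp [conjCoord, Matrix.mul_apply, map_sum, Finset.sum_mul]

theorem aeval_conjCoord_self (P g : GL n K) (i j : n) :
    MvPolynomial.aeval (fun ij : n × n => g.1 ij.1 ij.2) (conjCoord P i j) =
      (P⁻¹ * g * P : GL n K).1 i j := by
  rw [aeval_conjCoord]
  simp [Algebra.algebraMap_self]

theorem mem_vanishingIdeal_matrixSet {T : Subgroup (GL n K)} {f : MvPolynomial (n × n) K} :
    f ∈ MvPolynomial.vanishingIdeal K (points (matrixSet T)) ↔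
      ∀ g ∈ T, MvPolynomial.aeval (fun ij : n × n => g.1 ij.1 ij.2) f = 0 := by
  rw [MvPolynomial.mem_vanishingIdeal_iff]
  constructor
  · exact fun h g hg => h _ ⟨_, ⟨g, hg, rfl⟩, rfl⟩
  · rintro h _ ⟨_, ⟨g, hg, rfl⟩, rfl⟩
    exact h g hg

/-- The matrix with diagonal entries `t, t⁻¹, 1` in the basis `P`. -/
def torusPoint {L : Type*} [Field L] [Algebra K L] (ε : n ≃ (Fin q ⊕ Fin q) ⊕ Fin r) (P : GL n K)
    (t : Fin q → L) : Matrix n n L :=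
  P.1.map (algebraMap K L) * diagonal (fun i => torusWeight t (ε i)) *
    (P⁻¹).1.map (algebraMap K L)

variable (ε : n ≃ (Fin q ⊕ Fin q) ⊕ Fin r) (P : GL n K)

/-- Clearing denominators: restricted to the torus, `f` is a Laurent polynomial in t. The formula
holds over all extensions, so it serves at the `K`-points and at the generic point alike. -/
theorem exists_cleared (f : MvPolynomial (n × n) K) :
    ∃ (N : ℕ) (F : MvPolynomial (Fin q) K), ∀ (L : Type u) [Field L] [Algebra K L] (t : Fin q → L),
      (∀ i, t i ≠ 0) → MvPolynomial.aeval t F = (∏ i, t i) ^ N *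
        MvPolynomial.aeval (fun ij : n × n => torusPoint ε P t ij.1 ij.2) f := by
  induction f using MvPolynomial.induction_on with
  | C c => exact ⟨0, MvPolynomial.C c, fun L _ _ t _ => by simp⟩
  | add f g hf hg =>
    obtain ⟨N, F, hF⟩ := hf
    obtain ⟨N', F', hF'⟩ := hg
    refine ⟨N + N', (∏ i, MvPolynomial.X i) ^ N' * F + (∏ i, MvPolynomial.X i) ^ N * F',
      fun L _ _ t ht => ?_⟩
    simp only [map_add, map_mul, map_pow, map_prod, MvPolynomial.aeval_X, hF L t ht, hF' L t ht]
    ring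
  | mul_X f kl hf =>
    obtain ⟨N, F, hF⟩ := hf
    refine ⟨N + 1, F * ∑ i, MvPolynomial.C (P.1 kl.1 i * (P⁻¹).1 i kl.2) * clearedWeight K (ε i),
      fun L _ _ t ht => ?_⟩
    simp only [map_mul, map_sum, hF L t ht, MvPolynomial.aeval_X, aeval_clearedWeight ht,
      MvPolynomial.aeval_C]
    rw [torusPoint, Matrix.mul_apply, pow_succ]
    simp only [mul_diagonal, map_apply, Finset.mul_sum]
    refine Finset.sum_congr rfl fun i _ => by ring

theorem exists_mem_splitTorus {t : Fin q → K} (ht : ∀ i, t i ≠ 0) :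
    ∃ g ∈ splitTorus ε P, g.1 = torusPoint ε P t := by
  let D : GL n K := ⟨diagonal fun i => torusWeight t (ε i), diagonal fun i => torusWeight t⁻¹ (ε i),
    by
      have : t * t⁻¹ = 1 := by
        ext j
        exact mul_inv_cancel₀ (ht j)
      simp [diagonal_mul_diagonal, ← torusWeight_mul, this, torusWeight_one], by
      have : t⁻¹ * t = 1 := by
        ext j
        exact inv_mul_cancel₀ (ht j)
      simp [diagonal_mul_diagonal, ← torusWeight_mul, this, torusWeight_one]⟩
  refine ⟨P * D * P⁻¹, ⟨t, ht, ?_⟩, ?_⟩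
  · rw [show P⁻¹ * (P * D * P⁻¹) * P = D by group]
  · simp [torusPoint, Algebra.algebraMap_self, D]

theorem eq_torusPoint {g : GL n K} {t : Fin q → K}
    (h : (P⁻¹ * g * P : GL n K).1 = diagonal fun i => torusWeight t (ε i)) :
    g.1 = torusPoint ε P t := by
  have h1 : g = P * (P⁻¹ * g * P) * P⁻¹ := by group
  rw [h1, Units.val_mul, Units.val_mul, h, torusPoint]
  simp [Algebra.algebraMap_self]

/-- The field of rational functions on a split torus. -/
abbrev TorusField (K : Type u) [Field K] (q : ℕ) : Type u := FractionRing (MvPolynomial (Fin q) K)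

/-- The generic point of a split torus. -/
noncomputable def genericTorusPoint : MvPolynomial (n × n) K →ₐ[K] TorusField K q :=
  MvPolynomial.aeval fun ij : n × n => torusPoint ε P
    (fun i => algebraMap (MvPolynomial (Fin q) K) (TorusField K q) (MvPolynomial.X i)) ij.1 ij.2

theorem aeval_algebraMap_X (F : MvPolynomial (Fin q) K) :
    MvPolynomial.aeval (fun i => algebraMap (MvPolynomial (Fin q) K) (TorusField K q)
      (MvPolynomial.X i)) F = algebraMap (MvPolynomial (Fin q) K) (TorusField K q) F := by
  have := MvPolynomial.aeval_algebraMap_apply (TorusField K q)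
    (MvPolynomial.X : Fin q → MvPolynomial (Fin q) K) F
  rw [MvPolynomial.aeval_X_left_apply] at this
  exact this

theorem mem_vanishingIdeal_splitTorus [Infinite K] (f : MvPolynomial (n × n) K) :
    f ∈ MvPolynomial.vanishingIdeal K (points (matrixSet (splitTorus ε P))) ↔
      genericTorusPoint ε P f = 0 := by
  obtain ⟨N, F, hF⟩ := exists_cleared ε P f
  have hX : ∀ i : Fin q, algebraMap (MvPolynomial (Fin q) K) (TorusField K q)
      (MvPolynomial.X i) ≠ 0 := fun i => by
    rw [ne_eq, IsFractionRing.to_map_eq_zero_iff]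
    exact MvPolynomial.X_ne_zero i
  have hgen := hF (TorusField K q) _ hX
  rw [aeval_algebraMap_X] at hgen
  have hF0 : genericTorusPoint ε P f = 0 ↔ F = 0 := by
    have h0 := IsFractionRing.to_map_eq_zero_iff (R := MvPolynomial (Fin q) K)
      (K := TorusField K q) (x := F)
    rw [← h0, hgen, mul_eq_zero,
      or_iff_right (pow_ne_zero _ (Finset.prod_ne_zero_iff.2 fun i _ => hX i))]
    rfl
  rw [hF0, mem_vanishingIdeal_matrixSet]
  constructor
  · intro h
    -- The product vanishes at every point: through `F` where all coordinates are nonzero, through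
    -- the monomial elsewhere. As `K` is infinite, it is zero.
    have h1 : F * ∏ i, MvPolynomial.X i = 0 := by
      refine MvPolynomial.funext fun t => ?_
      rw [map_mul, map_prod, map_zero]
      simp only [MvPolynomial.eval_X]
      by_cases ht : ∀ i, t i ≠ 0
      · obtain ⟨g, hg, hgt⟩ := exists_mem_splitTorus ε P ht
        have h2 := hF K t ht
        rw [← hgt, h g hg, mul_zero, MvPolynomial.aeval_eq_eval] at h2
        exact mul_eq_zero_of_left h2 _
      · push Not at ht
        obtain ⟨i, hi⟩ := ht
        rw [Finset.prod_eq_zero (Finset.mem_univ i) hi, mul_zero]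
    exact (mul_eq_zero.1 h1).resolve_right
      (Finset.prod_ne_zero_iff.2 fun i _ => MvPolynomial.X_ne_zero i)
  · rintro rfl g ⟨t, ht, hg⟩
    have h2 := hF K t ht
    rw [map_zero] at h2
    rw [eq_torusPoint ε P hg]
    exact (mul_eq_zero.1 h2.symm).resolve_left
      (pow_ne_zero _ (Finset.prod_ne_zero_iff.2 fun i _ => ht i))

theorem vanishingIdeal_splitTorus [Infinite K] :
    MvPolynomial.vanishingIdeal K (points (matrixSet (splitTorus ε P))) =
      RingHom.ker (genericTorusPoint ε P) := by
  ext f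
  rw [mem_vanishingIdeal_splitTorus]
  rfl

/-- In the basis `P` the torus is cut out by equations: off-diagonal entries are 0, partner entries
have product 1, entries at the remaining vectors are 1. Its ideal is prime as the kernel of a map to
a field. -/
theorem isTorus_splitTorus [Infinite K] : IsTorus (splitTorus ε P) := by
  refine ⟨fun g hg => ?_, ?_, P⁻¹, ?_⟩
  · rw [MvPolynomial.mem_zeroLocus_iff] at hg
    have hzero : ∀ f : MvPolynomial (n × n) K, (∀ g' ∈ splitTorus ε P,
        MvPolynomial.aeval (fun ij : n × n => g'.1 ij.1 ij.2) f = 0) →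
        MvPolynomial.aeval (fun ij : n × n => g.1 ij.1 ij.2) f = 0 :=
      fun f hf => hg f (mem_vanishingIdeal_matrixSet.2 hf)
    set h : Matrix n n K := (P⁻¹ * g * P : GL n K).1 with hh
    have hoff : ∀ i j, i ≠ j → h i j = 0 := by
      intro i j hij
      rw [hh, ← aeval_conjCoord_self]
      refine hzero _ ?_
      rintro g' ⟨t, -, hg'⟩
      rw [aeval_conjCoord_self, hg', diagonal_apply_ne _ hij]
    have hmul : ∀ s, h (ε.symm s) (ε.symm s) *
        h (ε.symm (Sum.map Sum.swap id s)) (ε.symm (Sum.map Sum.swap id s)) = 1 := by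
      intro s
      rw [hh, ← aeval_conjCoord_self, ← aeval_conjCoord_self, ← map_mul, ← sub_eq_zero,
        ← map_one (MvPolynomial.aeval (R := K) fun ij : n × n => g.1 ij.1 ij.2), ← map_sub]
      refine hzero _ ?_
      rintro g' ⟨t, ht, hg'⟩
      rw [map_sub, map_mul, map_one, aeval_conjCoord_self, aeval_conjCoord_self, hg',
        diagonal_apply_eq, diagonal_apply_eq, Equiv.apply_symm_apply, Equiv.apply_symm_apply,
        torusWeight_mul_swap ht, sub_self]
    have hone : ∀ j, h (ε.symm (Sum.inr j)) (ε.symm (Sum.inr j)) = 1 := by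
      intro j
      rw [hh, ← aeval_conjCoord_self, ← sub_eq_zero,
        ← map_one (MvPolynomial.aeval (R := K) fun ij : n × n => g.1 ij.1 ij.2), ← map_sub]
      refine hzero _ ?_
      rintro g' ⟨t, ht, hg'⟩
      rw [map_sub, map_one, aeval_conjCoord_self, hg', diagonal_apply_eq, Equiv.apply_symm_apply,
        torusWeight, Sum.elim_inr, Pi.one_apply, sub_self]
    refine ⟨fun i => h (ε.symm (Sum.inl (Sum.inl i))) (ε.symm (Sum.inl (Sum.inl i))), fun i => ?_,
      ?_⟩
    · exact left_ne_zero_of_mul_eq_one (hmul (Sum.inl (Sum.inl i)))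
    · ext i j
      obtain ⟨s, rfl⟩ := ε.symm.surjective i
      by_cases hij : ε.symm s = j
      · subst hij
        rw [diagonal_apply_eq, Equiv.apply_symm_apply]
        rcases s with (a | a) | a
        · rfl
        · exact (inv_eq_of_mul_eq_one_left (hmul (Sum.inl (Sum.inr a)))).symm
        · exact hone a
      · rw [diagonal_apply_ne _ hij]
        exact hoff _ _ hij
  · rw [vanishingIdeal_splitTorus]
    exact RingHom.ker_isPrime _
  · rintro g ⟨t, -, hg⟩
    rw [inv_inv, hg]
    exact isDiag_diagonal _

theorem trdeg_torusField : Algebra.trdeg K (TorusField K q) = q := by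
  have h1 := trdeg_add_eq K (MvPolynomial (Fin q) K) (A := TorusField K q)
  have : Algebra.IsAlgebraic (MvPolynomial (Fin q) K) (TorusField K q) :=
    IsLocalization.isAlgebraic _ (nonZeroDivisors (MvPolynomial (Fin q) K))
  rw [trdeg_eq_zero (R := MvPolynomial (Fin q) K), add_zero, MvPolynomial.trdeg_of_isDomain] at h1
  rw [← h1]
  simp

/-- The coordinate ring embeds into a field of transcendence degree q, and the q diagonal entries t
are independent in it. -/
theorem zariskiDim_splitTorus [Infinite K] :
    zariskiDim (matrixSet (splitTorus ε P)) = (q : WithBot ℕ∞) := by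
  have hprime : (MvPolynomial.vanishingIdeal K (points (matrixSet (splitTorus ε P)))).IsPrime :=
    (isTorus_splitTorus ε P).2.1
  rw [zariskiDim]
  refine le_antisymm ?_ ?_
  · obtain ⟨d, x, hd, hx, -⟩ := exists_algebraicIndependent_ringKrullDim_eq K
      (MvPolynomial (n × n) K ⧸ MvPolynomial.vanishingIdeal K (points (matrixSet (splitTorus ε P))))
    let φ := Ideal.Quotient.liftₐ
      (MvPolynomial.vanishingIdeal K (points (matrixSet (splitTorus ε P)))) (genericTorusPoint ε P)
      fun a ha => (mem_vanishingIdeal_splitTorus ε P a).1 ha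
    have hφ : Function.Injective φ := by
      rw [injective_iff_map_eq_zero]
      intro a ha
      obtain ⟨a, rfl⟩ := Ideal.Quotient.mk_surjective a
      exact Ideal.Quotient.eq_zero_iff_mem.2 ((mem_vanishingIdeal_splitTorus ε P a).2 ha)
    have h1 := (hx.map' hφ).lift_cardinalMk_le_trdeg
    rw [trdeg_torusField] at h1
    simp only [Cardinal.mk_fin, Cardinal.lift_natCast] at h1
    rw [hd]
    exact_mod_cast h1
  · refine natCast_le_ringKrullDim_of_algebraicIndependent (k := K)
      (algebraicIndependent_comp_of_ker (Ideal.Quotient.mkₐ K _) (x := fun i : Fin q =>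
        conjCoord P (ε.symm (Sum.inl (Sum.inl i))) (ε.symm (Sum.inl (Sum.inl i)))) fun F hF => ?_)
    have h1 := (mem_vanishingIdeal_splitTorus ε P _).1 (Ideal.Quotient.eq_zero_iff_mem.1 hF)
    rw [MvPolynomial.comp_aeval_apply] at h1
    have h2 : ∀ i : Fin q, genericTorusPoint ε P
        (conjCoord P (ε.symm (Sum.inl (Sum.inl i))) (ε.symm (Sum.inl (Sum.inl i)))) =
        algebraMap (MvPolynomial (Fin q) K) (TorusField K q) (MvPolynomial.X i) := by
      intro i
      have hPP : (P⁻¹).1.map (algebraMap K (TorusField K q)) *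
          P.1.map (algebraMap K (TorusField K q)) = 1 := by
        rw [← Matrix.map_mul, ← Units.val_mul, inv_mul_cancel]
        simp
      rw [genericTorusPoint, aeval_conjCoord, torusPoint, Matrix.mul_assoc, Matrix.mul_assoc, hPP,
        Matrix.mul_one, ← Matrix.mul_assoc, hPP, Matrix.one_mul, diagonal_apply_eq,
        Equiv.apply_symm_apply]
      rfl
    simp only [h2, aeval_algebraMap_X] at h1
    exact (IsFractionRing.to_map_eq_zero_iff).1 h1

end SplitTorus

/-! ### Maximal tori of the orthogonal group. -/

section MaximalTorus

variable {K : Type u} [Field K] {n : Type} [Fintype n] [DecidableEq n] {q r : ℕ}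

theorem OrthSymm.IsTorus.mul_comm {T : Subgroup (GL n K)} (hT : IsTorus T) {a b : GL n K} (ha : a ∈ T)
    (hb : b ∈ T) : a * b = b * a := by
  obtain ⟨-, -, h, hh⟩ := hT
  have h1 : (h * a * h⁻¹) * (h * b * h⁻¹) = (h * b * h⁻¹) * (h * a * h⁻¹) := by
    refine Units.ext ?_
    rw [Units.val_mul (h * a * h⁻¹), Units.val_mul (h * b * h⁻¹), ← (hh a ha).diagonal_diag, ← (hh b hb).diagonal_diag,
      diagonal_mul_diagonal, diagonal_mul_diagonal]
    simp only [_root_.mul_comm]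
  have h2 : h * (a * b) * h⁻¹ = h * (b * a) * h⁻¹ := by
    calc h * (a * b) * h⁻¹ = (h * a * h⁻¹) * (h * b * h⁻¹) := by group
      _ = _ := h1
      _ = h * (b * a) * h⁻¹ := by group
  exact mul_left_cancel (mul_right_cancel h2)

/-- Connectedness: (f - 1)(f + 1) lies in the prime ideal of `T`, and f + 1 does not vanish at the
identity. -/
theorem OrthSymm.IsTorus.aeval_eq_one [CharZero K] {T : Subgroup (GL n K)} (hT : IsTorus T)
    {f : MvPolynomial (n × n) K}
    (hf : ∀ g ∈ T, MvPolynomial.aeval (fun ij : n × n => g.1 ij.1 ij.2) f *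
      MvPolynomial.aeval (fun ij : n × n => g.1 ij.1 ij.2) f = 1)
    (h1 : MvPolynomial.aeval (fun ij : n × n => (1 : GL n K).1 ij.1 ij.2) f = 1) :
    ∀ g ∈ T, MvPolynomial.aeval (fun ij : n × n => g.1 ij.1 ij.2) f = 1 := by
  have hmem : (f - 1) * (f + 1) ∈ MvPolynomial.vanishingIdeal K (points (matrixSet T)) := by
    rw [mem_vanishingIdeal_matrixSet]
    intro g hg
    rw [map_mul, map_sub, map_add, map_one]
    linear_combination hf g hg
  rcases hT.2.1.mem_or_mem hmem with h | h
  · intro g hg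
    have := mem_vanishingIdeal_matrixSet.1 h g hg
    rwa [map_sub, map_one, sub_eq_zero] at this
  · exfalso
    have := mem_vanishingIdeal_matrixSet.1 h 1 T.one_mem
    rw [map_add, map_one, h1] at this
    norm_num at this

theorem OrthSymm.IsTorus.span_eigenvectors {T : Subgroup (GL n K)} (hT : IsTorus T) :
    Submodule.span K {v : n → K | ∀ g : T, ∃ c : K, toLin' g.1.1 v = c • v} = ⊤ := by
  obtain ⟨-, -, h, hh⟩ := hT
  rw [eq_top_iff]
  rintro v -
  have hv : v = ∑ i, (h.1 *ᵥ v) i • ((h⁻¹).1 *ᵥ Pi.single i 1) := by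
    have h1 : v = (h⁻¹).1 *ᵥ (h.1 *ᵥ v) := by
      rw [mulVec_mulVec, ← Units.val_mul, inv_mul_cancel, Units.val_one, one_mulVec]
    conv_lhs => rw [h1, pi_eq_sum_univ' (h.1 *ᵥ v), mulVec_sum]
    refine Finset.sum_congr rfl fun i _ => ?_
    rw [mulVec_smul]
  rw [hv]
  refine Submodule.sum_mem _ fun i _ => Submodule.smul_mem _ _ (Submodule.subset_span ?_)
  intro g
  refine ⟨(h * g.1 * h⁻¹).1 i i, ?_⟩
  have h1 : g.1 * h⁻¹ = h⁻¹ * (h * g.1 * h⁻¹) := by group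
  rw [toLin'_apply, mulVec_mulVec, ← Units.val_mul, h1, Units.val_mul, ← mulVec_mulVec,
    ← mulVec_smul]
  congr 1
  have h2 := hh g.1 g.2
  rw [← h2.diagonal_diag]
  ext j
  by_cases hij : j = i
  · subst hij
    simp [mulVec_diagonal]
  · simp [mulVec_diagonal, hij]

/-- Invariance of the form gives c² = 1 for the eigenvalue c on `v`, and connectedness then gives c
= 1. -/
theorem OrthSymm.IsTorus.fixed_of_bilin_ne_zero [CharZero K] {T : Subgroup (GL n K)} (hT : IsTorus T)
    {B : LinearMap.BilinForm K (n → K)}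
    (hB : ∀ (g : T) x y, B (toLin' g.1.1 x) (toLin' g.1.1 y) = B x y) {v : n → K}
    (hv : ∀ g : T, ∃ c : K, toLin' g.1.1 v = c • v) (hvv : B v v ≠ 0) (g : T) :
    toLin' g.1.1 v = v := by
  choose c hc using hv
  have hv0 : v ≠ 0 := by
    rintro rfl
    exact hvv (map_zero _)
  obtain ⟨i, hi⟩ := Function.ne_iff.1 hv0
  rw [Pi.zero_apply] at hi
  -- The eigenvalue is a polynomial function of g, namely the quotient of the i-th coordinates of g
  -- v and v.
  let f : MvPolynomial (n × n) K := ∑ j, MvPolynomial.X (i, j) * MvPolynomial.C (v j / v i)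
  have hf : ∀ g : GL n K, MvPolynomial.aeval (fun ij : n × n => g.1 ij.1 ij.2) f * v i =
      (g.1 *ᵥ v) i := by
    intro g
    simp only [f, map_sum, map_mul, MvPolynomial.aeval_X, MvPolynomial.aeval_C, Finset.sum_mul,
      Algebra.algebraMap_self, RingHom.id_apply]
    refine Finset.sum_congr rfl fun j _ => ?_
    rw [mul_assoc, div_mul_cancel₀ _ hi]
  have hfc : ∀ g : T, MvPolynomial.aeval (fun ij : n × n => g.1.1 ij.1 ij.2) f = c g := by
    intro g
    refine mul_right_cancel₀ hi ?_
    rw [hf, ← toLin'_apply, hc]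
    rfl
  have hcc : ∀ g : T, c g * c g = 1 := by
    intro g
    have := hB g v v
    rw [hc, map_smul, map_smul, LinearMap.smul_apply, smul_eq_mul, smul_eq_mul, ← mul_assoc] at this
    exact mul_right_cancel₀ hvv (this.trans (one_mul _).symm)
  have h1 := hT.aeval_eq_one (f := f) (fun g hg => by rw [hfc ⟨g, hg⟩]; exact hcc ⟨g, hg⟩)
    (mul_right_cancel₀ hi (by rw [hf, Units.val_one, one_mulVec, one_mul])) g.1 g.2
  rw [hfc] at h1
  rw [hc, h1, one_smul]

/-- The Gram matrix of a hyperbolic basis. -/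
def hypGram (K : Type u) [Field K] (ε : n ≃ (Fin q ⊕ Fin q) ⊕ Fin r) : Matrix n n K :=
  of fun i j => if ε j = Sum.map Sum.swap id (ε i) then 1 else 0

theorem diagonal_mul_hypGram_mul {ε : n ≃ (Fin q ⊕ Fin q) ⊕ Fin r} {c : n → K} :
    diagonal c * hypGram K ε * diagonal c = hypGram K ε ↔
      ∀ s, c (ε.symm s) * c (ε.symm (Sum.map Sum.swap id s)) = 1 := by
  constructor
  · intro h s
    have := congrFun (congrFun h (ε.symm s)) (ε.symm (Sum.map Sum.swap id s))
    simpa [hypGram, mul_diagonal, diagonal_mul] using this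
  · intro h
    ext i j
    rw [mul_diagonal, diagonal_mul, hypGram, of_apply]
    split_ifs with hij
    · have := h (ε i)
      rw [← hij, Equiv.symm_apply_apply, Equiv.symm_apply_apply] at this
      rw [mul_one, this]
    · rw [mul_zero, zero_mul]

variable {J : Matrix n n K} {ε : n ≃ (Fin q ⊕ Fin q) ⊕ Fin r} {P : GL n K}

theorem mem_orthGroup_iff_of_diagonal (hJ : J = P.1 * hypGram K ε * P.1ᵀ) {g : GL n K} {c : n → K}
    (hg : (P⁻¹ * g * P : GL n K).1 = diagonal c) :
    g ∈ orthGroup J ↔ ∀ s, c (ε.symm s) * c (ε.symm (Sum.map Sum.swap id s)) = 1 := by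
  rw [← diagonal_mul_hypGram_mul]
  change g.1 * J * g.1ᵀ = J ↔ _
  have h1 : g.1 * P.1 = P.1 * diagonal c := by
    rw [← hg, ← Units.val_mul, ← Units.val_mul]
    congr 1
    group
  have h2 : P.1ᵀ * g.1ᵀ = diagonal c * P.1ᵀ := by
    rw [← transpose_mul, h1, transpose_mul, diagonal_transpose]
  have h3 : g.1 * J * g.1ᵀ = P.1 * (diagonal c * hypGram K ε * diagonal c) * P.1ᵀ := by
    calc g.1 * J * g.1ᵀ = (g.1 * P.1) * hypGram K ε * (P.1ᵀ * g.1ᵀ) := by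
          rw [hJ]; simp only [Matrix.mul_assoc]
      _ = _ := by rw [h1, h2]; simp only [Matrix.mul_assoc]
  rw [h3, hJ]
  have hP : IsUnit P.1 := P.isUnit
  have hPt : IsUnit P.1ᵀ := (isUnit_transpose P.1).2 hP
  exact ⟨fun h => hP.mul_left_cancel (hPt.mul_right_cancel h), fun h => by rw [h]⟩

theorem splitTorus_le_orthGroup (hJ : J = P.1 * hypGram K ε * P.1ᵀ) :
    splitTorus ε P ≤ orthGroup J := by
  rintro g ⟨t, ht, hg⟩
  rw [mem_orthGroup_iff_of_diagonal hJ hg]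
  intro s
  rw [Equiv.apply_symm_apply, Equiv.apply_symm_apply, torusWeight_mul_swap ht]

theorem mem_splitTorus_of_diagonal (hJ : J = P.1 * hypGram K ε * P.1ᵀ) {g : GL n K}
    (hgJ : g ∈ orthGroup J) {c : n → K} (hg : (P⁻¹ * g * P : GL n K).1 = diagonal c)
    (hc : ∀ j, c (ε.symm (Sum.inr j)) = 1) : g ∈ splitTorus ε P := by
  have h1 := (mem_orthGroup_iff_of_diagonal hJ hg).1 hgJ
  refine ⟨fun i => c (ε.symm (Sum.inl (Sum.inl i))),
    fun i => left_ne_zero_of_mul_eq_one (h1 (Sum.inl (Sum.inl i))), ?_⟩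
  rw [hg]
  congr 1
  ext i
  obtain ⟨s, rfl⟩ := ε.symm.surjective i
  rw [Equiv.apply_symm_apply]
  rcases s with (a | a) | a
  · rfl
  · exact (inv_eq_of_mul_eq_one_left (h1 (Sum.inl (Sum.inr a)))).symm
  · exact hc a

/-- `T` is commutative and contains the element with t_i = 2^(i+1), whose entries are distinct, so
`T` is diagonal in the basis `P`. An entry at a self-paired vector squares to 1, hence equals 1 by
connectedness. -/
theorem OrthSymm.IsTorus.le_splitTorus [CharZero K] (hr : r ≤ 1) (hJ : J = P.1 * hypGram K ε * P.1ᵀ)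
    {T : Subgroup (GL n K)} (hT : IsTorus T) (hTJ : T ≤ orthGroup J) (hle : splitTorus ε P ≤ T) :
    T ≤ splitTorus ε P := by
  obtain ⟨g₀, hg₀, hg₀'⟩ := exists_mem_splitTorus ε P
    (t := fun i : Fin q => (2 : K) ^ ((i : ℕ) + 1)) fun i => pow_ne_zero _ two_ne_zero
  have hd₀ : (P⁻¹ * g₀ * P : GL n K).1 =
      diagonal fun i => torusWeight (fun i : Fin q => (2 : K) ^ ((i : ℕ) + 1)) (ε i) := by
    have h1 : (P⁻¹).1 * P.1 = 1 := by rw [← Units.val_mul, inv_mul_cancel, Units.val_one]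
    rw [Units.val_mul, Units.val_mul, hg₀', torusPoint, Algebra.algebraMap_self]
    simp only [RingHom.coe_id, Matrix.map_id, Matrix.mul_assoc, h1, Matrix.mul_one]
    rw [← Matrix.mul_assoc, h1, Matrix.one_mul]
  have hdiag : ∀ g ∈ T, (P⁻¹ * g * P : GL n K).1 =
      diagonal fun i => (P⁻¹ * g * P : GL n K).1 i i := by
    intro g hg
    have hcomm : (P⁻¹ * g * P) * (P⁻¹ * g₀ * P) = (P⁻¹ * g₀ * P) * (P⁻¹ * g * P) := by
      calc (P⁻¹ * g * P) * (P⁻¹ * g₀ * P) = P⁻¹ * (g * g₀) * P := by group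
        _ = P⁻¹ * (g₀ * g) * P := by rw [hT.mul_comm hg (hle hg₀)]
        _ = _ := by group
    have h1 := congrArg Units.val hcomm
    rw [Units.val_mul (P⁻¹ * g * P), Units.val_mul (P⁻¹ * g₀ * P), hd₀] at h1
    ext i j
    by_cases hij : i = j
    · subst hij
      rw [diagonal_apply_eq]
    · rw [diagonal_apply_ne _ hij]
      have h2 := congrFun (congrFun h1 i) j
      rw [mul_diagonal, diagonal_mul, _root_.mul_comm, ← sub_eq_zero, ← sub_mul] at h2
      refine (mul_eq_zero.1 h2).resolve_left (sub_ne_zero.2 fun h3 => hij ?_)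
      exact (ε.injective (torusWeight_injective hr h3)).symm
  intro g hg
  refine mem_splitTorus_of_diagonal hJ (hTJ hg) (hdiag g hg) fun j => ?_
  have h1 := hT.aeval_eq_one (f := conjCoord P (ε.symm (Sum.inr j)) (ε.symm (Sum.inr j)))
    (fun g hg => by
      rw [aeval_conjCoord_self]
      exact (mem_orthGroup_iff_of_diagonal hJ (hdiag g hg)).1 (hTJ hg) (Sum.inr j))
    (by rw [aeval_conjCoord_self, mul_one, inv_mul_cancel, Units.val_one, one_apply_eq]) g hg
  rwa [aeval_conjCoord_self] at h1

theorem maximal_splitTorus [CharZero K] (hr : r ≤ 1) (hJ : J = P.1 * hypGram K ε * P.1ᵀ) :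
    Maximal (fun T : Subgroup (GL n K) => T ≤ orthGroup J ∧ IsTorus T) (splitTorus ε P) :=
  ⟨⟨splitTorus_le_orthGroup hJ, isTorus_splitTorus ε P⟩,
    fun _ hT hle => hT.2.le_splitTorus hr hJ hT.1 hle⟩

theorem transpose_mul_mul_of_mem_orthGroup (hJJ : J * J = 1) {g : GL n K} (hg : g ∈ orthGroup J) :
    g.1ᵀ * J * g.1 = J := by
  have h1 : g.1 * J * g.1ᵀ = J := hg
  have h2 : g.1 * (J * g.1ᵀ * J) = 1 := by
    rw [← Matrix.mul_assoc, ← Matrix.mul_assoc, h1, hJJ]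
  have h3 := mul_eq_one_comm.1 h2
  calc g.1ᵀ * J * g.1 = J * (J * g.1ᵀ * J * g.1) := by
        simp only [← Matrix.mul_assoc, hJJ, Matrix.one_mul]
    _ = J := by rw [h3, Matrix.mul_one]

theorem isTorus_bot : IsTorus (⊥ : Subgroup (GL n K)) := by
  have hmem : ∀ f : MvPolynomial (n × n) K,
      f ∈ MvPolynomial.vanishingIdeal K (points (matrixSet (⊥ : Subgroup (GL n K)))) ↔
        MvPolynomial.aeval (fun ij : n × n => (1 : GL n K).1 ij.1 ij.2) f = 0 := by
    intro f
    rw [mem_vanishingIdeal_matrixSet]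
    refine ⟨fun h => h 1 (Subgroup.mem_bot.2 rfl), fun h g hg => ?_⟩
    rw [Subgroup.mem_bot.1 hg]
    exact h
  refine ⟨fun g hg => ?_, ?_, 1, fun g hg => ?_⟩
  · rw [MvPolynomial.mem_zeroLocus_iff] at hg
    refine Subgroup.mem_bot.2 (Units.ext (Matrix.ext fun i j => ?_))
    have := hg (MvPolynomial.X (i, j) - MvPolynomial.C ((1 : GL n K).1 i j)) ((hmem _).2 (by simp))
    rw [map_sub, MvPolynomial.aeval_X, MvPolynomial.aeval_C, sub_eq_zero] at this
    exact this
  · have h : MvPolynomial.vanishingIdeal K (points (matrixSet (⊥ : Subgroup (GL n K)))) =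
        RingHom.ker (MvPolynomial.aeval (R := K) fun ij : n × n => (1 : GL n K).1 ij.1 ij.2) :=
      Ideal.ext hmem
    rw [h]
    exact RingHom.ker_isPrime _
  · rw [Subgroup.mem_bot.1 hg, mul_one, one_mul, inv_one, Units.val_one]
    exact isDiag_one

variable [IsAlgClosed K] [CharZero K]

/-- The columns of `P` are a hyperbolic basis of joint eigenvectors of `T`; the hypothesis `hfix` of
its construction is supplied by connectedness. -/
theorem exists_le_splitTorus (hJt : Jᵀ = J) (hJJ : J * J = 1) (hr : r ≤ 1)
    (ε : n ≃ (Fin q ⊕ Fin q) ⊕ Fin r) {T : Subgroup (GL n K)} (hT : IsTorus T)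
    (hTJ : T ≤ orthGroup J) :
    ∃ P : GL n K, J = P.1 * hypGram K ε * P.1ᵀ ∧ T ≤ splitTorus ε P := by
  have hBapp : ∀ x y, toBilin' J x y = x ⬝ᵥ (J *ᵥ y) := fun x y => toBilin'_apply' _ _ _
  have hB : ∀ x y, toBilin' J x y = toBilin' J y x := fun x y => by
    rw [hBapp, hBapp, dotProduct_mulVec, dotProduct_comm, ← mulVec_transpose, hJt]
  have hnd : ∀ x, (∀ y, toBilin' J x y = 0) → x = 0 := by
    intro x h
    ext i
    have := h (J *ᵥ Pi.single i 1)
    rw [hBapp, mulVec_mulVec, hJJ, one_mulVec, dotProduct_single_one] at this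
    exact this
  have hinv : ∀ (g : T) x y, toBilin' J (toLin' g.1.1 x) (toLin' g.1.1 y) = toBilin' J x y := by
    intro g x y
    rw [hBapp, hBapp, toLin'_apply, toLin'_apply, mulVec_mulVec, ← vecMul_transpose,
      ← dotProduct_mulVec, mulVec_mulVec, ← Matrix.mul_assoc,
      transpose_mul_mul_of_mem_orthGroup hJJ (hTJ g.2)]
  have hcard : Module.finrank K (n → K) = 2 * q + r := by
    rw [Module.finrank_fintype_fun_eq_card, Fintype.card_congr ε]
    simp [two_mul]
  obtain ⟨e, he, hfe, hfix⟩ := exists_hyperbolic_basis hB hnd hinv hT.span_eigenvectors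
    (fun v hv hvv g => hT.fixed_of_bilin_ne_zero hinv hv hvv g) hr hcard
  obtain ⟨Pm, hPm⟩ : ∃ Pm : Matrix n n K, ∀ i j, Pm i j = e (ε j) i :=
    ⟨of fun i j => e (ε j) i, fun _ _ => rfl⟩
  have hgram : Pmᵀ * J * Pm = hypGram K ε := by
    ext i j
    rw [hypGram, of_apply, ← he, hBapp, Matrix.mul_assoc, Matrix.mul_apply]
    refine Finset.sum_congr rfl fun l _ => ?_
    rw [transpose_apply, hPm, Matrix.mul_apply]
    congr 1
    exact Finset.sum_congr rfl fun m _ => by rw [hPm]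
  have hMM : hypGram K ε * hypGram K ε = 1 := by
    ext i j
    rw [Matrix.mul_apply]
    simp only [hypGram, of_apply]
    rw [Finset.sum_eq_single (ε.symm (Sum.map Sum.swap id (ε i)))]
    · simp [Matrix.one_apply, eq_comm]
    · intro b _ hb
      rw [if_neg, zero_mul]
      intro h
      exact hb (by rw [← h, Equiv.symm_apply_apply])
    · exact fun h => absurd (Finset.mem_univ _) h
  have hleft : (hypGram K ε * Pmᵀ * J) * Pm = 1 := by
    rw [Matrix.mul_assoc, Matrix.mul_assoc, ← Matrix.mul_assoc Pmᵀ, hgram, hMM]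
  have hright : Pm * (hypGram K ε * Pmᵀ * J) = 1 := mul_eq_one_comm.1 hleft
  let P : GL n K := ⟨Pm, hypGram K ε * Pmᵀ * J, hright, hleft⟩
  -- Both `J` and the Gram matrix are involutions, so PᵗJP = `hypGram` can be inverted into this
  -- form.
  have hJP : J = P.1 * hypGram K ε * P.1ᵀ := by
    change J = Pm * hypGram K ε * Pmᵀ
    have h1 : (Pm * hypGram K ε * Pmᵀ) * J = 1 := by
      rw [← hright]
      simp only [Matrix.mul_assoc]
    calc J = ((Pm * hypGram K ε * Pmᵀ) * J) * J := by rw [h1, Matrix.one_mul]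
      _ = _ := by rw [Matrix.mul_assoc, hJJ, Matrix.mul_one]
  refine ⟨P, hJP, fun g hg => ?_⟩
  choose c hc using fun s => hfe s ⟨g, hg⟩
  have hgP : g.1 * Pm = Pm * diagonal fun i => c (ε i) := by
    ext i j
    have := congrFun (hc (ε j)) i
    rw [toLin'_apply, Pi.smul_apply, smul_eq_mul, _root_.mul_comm] at this
    rw [mul_diagonal, hPm, ← this, Matrix.mul_apply]
    exact Finset.sum_congr rfl fun l _ => by rw [hPm]
  refine mem_splitTorus_of_diagonal hJP (hTJ hg) (c := fun i => c (ε i)) ?_ fun j => ?_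
  · rw [Units.val_mul, Units.val_mul, Matrix.mul_assoc]
    change (P⁻¹).1 * (g.1 * Pm) = _
    rw [hgP, ← Matrix.mul_assoc]
    change hypGram K ε * Pmᵀ * J * Pm * _ = _
    rw [hleft, Matrix.one_mul]
  · rw [Equiv.apply_symm_apply]
    have h1 := hfix j ⟨g, hg⟩
    rw [hc] at h1
    have h2 : e (Sum.inr j) ≠ 0 := by
      intro h0
      have h3 := he (Sum.inr j) (Sum.inr j)
      rw [h0, map_zero] at h3
      exact zero_ne_one (h3.trans (if_pos rfl))
    exact smul_left_injective K h2 (h1.trans (one_smul K _).symm)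

/-- Starting from the trivial torus gives a maximal torus; any maximal torus lies in a split one,
hence equals it. -/
theorem groupRankEq_orthGroup (hJt : Jᵀ = J) (hJJ : J * J = 1) (hr : r ≤ 1)
    (ε : n ≃ (Fin q ⊕ Fin q) ⊕ Fin r) : GroupRankEq (orthGroup J) q := by
  constructor
  · obtain ⟨P, hJ, -⟩ := exists_le_splitTorus hJt hJJ hr ε isTorus_bot bot_le
    exact ⟨_, maximal_splitTorus hr hJ⟩
  · intro T hT
    obtain ⟨P, hJ, hle⟩ := exists_le_splitTorus hJt hJJ hr ε hT.1.2 hT.1.1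
    rw [le_antisymm hle (hT.2 (maximal_splitTorus hr hJ).1 hle), zariskiDim_splitTorus]

end MaximalTorus

/-! ### The rank of O(J_{p,q}) and the main theorem. -/

section Jpq

variable {K : Type*} [Field K]

theorem Jpq_transpose (p q : ℕ) : (Jpq K p q)ᵀ = Jpq K p q := by
  rw [Jpq, fromBlocks_transpose, transpose_neg, antiDiag_transpose, antiDiag_transpose,
    transpose_zero, transpose_zero]

/-- Here r = p - q, so r = 1 and r = 0 are the two cases of the theorem; the equivalence only
regroups the q + r and q indices into two q's and r. -/
theorem groupRankEq_Jpq [IsAlgClosed K] [CharZero K] (q r : ℕ) (hr : r ≤ 1) :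
    GroupRankEq (orthGroup (Jpq K (q + r) q)) q :=
  groupRankEq_orthGroup (Jpq_transpose _ _) (Jpq_mul_self _ _) hr
    (((Equiv.sumComm _ _).trans ((Equiv.refl _).sumCongr finSumFinEquiv.symm)).trans
      (Equiv.sumAssoc _ _ _).symm)

end Jpq

theorem mainTheorem7 {F : Type*} [Field F] [CharZero F]
    (K : Type*) [Field K] [Algebra F K] [IsAlgClosure F K] (q : ℕ) (hq : 0 < q) :
    -- the case `p = q + 1`
    (eOdd F q ∈ gMinus F (q + 1) q ∧
      IsNilpotent (eOdd F q) ∧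
      Module.finrank F (gMinusCentralizer (q + 1) q (eOdd F q)) = q ∧
      RankThetaEq F (q + 1) q q ∧
      GroupRankEq (orthGroup (Jpq K (q + 1) q)) q ∧
      IsRelativelyRegular (q + 1) q ((eOdd F q).map (algebraMap F K))) ∧
    -- the case `p = q`
    (eEven F q ∈ gMinus F q q ∧
      IsNilpotent (eEven F q) ∧
      Module.finrank F (gMinusCentralizer q q (eEven F q)) = q ∧
      RankThetaEq F q q q ∧
      GroupRankEq (orthGroup (Jpq K q q)) q ∧
      IsRelativelyRegular q q ((eEven F q).map (algebraMap F K))) := by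
  have : IsAlgClosed K := IsAlgClosure.isAlgClosed F
  have : CharZero K := charZero_of_injective_algebraMap (algebraMap F K).injective
  refine ⟨⟨?_, ?_, ?_, rankThetaEq K hq (Nat.le_succ q), groupRankEq_Jpq q 1 le_rfl, ?_⟩,
    ⟨?_, ?_, ?_, rankThetaEq K hq le_rfl, groupRankEq_Jpq q 0 (Nat.zero_le 1), ?_⟩⟩
  · rw [eOdd_eq]
    exact offDiag_mem_gMinus _
  · rw [eOdd_eq]
    exact isNilpotent_offDiag (isStaircase_oddBlock q).lower
  · rw [eOdd_eq]
    exact (isStaircase_oddBlock q).finrank_gMinusCentralizer hq (Or.inl rfl)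
  · rw [eOdd_eq, offDiag_map, oddBlock_map]
    refine isRelativelyRegular_offDiag hq (fun L _ _ _ => ?_)
    rw [oddBlock_map]
    exact isStaircase_oddBlock q
  · rw [eEven_eq]
    exact offDiag_mem_gMinus _
  · rw [eEven_eq]
    exact isNilpotent_offDiag (isStaircase_eStar hq).lower
  · rw [eEven_eq]
    exact (isStaircase_eStar hq).finrank_gMinusCentralizer hq (Or.inr rfl)
  · rw [eEven_eq, offDiag_map, eStar_map]
    refine isRelativelyRegular_offDiag hq (fun L _ _ _ => ?_)
    rw [eStar_map]
    exact isStaircase_eStar hq
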